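/- Let $T=(\mathbb C^*)^3$ with equivariant parameters $t_1,t_2,t_3$. For a partition $\mu$ of $n$ (a Young diagram with cells $(i,j)$, $i,j\ge 0$) put $Q_e=\sum_{(i,j)\in\mu}t_1^it_2^j$, and let $\bar{\cdot}$ be the involution $t_a\mapsto t_a^{-1}$. A restricted 3D partition $\pi$ of shape $\mu$ is the set of exponents of the monomial basis of a monomial $\mathbb C[x_1,x_2,x_3]$-submodule $M_\pi$, $O_\mu\subseteq M_\pi\subseteq M_\mu$, of $M_\mu=\mathbb C[x_1,x_2]/I_\mu\otimes\mathbb C[x_3^{\pm1}]$ containing $O_\mu=\mathbb C[x_1,x_2]/I_\mu\otimes\mathbb C[x_3]$, with $|\pi|:=\dim M_\pi/O_\mu<\infty$. Let $Q_v$ be the character of $M_\pi/O_\mu$, $F_v=Q_v+\frac{Q_e}{1-t_3}$, and $$F_e=-Q_e-\frac{\overline{Q}_e}{t_1t_2}+Q_e\overline{Q}_e\frac{(1-t_1)(1-t_2)}{t_1t_2},\qquad V(\pi)=F_v-\frac{\overline F_v}{t_1t_2t_3}+F_v\overline F_v\frac{(1-t_1)(1-t_2)(1-t_3)}{t_1t_2t_3}+\frac{F_e}{1-t_3},$$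 which is a Laurent polynomial. Let $\mathrm{Exp}(\sum a_{ijk}t_1^it_2^jt_3^k)=\prod(it_1+jt_2+kt_3)^{a_{ijk}}$, let $e_\mu=\mathrm{Exp}(-F_e)$ be the Euler class of the tangent space of $\mathrm{Hilb}_n(\mathbb C^2)$ at $\mu$, and let $\mathrm{ch}_k(\pi)$ be the coefficient of $z^k$ in $(1-e^{t_1z})(1-e^{t_2z})(1-e^{t_3z})\sum_{(i,j,l)\in\pi}e^{(it_1+jt_2+lt_3)z}$ (infinite columns being summed as geometric series). For $k_1,\dots,k_m\ge 0$ and $\omega\in H_T^*(\mathrm{Hilb}_n(\mathbb C^2))$ with restrictions $\omega(\mu)$ to the fixed points, the bare one-leg PT descendent vertex is $$\mathrm Z^{\mathrm{bare}}_{\mathrm{PT}}\Big(\prod_r\mathrm{ch}_{k_r}\Big|\omega\Big)=\sum_{|\mu|=n}\frac{\omega(\mu)}{e_\mu}\sum_{\pi}q^{|\pi|}\,\mathrm{Exp}(-V(\pi))\prod_r\mathrm{ch}_{k_r}(\pi)\in\mathbb C(t_1,t_2,t_3)[[q]],$$ where $\pi$ runs over the restricted 3D partitions of shape $\mu$. Theorem.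 For every integer $c\ge 0$ (in particular for every positive integer $c$), all $n,m\ge 0$, all $k_1,\dots,k_m\ge 0$ and all $\omega\in H_T^*(\mathrm{Hilb}_n(\mathbb C^2))$, the specialization $t_1+t_2=ct_3$ of $\mathrm Z^{\mathrm{bare}}_{\mathrm{PT}}(\prod_r\mathrm{ch}_{k_r}|\omega)$ is well defined (every coefficient of the $q$-expansion is regular at the generic point of the plane $t_1+t_2=ct_3$), and the resulting power series in $q$, with coefficients in the field of rational functions on that plane, is the $q$-expansion of a rational function of $q$. -/

import Mathlib

noncomputable section

namespace PTVertex

/-! ### Equivariant parameters -/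

/-- The equivariant cohomology `H_T^*(pt) = ℂ[t₁, t₂, t₃]` of a point, `T = (ℂ^*)³`. -/
abbrev CohPt : Type := MvPolynomial (Fin 3) ℂ

/-- The field `ℂ(t₁, t₂, t₃)`. -/
abbrev CohFrac : Type := FractionRing CohPt

/-- The equivariant parameter `t₁`, `t₂`, `t₃` (indices `0`, `1`, `2`) in `ℂ(t₁, t₂, t₃)`. -/
def t (a : Fin 3) : CohFrac := algebraMap CohPt CohFrac (MvPolynomial.X a)

/-! ### Characters of the torus and the plethystic exponential -/

/-- Characters of virtual representations of `T`: the ring `ℤ[t₁^±¹, t₂^±¹, t₃^±¹]`. The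
exponent vector `(i, j, k)` stands for the weight `t₁^i t₂^j t₃^k`. -/
abbrev Char : Type := AddMonoidAlgebra ℤ (ℤ × ℤ × ℤ)

/-- The monomial `t₁^i t₂^j t₃^k`. -/
def mono (i j k : ℤ) : Char := AddMonoidAlgebra.single (i, j, k) 1

/-- The involution `t_a ↦ t_a⁻¹` of the ring of characters. -/
def conj : Char →+* Char := AddMonoidAlgebra.mapDomainRingHom ℤ (-AddMonoidHom.id (ℤ × ℤ × ℤ))

/-- The linear form `i t₁ + j t₂ + k t₃`. -/
def weight (v : ℤ × ℤ × ℤ) : CohFrac := v.1 * t 0 + v.2.1 * t 1 + v.2.2 * t 2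

/-- The plethystic exponential
`Exp(∑ a_{ijk} t₁^i t₂^j t₃^k) = ∏ (i t₁ + j t₂ + k t₃)^{a_{ijk}}`. -/
def Exp (f : Char) : CohFrac := f.coeff.prod fun v a => weight v ^ a

/-! ### Torus fixed points -/

/-- Partitions of `n`, as Young diagrams: the torus fixed points of `Hilb_n(ℂ²)`. -/
abbrev Part (n : ℕ) : Type := {μ : YoungDiagram // μ.card = n}

instance finite_part (n : ℕ) : Finite (Part n) := by
  let S : Finset (Finset (ℕ × ℕ)) := (Finset.range n ×ˢ Finset.range n).powerset
  have hS : ∀ μ : Part n, μ.1.cells ∈ S := by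
    rintro ⟨μ, hμ⟩
    simp only [S, Finset.mem_powerset]
    rintro ⟨i, j⟩ hij
    have h1 : (Finset.range (i + 1)).image (fun a => (a, j)) ⊆ μ.cells := by
      intro x hx
      simp only [Finset.mem_image, Finset.mem_range] at hx
      obtain ⟨a, ha, rfl⟩ := hx
      exact μ.up_left_mem (by omega) le_rfl hij
    have h2 : (Finset.range (j + 1)).image (fun b => (i, b)) ⊆ μ.cells := by
      intro x hx
      simp only [Finset.mem_image, Finset.mem_range] at hx
      obtain ⟨a, ha, rfl⟩ := hx
      exact μ.up_left_mem le_rfl (by omega) hij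
    have c1 := Finset.card_le_card h1
    have c2 := Finset.card_le_card h2
    rw [Finset.card_image_of_injective _ (fun a b h => by simpa using h), Finset.card_range] at c1
    rw [Finset.card_image_of_injective _ (fun a b h => by simpa using h), Finset.card_range] at c2
    have hc : μ.cells.card = n := hμ
    simp only [Finset.mem_product, Finset.mem_range]
    omega
  refine Finite.of_injective (fun μ : Part n => (⟨μ.1.cells, hS μ⟩ : S)) ?_
  intro μ ν h
  simp only [Subtype.mk.injEq] at h
  exact Subtype.ext (YoungDiagram.ext h)

instance fintype_part (n : ℕ) : Fintype (Part n) := Fintype.ofFinite _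

/-- `B` is the set of exponents of the monomial basis of `M_π / O_μ` for a monomial
`ℂ[x₁, x₂, x₃]`-submodule `O_μ ⊆ M_π ⊆ M_μ` with `M_π / O_μ` finite dimensional, where
`M_μ = ℂ[x₁, x₂] / I_μ ⊗ ℂ[x₃, x₃⁻¹]` and `O_μ = ℂ[x₁, x₂] / I_μ ⊗ ℂ[x₃]`.
So `B` consists of exponents `(i, j, l)` of the cylinder over `μ` with `l < 0`, and it is closed
under multiplication by `x₁`, `x₂`, `x₃` in `M_μ / O_μ`. These are the restricted 3D partitions
of shape `μ`. -/
structure IsRestricted (μ : YoungDiagram) (B : Finset (ℕ × ℕ × ℤ)) : Prop where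
  cyl : ∀ i j l, (i, j, l) ∈ B → (i, j) ∈ μ ∧ l < 0
  mul_x₁ : ∀ i j l, (i, j, l) ∈ B → (i + 1, j) ∈ μ → (i + 1, j, l) ∈ B
  mul_x₂ : ∀ i j l, (i, j, l) ∈ B → (i, j + 1) ∈ μ → (i, j + 1, l) ∈ B
  mul_x₃ : ∀ i j l, (i, j, l) ∈ B → l + 1 < 0 → (i, j, l + 1) ∈ B

theorem IsRestricted.upward {μ : YoungDiagram} {B : Finset (ℕ × ℕ × ℤ)} (h : IsRestricted μ B)
    {i j : ℕ} {l : ℤ} (hl : (i, j, l) ∈ B) (s : ℕ) (hs : l + s < 0) : (i, j, l + s) ∈ B := by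
  induction s with
  | zero => simpa using hl
  | succ s ih =>
    have := h.mul_x₃ i j (l + s) (ih (by push_cast at hs; omega)) (by push_cast at hs; omega)
    simpa [add_assoc] using this

theorem finite_restricted (μ : YoungDiagram) (d : ℕ) :
    {B : Finset (ℕ × ℕ × ℤ) | IsRestricted μ B ∧ B.card = d}.Finite := by
  let big : Finset (ℕ × ℕ × ℤ) :=
    (μ.cells ×ˢ Finset.Icc (-(d : ℤ)) 0).image fun x => (x.1.1, x.1.2, x.2)
  refine (big.powerset.finite_toSet).subset ?_
  rintro B ⟨hB, hd⟩
  simp only [Finset.coe_powerset, Set.mem_preimage, Set.mem_powerset_iff, Finset.coe_subset]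
  rintro ⟨i, j, l⟩ hx
  obtain ⟨hij, hl⟩ := hB.cyl i j l hx
  have hsub : (Finset.range (-l).toNat).image (fun s : ℕ => (i, j, l + (s : ℤ))) ⊆ B := by
    intro y hy
    simp only [Finset.mem_image, Finset.mem_range] at hy
    obtain ⟨s, hs, rfl⟩ := hy
    exact hB.upward hx s (by omega)
  have hc := Finset.card_le_card hsub
  rw [Finset.card_image_of_injective _ (fun a b h => by simpa using h), Finset.card_range] at hc
  simp only [big, Finset.mem_image, Finset.mem_product, Finset.mem_Icc]
  exact ⟨((i, j), l), ⟨hij, by omega, by omega⟩, rfl⟩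

/-- The restricted 3D partitions of shape `μ` and size `d`. -/
def restricted (μ : YoungDiagram) (d : ℕ) : Finset (Finset (ℕ × ℕ × ℤ)) :=
  (finite_restricted μ d).toFinset

/-! ### Localization weights -/

/-- `Q_e(μ) = ∑_{(i,j) ∈ μ} t₁^i t₂^j`. -/
def Qe (μ : YoungDiagram) : Char := ∑ c ∈ μ.cells, mono c.1 c.2 0

/-- `Q_v(π)`, the character of `M_π / O_μ`. -/
def Qv (B : Finset (ℕ × ℕ × ℤ)) : Char := ∑ b ∈ B, mono b.1 b.2.1 b.2.2

/-- The edge character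
`F_e = - Q_e - Q̄_e / (t₁ t₂) + Q_e Q̄_e (1 - t₁) (1 - t₂) / (t₁ t₂)`. -/
def Fe (μ : YoungDiagram) : Char :=
  - Qe μ - conj (Qe μ) * mono (-1) (-1) 0
    + Qe μ * conj (Qe μ) * ((1 - mono 1 0 0) * (1 - mono 0 1 0) * mono (-1) (-1) 0)

/-- The vertex character
`V = F_v - F̄_v / (t₁ t₂ t₃) + F_v F̄_v (1 - t₁) (1 - t₂) (1 - t₃) / (t₁ t₂ t₃) + F_e / (1 - t₃)`,
where `F_v = Q_v + Q_e / (1 - t₃)`, written as a Laurent polynomial by cancelling the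
denominators; see `vertexChar_spec`. -/
def vertexChar (μ : YoungDiagram) (B : Finset (ℕ × ℕ × ℤ)) : Char :=
  Qv B - conj (Qv B) * mono (-1) (-1) (-1)
    + Qv B * conj (Qv B) *
        ((1 - mono 1 0 0) * (1 - mono 0 1 0) * (1 - mono 0 0 1) * mono (-1) (-1) (-1))
    + (conj (Qv B) * Qe μ * mono 0 0 (-1) - Qv B * conj (Qe μ)) *
        ((1 - mono 1 0 0) * (1 - mono 0 1 0) * mono (-1) (-1) 0)

theorem mono_mul (i j k i' j' k' : ℤ) :
    mono i j k * mono i' j' k' = mono (i + i') (j + j') (k + k') := by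
  simp [mono, AddMonoidAlgebra.single_mul_single]

theorem mono_zero : mono 0 0 0 = 1 := rfl

theorem conj_mono (i j k : ℤ) : conj (mono i j k) = mono (-i) (-j) (-k) := by
  simp [conj, mono]

/-- The defining formula of the vertex character, multiplied by `(1 - t₃) (1 - t₃⁻¹)`. Here
`N = (1 - t₃) F_v`, so that `N̄ = (1 - t₃⁻¹) F̄_v`. -/
theorem vertexChar_spec (μ : YoungDiagram) (B : Finset (ℕ × ℕ × ℤ)) (N : Char)
    (hN : N = (1 - mono 0 0 1) * Qv B + Qe μ) :
    (1 - mono 0 0 1) * (1 - mono 0 0 (-1)) * vertexChar μ B =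
      (1 - mono 0 0 (-1)) * N - (1 - mono 0 0 1) * conj N * mono (-1) (-1) (-1)
        + N * conj N *
          ((1 - mono 1 0 0) * (1 - mono 0 1 0) * (1 - mono 0 0 1) * mono (-1) (-1) (-1))
        + (1 - mono 0 0 (-1)) * Fe μ := by
  subst hN
  have h3 : mono 0 0 1 * mono 0 0 (-1) = 1 := by rw [mono_mul]; rfl
  have h123 : mono (-1) (-1) (-1) = mono (-1) (-1) 0 * mono 0 0 (-1) := by rw [mono_mul]; rfl
  simp only [vertexChar, Fe, map_add, map_mul, map_sub, map_one, conj_mono, h123, neg_zero]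
  generalize conj (Qv B) = q'
  generalize conj (Qe μ) = e'
  generalize Qv B = q
  generalize Qe μ = e
  generalize mono 0 0 1 = z at *
  generalize mono 0 0 (-1) = z' at *
  generalize mono (-1) (-1) 0 = w
  generalize mono 1 0 0 = x
  generalize mono 0 1 0 = y
  grind

/-- The localization weight `Exp(-V)` of a restricted 3D partition. -/
def vertexWeight (μ : YoungDiagram) (B : Finset (ℕ × ℕ × ℤ)) : CohFrac := Exp (-vertexChar μ B)

/-- The Euler class `e_μ` of the tangent space of `Hilb_n(ℂ²)` at the fixed point `μ`, the
character of this tangent space being `-F_e`. -/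
def eulerHilb (μ : YoungDiagram) : CohFrac := Exp (-Fe μ)

/-! ### Descendents and insertions -/

/-- The power series `e^{w z}` in `z`. -/
def expSeries (w : CohFrac) : PowerSeries CohFrac := PowerSeries.rescale w (PowerSeries.exp CohFrac)

/-- The generating series in `z` of the descendents at a restricted 3D partition `π`,
`ch(π)[z] = (1 - e^{t₁ z}) (1 - e^{t₂ z}) (1 - e^{t₃ z}) ∑_{(i,j,l) ∈ π} e^{(i t₁ + j t₂ + l t₃) z}`.
The set `π` is the union of `B` and of the half-infinite columns `{(i, j, l) | l ≥ 0}`,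
`(i, j) ∈ μ`; the sum over such a column is `e^{(i t₁ + j t₂) z} / (1 - e^{t₃ z})`. -/
def chSeries (μ : YoungDiagram) (B : Finset (ℕ × ℕ × ℤ)) : PowerSeries CohFrac :=
  (1 - expSeries (t 0)) * (1 - expSeries (t 1)) *
    ((1 - expSeries (t 2)) * ∑ b ∈ B, expSeries (weight (b.1, b.2.1, b.2.2))
      + ∑ c ∈ μ.cells, expSeries (weight (c.1, c.2, 0)))

/-- The restriction of the descendent `ch_k` to a restricted 3D partition. -/
def ch (k : ℕ) (μ : YoungDiagram) (B : Finset (ℕ × ℕ × ℤ)) : CohFrac :=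
  PowerSeries.coeff k (chSeries μ B)

/-- The restrictions to the fixed points `μ` of the Chern class `c_r` of the tautological bundle
`O^[n]`, whose Chern roots at `μ` are the contents `i t₁ + j t₂`, `(i, j) ∈ μ`. -/
def chern (n r : ℕ) : Part n → CohFrac :=
  fun μ => (μ.1.cells.val.map fun c => weight (c.1, c.2, 0)).esymm r

/-- `H_T^*(Hilb_n(ℂ²))`, as a ring of functions on the fixed points: restriction to the fixed
points is injective, and the ring is generated over `H_T^*(pt)` by the Chern classes of the
tautological bundle. -/
def cohHilb (n : ℕ) : Subalgebra CohPt (Part n → CohFrac) :=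
  Algebra.adjoin CohPt (Set.range (chern n))

/-- The bare one-leg PT vertex with descendents
`Z(∏_r ch_{i_r} | ω) = ∑_{|μ| = n} ω(μ) / e_μ ∑_π q^{|π|} Exp(-V(π)) ∏_r ch_{i_r}(π)`,
a power series in `q` over `ℂ(t₁, t₂, t₃)`; `π` runs over the restricted 3D partitions of
shape `μ`. -/
def bareVertex {n m : ℕ} (i : Fin m → ℕ) (ω : cohHilb n) : PowerSeries CohFrac :=
  PowerSeries.mk fun d =>
    ∑ μ : Part n, ω.1 μ / eulerHilb μ.1 *
      ∑ B ∈ restricted μ.1 d, vertexWeight μ.1 B * ∏ r, ch (i r) μ.1 B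

/-! ### Specialization of the parameters -/

/-- The field of rational functions on the plane `t₁ + t₂ = c t₃`, in the coordinates
`x = t₁` (index `0`), `y = t₃` (index `1`). -/
abbrev PlaneFrac : Type := FractionRing (MvPolynomial (Fin 2) ℂ)

/-- Restriction of polynomials to the plane `t₁ + t₂ = c t₃`, that is
`t₁ ↦ x`, `t₂ ↦ c y - x`, `t₃ ↦ y`. -/
def restrictPlane (c : ℕ) : CohPt →ₐ[ℂ] MvPolynomial (Fin 2) ℂ :=
  MvPolynomial.aeval
    ![MvPolynomial.X 0, (c : MvPolynomial (Fin 2) ℂ) * MvPolynomial.X 1 - MvPolynomial.X 0,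
      MvPolynomial.X 1]

/-- The rational function `f` in `t₁, t₂, t₃` has a specialization to (the generic point of) the
plane `t₁ + t₂ = c t₃`, and the specialization is `g`. -/
def SpecializesTo (c : ℕ) (f : CohFrac) (g : PlaneFrac) : Prop :=
  ∃ a b : CohPt, restrictPlane c b ≠ 0 ∧
    f = algebraMap CohPt CohFrac a / algebraMap CohPt CohFrac b ∧
    g = algebraMap (MvPolynomial (Fin 2) ℂ) PlaneFrac (restrictPlane c a) /
      algebraMap (MvPolynomial (Fin 2) ℂ) PlaneFrac (restrictPlane c b)

theorem SpecializesTo.unique {c : ℕ} {f : CohFrac} {g g' : PlaneFrac}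
    (h : SpecializesTo c f g) (h' : SpecializesTo c f g') : g = g' := by
  obtain ⟨a, b, hb, hf, rfl⟩ := h
  obtain ⟨a', b', hb', hf', rfl⟩ := h'
  have hinj := IsFractionRing.injective CohPt CohFrac
  have hinj₂ := IsFractionRing.injective (MvPolynomial (Fin 2) ℂ) PlaneFrac
  have nb : algebraMap CohPt CohFrac b ≠ 0 := fun h0 => hb (by
    rw [(map_eq_zero_iff _ hinj).1 h0, map_zero])
  have nb' : algebraMap CohPt CohFrac b' ≠ 0 := fun h0 => hb' (by
    rw [(map_eq_zero_iff _ hinj).1 h0, map_zero])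
  rw [hf, div_eq_div_iff nb nb', ← map_mul, ← map_mul] at hf'
  have key := congrArg (restrictPlane c) (hinj hf')
  rw [map_mul, map_mul] at key
  rw [div_eq_div_iff (by rwa [Ne, map_eq_zero_iff _ hinj₂]) (by rwa [Ne, map_eq_zero_iff _ hinj₂]),
    ← map_mul (algebraMap _ PlaneFrac), ← map_mul (algebraMap _ PlaneFrac), key]

end PTVertex

end

noncomputable section

namespace PTVertex

section

open Finset

/-! ### Antisymmetrization -/

section Symmetrization

variable {ι : Type*} {n : ι → ℕ} {K : Type*} [Field K]

/-- A function on `∏ r, S_{n r}` given by a polynomial of degree at most `k` in the values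
`σ r p`. -/
def PolyDeg (K : Type*) [Field K] (n : ι → ℕ) (k : ℕ)
    (Φ : (∀ r, Equiv.Perm (Fin (n r))) → K) : Prop :=
  ∃ P : MvPolynomial (Σ r, Fin (n r)) K, P.totalDegree ≤ k ∧
    ∀ σ, Φ σ = MvPolynomial.eval (fun x => ((σ x.1 x.2 : ℕ) : K)) P

theorem PolyDeg.const (k : ℕ) (a : K) :
    PolyDeg K n k (fun _ : ∀ r, Equiv.Perm (Fin (n r)) => a) :=
  ⟨MvPolynomial.C a, by simp, by simp⟩

theorem PolyDeg.coord (r : ι) (p : Fin (n r)) :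
    PolyDeg K n 1 (fun σ => ((σ r p : ℕ) : K)) :=
  ⟨MvPolynomial.X ⟨r, p⟩, by simp, by simp⟩

theorem PolyDeg.add {k : ℕ} {Φ Ψ : (∀ r, Equiv.Perm (Fin (n r))) → K}
    (h : PolyDeg K n k Φ) (h' : PolyDeg K n k Ψ) : PolyDeg K n k (fun σ => Φ σ + Ψ σ) := by
  obtain ⟨P, hP, hΦ⟩ := h
  obtain ⟨Q, hQ, hΨ⟩ := h'
  exact ⟨P + Q, (MvPolynomial.totalDegree_add _ _).trans (max_le hP hQ), by simp [hΦ, hΨ]⟩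

theorem PolyDeg.mul {k l : ℕ} {Φ Ψ : (∀ r, Equiv.Perm (Fin (n r))) → K}
    (h : PolyDeg K n k Φ) (h' : PolyDeg K n l Ψ) : PolyDeg K n (k + l) (fun σ => Φ σ * Ψ σ) := by
  obtain ⟨P, hP, hΦ⟩ := h
  obtain ⟨Q, hQ, hΨ⟩ := h'
  exact ⟨P * Q, (MvPolynomial.totalDegree_mul _ _).trans (add_le_add hP hQ), by simp [hΦ, hΨ]⟩

theorem PolyDeg.const_mul {k : ℕ} {Φ : (∀ r, Equiv.Perm (Fin (n r))) → K} (a : K)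
    (h : PolyDeg K n k Φ) : PolyDeg K n k (fun σ => a * Φ σ) := by
  simpa using (PolyDeg.const 0 a).mul h

theorem PolyDeg.neg {k : ℕ} {Φ : (∀ r, Equiv.Perm (Fin (n r))) → K}
    (h : PolyDeg K n k Φ) : PolyDeg K n k (fun σ => -Φ σ) := by
  simpa using h.const_mul (-1)

theorem PolyDeg.sub {k : ℕ} {Φ Ψ : (∀ r, Equiv.Perm (Fin (n r))) → K}
    (h : PolyDeg K n k Φ) (h' : PolyDeg K n k Ψ) : PolyDeg K n k (fun σ => Φ σ - Ψ σ) := by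
  simpa [sub_eq_add_neg] using h.add h'.neg

theorem PolyDeg.sum {α : Type*} {k : ℕ} (s : Finset α)
    {Φ : α → (∀ r, Equiv.Perm (Fin (n r))) → K} (h : ∀ a ∈ s, PolyDeg K n k (Φ a)) :
    PolyDeg K n k (fun σ => ∑ a ∈ s, Φ a σ) := by
  classical
  induction s using Finset.induction_on with
  | empty => simpa using PolyDeg.const (n := n) k (0 : K)
  | insert a s ha ih =>
    simp only [Finset.sum_insert ha]
    exact (h a (by simp)).add (ih fun b hb => h b (by simp [hb]))

theorem PolyDeg.prod {α : Type*} (s : Finset α) {k : α → ℕ}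
    {Φ : α → (∀ r, Equiv.Perm (Fin (n r))) → K} (h : ∀ a ∈ s, PolyDeg K n (k a) (Φ a)) :
    PolyDeg K n (∑ a ∈ s, k a) (fun σ => ∏ a ∈ s, Φ a σ) := by
  classical
  induction s using Finset.induction_on with
  | empty => simpa using PolyDeg.const (n := n) 0 (1 : K)
  | insert a s ha ih =>
    simp only [Finset.prod_insert ha, Finset.sum_insert ha]
    exact (h a (by simp)).mul (ih fun b hb => h b (by simp [hb]))

variable [Fintype ι]

/-- The product of the signs. -/
def sgn (σ : ∀ r, Equiv.Perm (Fin (n r))) : ℤ := ∏ r, (Equiv.Perm.sign (σ r) : ℤ)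

theorem choose_two_le_sum_of_injective {N : ℕ} (m : Fin N → ℕ) (hm : Function.Injective m) :
    N.choose 2 ≤ ∑ p, m p := by
  have h := Finset.sum_range_le_sum (s := univ.image fun p => (m p : ℤ)) (c := 0) (by simp)
  have hinj : Function.Injective fun p => (m p : ℤ) := fun p q h => hm (by simpa using h)
  rw [sum_image (fun a _ b _ h => hinj h), card_image_of_injective _ hinj, card_univ,
    Fintype.card_fin] at h
  rw [Nat.choose_two_right, ← Finset.sum_range_id]
  zify
  simpa using h

theorem sum_sgn_mul_monomial [DecidableEq ι] (m : (Σ r, Fin (n r)) →₀ ℕ)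
    (hm : ∑ x, m x < ∑ r, (n r).choose 2) :
    ∑ σ : ∀ r, Equiv.Perm (Fin (n r)),
      ((sgn σ : ℤ) : K) * ∏ x : Σ r, Fin (n r), ((σ x.1 x.2 : ℕ) : K) ^ m x = 0 := by
  obtain ⟨r, hr⟩ : ∃ r, ∑ p, m ⟨r, p⟩ < (n r).choose 2 := by
    by_contra! hcon
    rw [Fintype.sum_sigma] at hm
    exact absurd (Finset.sum_le_sum fun r _ => hcon r) (by simpa using hm)
  obtain ⟨p, q, hpq, hne⟩ : ∃ p q, m ⟨r, p⟩ = m ⟨r, q⟩ ∧ p ≠ q := by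
    by_contra! hcon
    exact absurd (choose_two_le_sum_of_injective (fun p => m ⟨r, p⟩) fun p q h => hcon p q h)
      (by simpa using hr)
  refine Finset.sum_involution
    (fun σ _ => Function.update σ r (σ r * Equiv.swap p q)) ?_ ?_ (by simp) ?_
  · intro σ _
    have h1 : sgn (Function.update σ r (σ r * Equiv.swap p q)) = - sgn σ := by
      unfold sgn
      rw [← Finset.mul_prod_erase univ _ (mem_univ r), ← Finset.mul_prod_erase univ
        (fun r => (Equiv.Perm.sign (σ r) : ℤ)) (mem_univ r)]
      have : ∏ x ∈ univ.erase r, (Equiv.Perm.sign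
          (Function.update σ r (σ r * Equiv.swap p q) x) : ℤ) =
          ∏ x ∈ univ.erase r, (Equiv.Perm.sign (σ x) : ℤ) := by
        refine prod_congr rfl fun x hx => ?_
        rw [Function.update_of_ne (ne_of_mem_erase hx)]
      rw [this]
      simp [Equiv.Perm.sign_swap hne]
    have h2 : ∏ x : Σ r, Fin (n r),
        ((Function.update σ r (σ r * Equiv.swap p q) x.1 x.2 : ℕ) : K) ^ m x =
        ∏ x : Σ r, Fin (n r), ((σ x.1 x.2 : ℕ) : K) ^ m x := by
      rw [Fintype.prod_sigma, Fintype.prod_sigma]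
      refine prod_congr rfl fun s _ => ?_
      by_cases hs : s = r
      · subst hs
        simp only [Function.update_self, Equiv.Perm.coe_mul, Function.comp_apply]
        rw [← Equiv.prod_comp (Equiv.swap p q)]
        refine prod_congr rfl fun x _ => ?_
        rw [Equiv.swap_apply_self]
        congr 1
        rcases eq_or_ne x p with rfl | hx
        · simp [hpq]
        rcases eq_or_ne x q with rfl | hx'
        · simp [hpq]
        rw [Equiv.swap_apply_of_ne_of_ne hx hx']
      · refine prod_congr rfl fun x _ => ?_
        simp [Function.update_of_ne hs]
    rw [h1, h2]
    push_cast
    ring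
  · intro σ _ _ h
    have := congrFun h r
    simp only [Function.update_self] at this
    have h3 : Equiv.swap p q = 1 := by simpa using this
    exact hne (Equiv.swap_eq_one_iff.1 h3)
  · intro σ _
    funext s
    by_cases hs : s = r
    · subst hs
      simp [mul_assoc]
    · simp [Function.update_of_ne hs]

theorem sum_sgn_mul_eq_zero [DecidableEq ι] {k : ℕ} {Φ : (∀ r, Equiv.Perm (Fin (n r))) → K}
    (h : PolyDeg K n k Φ) (hk : k < ∑ r, (n r).choose 2) :
    ∑ σ, ((sgn σ : ℤ) : K) * Φ σ = 0 := by
  obtain ⟨P, hP, hΦ⟩ := h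
  simp only [hΦ, MvPolynomial.eval_eq', Finset.mul_sum]
  rw [Finset.sum_comm]
  refine Finset.sum_eq_zero fun m hm => ?_
  have h1 : ∑ x, m x < ∑ r, (n r).choose 2 := by
    refine lt_of_le_of_lt ?_ hk
    refine le_trans ?_ hP
    have := MvPolynomial.le_totalDegree hm
    rwa [Finsupp.sum_fintype _ _ (by simp)] at this
  have h2 := sum_sgn_mul_monomial (K := K) m h1
  calc _ = MvPolynomial.coeff m P * ∑ σ : ∀ r, Equiv.Perm (Fin (n r)),
      ((sgn σ : ℤ) : K) * ∏ x : Σ r, Fin (n r), ((σ x.1 x.2 : ℕ) : K) ^ m x := by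
        rw [Finset.mul_sum]
        exact sum_congr rfl fun σ _ => by ring
    _ = 0 := by rw [h2, mul_zero]

/-- The pairs of slots with values in strictly decreasing order. -/
def descents {N : ℕ} (v : Fin N → ℤ) : Finset (Fin N × Fin N) :=
  univ.filter fun x => v x.2 < v x.1

/-- The pairs of slots `p < q` with equal values. -/
def ties {N : ℕ} (v : Fin N → ℤ) : Finset (Fin N × Fin N) :=
  univ.filter fun x => x.1 < x.2 ∧ v x.1 = v x.2

theorem prod_pairs {N : ℕ} {R : Type*} [CommRing R] (F : Fin N → Fin N → R) (v : Fin N → ℤ) :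
    (∏ x ∈ descents v, F x.1 x.2) * ∏ x ∈ ties v, F x.1 x.2 =
      ∏ i, ∏ j ∈ Ioi i, if v i < v j then F j i else F i j := by
  have h0 : ∏ x ∈ descents v, F x.1 x.2 =
      ∏ i, ∏ j ∈ {i}ᶜ, if v i < v j then F j i else 1 := by
    rw [descents, prod_filter, ← univ_product_univ, prod_product_right]
    refine prod_congr rfl fun i _ => ?_
    refine (prod_subset (subset_univ _) fun j _ hj => ?_).symm
    simp only [mem_compl, mem_singleton, not_not] at hj
    simp [hj]
  have h1 : ∏ x ∈ ties v, F x.1 x.2 =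
      ∏ i, ∏ j ∈ Ioi i, if v i = v j then F i j else 1 := by
    rw [ties, prod_filter, ← univ_product_univ, prod_product]
    refine prod_congr rfl fun i _ => ?_
    refine (prod_subset (subset_univ (Ioi i)) fun j _ hj => ?_).symm.trans
      (prod_congr rfl fun j hj => ?_)
    · simp only [mem_Ioi] at hj
      simp [hj]
    · simp only [mem_Ioi] at hj
      simp [hj]
  rw [h0, h1, ← Finset.prod_prod_Ioi_mul_eq_prod_prod_off_diag
    (fun j i => if v i < v j then F j i else 1), ← prod_mul_distrib]
  refine prod_congr rfl fun i _ => ?_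
  rw [← prod_mul_distrib]
  refine prod_congr rfl fun j _ => ?_
  rcases lt_trichotomy (v i) (v j) with h | h | h
  · simp [h, h.not_gt, h.ne]
  · simp [h]
  · simp [h, h.not_gt, h.ne']

theorem card_descents_add_card_ties {N : ℕ} (v : Fin N → ℤ) :
    (descents v).card + (ties v).card = N.choose 2 := by
  have h := prod_pairs (fun _ _ => (Polynomial.X : Polynomial ℤ)) v
  simp only [ite_self, prod_const, ← pow_add, Fin.card_Ioi] at h
  have h2 := congrArg Polynomial.natDegree h
  rw [Finset.prod_pow_eq_pow_sum, Polynomial.natDegree_X_pow, Polynomial.natDegree_X_pow] at h2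
  rw [h2, Nat.choose_two_right, ← Finset.sum_range_id, ← Finset.sum_range_reflect,
    Fin.sum_univ_eq_sum_range (fun i => N - 1 - i)]

theorem exists_prod_descents_mul_prod_ties {N : ℕ} [CharZero K] (v : Fin N → ℤ) :
    ∃ a : K, a ≠ 0 ∧ ∀ s : Equiv.Perm (Fin N),
      (∏ x ∈ descents v, (((s x.2 : ℕ) : K) - ((s x.1 : ℕ) : K))) *
        ∏ x ∈ ties v, (((s x.2 : ℕ) : K) - ((s x.1 : ℕ) : K)) =
      a * ((Equiv.Perm.sign s : ℤ) : K) := by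
  refine ⟨(∏ i, ∏ j ∈ Ioi i, if v i < v j then (-1 : K) else 1) *
    ∏ i : Fin N, ∏ j ∈ Ioi i, (((j : ℕ) : K) - ((i : ℕ) : K)), ?_, fun s => ?_⟩
  · refine mul_ne_zero (prod_ne_zero_iff.2 fun i _ => prod_ne_zero_iff.2 fun j _ => ?_)
      (prod_ne_zero_iff.2 fun i _ => prod_ne_zero_iff.2 fun j hj => ?_)
    · split_ifs <;> simp
    · rw [sub_ne_zero, Ne, Nat.cast_inj]
      have := mem_Ioi.1 hj
      exact fun h => (Fin.lt_def.1 this).ne' h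
  · have hs := (Equiv.Perm.prod_Ioi_comp_eq_sign_mul_prod (R := K) s
      (f := fun i j : Fin N => ((j : ℕ) : K) - ((i : ℕ) : K)) (by intro i j; ring)).symm
    rw [prod_pairs (fun i j => ((s j : ℕ) : K) - ((s i : ℕ) : K)) v, mul_assoc,
      mul_comm _ (((Equiv.Perm.sign s : ℤ) : K)), hs, ← prod_mul_distrib]
    refine prod_congr rfl fun i _ => ?_
    rw [← prod_mul_distrib]
    refine prod_congr rfl fun j _ => ?_
    split_ifs <;> ring

/-- The denominator of the symmetrization: the product over the pairs of slots with strictly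
decreasing values. -/
def descentProd (K : Type*) [Field K] (v : ∀ r, Fin (n r) → ℤ)
    (σ : ∀ r, Equiv.Perm (Fin (n r))) : K :=
  ∏ r, ∏ x ∈ descents (v r), (((σ r x.2 : ℕ) : K) - ((σ r x.1 : ℕ) : K))

theorem sum_div_descentProd_eq_zero [DecidableEq ι] [CharZero K] {k : ℕ}
    {Φ : (∀ r, Equiv.Perm (Fin (n r))) → K} (h : PolyDeg K n k Φ) (v : ∀ r, Fin (n r) → ℤ)
    (hk : k < ∑ r, (descents (v r)).card) :
    ∑ σ, Φ σ / descentProd K v σ = 0 := by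
  choose a ha0 ha using fun r => exists_prod_descents_mul_prod_ties (K := K) (v r)
  set S : (∀ r, Equiv.Perm (Fin (n r))) → K := fun σ =>
    ∏ r, ∏ x ∈ ties (v r), (((σ r x.2 : ℕ) : K) - ((σ r x.1 : ℕ) : K)) with hS
  have hprod : ∀ σ, descentProd K v σ * S σ = (∏ r, a r) * ((sgn σ : ℤ) : K) := by
    intro σ
    rw [hS, descentProd, ← prod_mul_distrib, sgn]
    push_cast
    rw [← prod_mul_distrib]
    exact prod_congr rfl fun r _ => ha r (σ r)
  have ha' : (∏ r, a r) ≠ 0 := prod_ne_zero_iff.2 fun r _ => ha0 r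
  have hsq : ∀ σ : ∀ r, Equiv.Perm (Fin (n r)), ((sgn σ : ℤ) : K) * ((sgn σ : ℤ) : K) = 1 := by
    intro σ
    rw [← Int.cast_mul, sgn, ← prod_mul_distrib]
    simp [← Units.val_mul]
  have key : ∀ σ, Φ σ / descentProd K v σ =
      (∏ r, a r)⁻¹ * (((sgn σ : ℤ) : K) * (Φ σ * S σ)) := by
    intro σ
    have h0 : descentProd K v σ ≠ 0 := by
      intro h0
      have := hprod σ
      rw [h0, zero_mul] at this
      have h1 := hsq σ
      rcases mul_eq_zero.1 this.symm with h2 | h2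
      · exact ha' h2
      · rw [h2] at h1; simp at h1
    rw [div_eq_iff h0]
    field_simp
    calc Φ σ * ∏ r, a r = Φ σ * (((∏ r, a r) * ((sgn σ : ℤ) : K)) * ((sgn σ : ℤ) : K)) := by
          rw [mul_assoc (∏ r, a r), hsq, mul_one]
      _ = _ := by rw [← hprod]; ring
  simp only [key]
  rw [← Finset.mul_sum, sum_sgn_mul_eq_zero (k := k + ∑ r, (ties (v r)).card), mul_zero]
  · refine h.mul ?_
    refine PolyDeg.prod (k := fun r => (ties (v r)).card) univ fun r _ => ?_
    have := PolyDeg.prod (ties (v r)) (k := fun _ => 1)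
      (Φ := fun x (σ : ∀ r, Equiv.Perm (Fin (n r))) => ((σ r x.2 : ℕ) : K) - ((σ r x.1 : ℕ) : K))
      fun x _ => (PolyDeg.coord r x.2).sub (PolyDeg.coord r x.1)
    simpa using this
  · have : ∑ r, (n r).choose 2 = ∑ r, (descents (v r)).card + ∑ r, (ties (v r)).card := by
      rw [← sum_add_distrib]
      exact sum_congr rfl fun r _ => (card_descents_add_card_ties (v r)).symm
    omega

end Symmetrization

end

section

open Finset PowerSeries

/-! ### Filtered families of power series -/

section FilteredSeries

variable {ι : Type*} {n : ι → ℕ} {K : Type*} [Field K]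

theorem PolyDeg.exists_eq_of_zero {Φ : (∀ r, Equiv.Perm (Fin (n r))) → K}
    (h : PolyDeg K n 0 Φ) : ∃ a, ∀ σ, Φ σ = a := by
  obtain ⟨P, hP, hΦ⟩ := h
  refine ⟨MvPolynomial.coeff 0 P, fun σ => ?_⟩
  rw [hΦ, MvPolynomial.totalDegree_eq_zero_iff_eq_C.1 (Nat.le_zero.1 hP)]
  simp

/-- A family of power series whose `k`-th coefficient is polynomial of degree at most `k`. -/
def SeriesDeg (K : Type*) [Field K] (n : ι → ℕ)
    (Φ : (∀ r, Equiv.Perm (Fin (n r))) → K⟦X⟧) : Prop :=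
  ∀ k, PolyDeg K n k fun σ => coeff k (Φ σ)

theorem SeriesDeg.const (a : K⟦X⟧) :
    SeriesDeg K n fun _ : ∀ r, Equiv.Perm (Fin (n r)) => a :=
  fun k => PolyDeg.const k _

theorem SeriesDeg.linear (a : K) {b : (∀ r, Equiv.Perm (Fin (n r))) → K} (hb : PolyDeg K n 1 b) :
    SeriesDeg K n fun σ => C a + C (b σ) * X := by
  intro k
  rcases k with _ | _ | k
  · simpa using PolyDeg.const 0 a
  · simpa [coeff_C, coeff_succ_mul_X] using hb
  · simpa [coeff_C, coeff_succ_mul_X] using PolyDeg.const (k + 2) (0 : K)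

variable {Φ Ψ : (∀ r, Equiv.Perm (Fin (n r))) → K⟦X⟧}

theorem SeriesDeg.add (h : SeriesDeg K n Φ) (h' : SeriesDeg K n Ψ) :
    SeriesDeg K n fun σ => Φ σ + Ψ σ := by
  intro k
  simpa using (h k).add (h' k)

theorem SeriesDeg.mul (h : SeriesDeg K n Φ) (h' : SeriesDeg K n Ψ) :
    SeriesDeg K n fun σ => Φ σ * Ψ σ := by
  intro k
  simp only [coeff_mul]
  refine PolyDeg.sum _ fun x hx => ?_
  rw [← mem_antidiagonal.1 hx]
  exact (h x.1).mul (h' x.2)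

theorem SeriesDeg.neg (h : SeriesDeg K n Φ) : SeriesDeg K n fun σ => -Φ σ := by
  intro k
  simpa using (h k).neg

theorem SeriesDeg.prod {α : Type*} (s : Finset α)
    {F : α → (∀ r, Equiv.Perm (Fin (n r))) → K⟦X⟧} (h : ∀ a ∈ s, SeriesDeg K n (F a)) :
    SeriesDeg K n fun σ => ∏ a ∈ s, F a σ := by
  classical
  induction s using Finset.induction_on with
  | empty => simpa using SeriesDeg.const (n := n) (1 : K⟦X⟧)
  | insert a s ha ih =>
    simp only [Finset.prod_insert ha]
    exact (h a (by simp)).mul (ih fun b hb => h b (by simp [hb]))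

theorem SeriesDeg.inv (h : SeriesDeg K n Φ) : SeriesDeg K n fun σ => (Φ σ)⁻¹ := by
  obtain ⟨a, ha⟩ := (h 0).exists_eq_of_zero
  simp only [coeff_zero_eq_constantCoeff] at ha
  intro k
  induction k using Nat.strong_induction_on with
  | _ k ih =>
    by_cases hk : k = 0
    · subst hk
      simp only [coeff_zero_eq_constantCoeff, constantCoeff_inv, ha]
      exact PolyDeg.const _ _
    · have hc : ∀ σ, coeff k (Φ σ)⁻¹ = -a⁻¹ * ∑ x ∈ antidiagonal k,
          if x.2 < k then coeff x.1 (Φ σ) * coeff x.2 (Φ σ)⁻¹ else 0 := fun σ => by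
        rw [PowerSeries.coeff_inv, if_neg hk, ha]
      simp only [hc]
      refine PolyDeg.const_mul _ (PolyDeg.sum _ fun x hx => ?_)
      split_ifs with hx2
      · rw [← mem_antidiagonal.1 hx]
        exact (h x.1).mul (ih x.2 hx2)
      · exact PolyDeg.const _ _

theorem coeff_prod_one_add_pow {α : Type*} (s : Finset α) (a : α → K) (e : α → ℕ) :
    coeff (∑ i ∈ s, e i) (∏ i ∈ s, (1 + C (a i) * X : K⟦X⟧) ^ e i) = ∏ i ∈ s, a i ^ e i := by
  have h : (∏ i ∈ s, (1 + C (a i) * X : K⟦X⟧) ^ e i) =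
      ((∏ i ∈ s, (1 + Polynomial.C (a i) * Polynomial.X : Polynomial K) ^ e i : Polynomial K) :
        K⟦X⟧) := by
    rw [← Polynomial.coeToPowerSeries.ringHom_apply, map_prod]
    simp
  have h1 : ∀ i, (1 + Polynomial.C (a i) * Polynomial.X : Polynomial K).natDegree ≤ 1 := by
    intro i
    compute_degree
  rw [h, Polynomial.coeff_coe]
  clear h
  classical
  induction s using Finset.induction_on with
  | empty => simp
  | insert i s hi ih =>
    rw [prod_insert hi, sum_insert hi, prod_insert hi,
      Polynomial.coeff_mul_add_eq_of_natDegree_le, ih]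
    · have := Polynomial.coeff_pow_of_natDegree_le (m := e i) (h1 i)
      rw [mul_one] at this
      rw [this]
      simp [Polynomial.coeff_one]
    · simpa using Polynomial.natDegree_pow_le_of_le (e i) (h1 i)
    · refine (Polynomial.natDegree_prod_le _ _).trans (sum_le_sum fun j _ => ?_)
      simpa using Polynomial.natDegree_pow_le_of_le (e j) (h1 j)

theorem X_pow_dvd_sum_div_descentProd [Fintype ι] [DecidableEq ι] [CharZero K] {k m : ℕ}
    {g : (∀ r, Equiv.Perm (Fin (n r))) → K} (hg : PolyDeg K n k g) (hkm : k ≤ m)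
    (hΦ : SeriesDeg K n Φ) (v : ∀ r, Fin (n r) → ℤ) :
    (X : K⟦X⟧) ^ (∑ r, (descents (v r)).card + (m - k)) ∣
      X ^ m * ∑ σ, C (g σ / descentProd K v σ) * Φ σ := by
  set N := ∑ r, (descents (v r)).card
  have h : (X : K⟦X⟧) ^ (N - k) ∣ ∑ σ, C (g σ / descentProd K v σ) * Φ σ := by
    rw [X_pow_dvd_iff]
    intro l hl
    rw [map_sum]
    have := sum_div_descentProd_eq_zero (hg.mul (hΦ l)) v (by omega)
    rw [← this]
    refine sum_congr rfl fun σ _ => ?_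
    rw [coeff_C_mul]
    ring
  obtain ⟨P, hP⟩ := h
  rw [hP, ← mul_assoc, ← pow_add]
  exact Dvd.dvd.mul_right (pow_dvd_pow _ (by omega)) _

end FilteredSeries

end

section

open Finset

/-! ### Pairs of rows -/

/-- Numbers `d r` of rows (out of `A`) that reach the column `r`. -/
structure IsShape (A M : ℕ) (d : ℕ → ℕ) : Prop where
  zero : d 0 = A
  succ_le : ∀ r, d (r + 1) ≤ d r
  le_succ : ∀ r, d r ≤ d (r + 1) + 1
  top : d M = 0

theorem IsShape.anti {A M : ℕ} {d : ℕ → ℕ} (hd : IsShape A M d) : Antitone d :=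
  antitone_nat_of_succ_le hd.succ_le

theorem IsShape.le {A M : ℕ} {d : ℕ → ℕ} (hd : IsShape A M d) (r : ℕ) : d r ≤ A :=
  hd.zero ▸ hd.anti (Nat.zero_le r)

section Pairs

variable (c M : ℕ) (d : ℕ → ℕ) (g : ℕ → ℕ → ℤ)

def pairsT (i k : ℕ) : Finset ℕ :=
  (range M).filter fun r => i < d (r + 1) ∧ k < d (r + 1) ∧ g (r + 1) k < g (r + 1) i

def pairsY (i k : ℕ) : Finset ℕ :=
  (range M).filter fun r => i < d r ∧ k < d (r + 1) ∧ g (r + 1) k < g r i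

def pairsX (i k : ℕ) : Finset ℕ :=
  (range M).filter fun r => i < d (r + 1) ∧ k < d r ∧ g r k + c < g (r + 1) i

def pairsR (i k : ℕ) : Finset ℕ :=
  (range M).filter fun r => i < d (r + 1) ∧ k < d (r + 1) ∧ g (r + 1) k + c < g (r + 1) i

def pairsE (i k : ℕ) : Finset ℕ :=
  (range M).filter fun r => i < d (r + 1) ∧ k < d r ∧ d (r + 1) ≤ k ∧
    -(c * k : ℤ) + c < -(c * i : ℤ)

/-- The excess number of `pairsX`. -/
def excess (i k : ℕ) : ℕ :=
  (pairsX c M d g i k).card - ((pairsR c M d g i k).card + (pairsE c M d i k).card)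

/-- Monotonicity along the rows. -/
def RowMono : Prop := ∀ r < M, ∀ i < d (r + 1), g r i ≤ g (r + 1) i

/-- Monotonicity along the columns. -/
def ColMono : Prop := ∀ r < M, ∀ i < d (r + 1), i + 1 < d r → g (r + 1) i ≤ g r (i + 1) + c

variable {c M d g} {A : ℕ}

theorem RowMono.pairsR_subset (hd : IsShape A M d) (hg : RowMono M d g) (i k : ℕ) :
    pairsR c M d g i k ⊆ pairsX c M d g i k := by
  intro r
  simp only [pairsR, pairsX, mem_filter, mem_range]
  rintro ⟨hr, hi, hk, h⟩
  have := hg r hr k hk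
  have := hd.succ_le r
  exact ⟨hr, hi, by omega, by omega⟩

theorem RowMono.card_le (hd : IsShape A M d) (hg : RowMono M d g)
    (h0 : ∀ i, g 0 i = -(c * i : ℤ)) (i k : ℕ) :
    (pairsR c M d g i k).card + (pairsE c M d i k).card ≤ (pairsX c M d g i k).card := by
  have hsub := hg.pairsR_subset (c := c) hd i k
  rcases (pairsE c M d i k).eq_empty_or_nonempty with he | ⟨s, hs⟩
  · rw [he]
    simpa using card_le_card hsub
  have h1 : (pairsE c M d i k).card ≤ 1 := by
    rw [card_le_one]
    intro r hr r' hr'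
    simp only [pairsE, mem_filter, mem_range] at hr hr'
    by_contra hne
    rcases lt_or_gt_of_ne hne with h | h
    · have := hd.anti (Nat.succ_le_of_lt h)
      simp only [Nat.succ_eq_add_one] at this
      omega
    · have := hd.anti (Nat.succ_le_of_lt h)
      simp only [Nat.succ_eq_add_one] at this
      omega
  simp only [pairsE, mem_filter, mem_range] at hs
  obtain ⟨hsM, hsi, hsk, hks, hc⟩ := hs
  have h2 : ∃ r ∈ pairsX c M d g i k, r ∉ pairsR c M d g i k := by
    by_contra! hcon
    have hP : ∀ r ≤ s, g r k + c < g r i := by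
      intro r
      induction r with
      | zero =>
        intro _
        rw [h0, h0]
        omega
      | succ r ih =>
        intro hr
        have h3 := ih (by omega)
        have h4 : i < d (r + 1) := lt_of_lt_of_le hsi (hd.anti (by omega))
        have h5 : k < d r := lt_of_lt_of_le hsk (hd.anti (by omega))
        have h6 := hg r (by omega) i h4
        have h7 := hcon r (by
          simp only [pairsX, mem_filter, mem_range]
          exact ⟨by omega, h4, h5, by omega⟩)
        simp only [pairsR, mem_filter, mem_range] at h7
        exact h7.2.2.2
    have h3 := hP s le_rfl
    have h4 := hg s hsM i hsi
    have h7 := hcon s (by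
      simp only [pairsX, mem_filter, mem_range]
      exact ⟨hsM, hsi, hsk, by omega⟩)
    simp only [pairsR, mem_filter, mem_range] at h7
    omega
  obtain ⟨r, hr, hr'⟩ := h2
  have h3 : (pairsR c M d g i k).card < (pairsX c M d g i k).card :=
    card_lt_card ⟨hsub, fun h => hr' (h hr)⟩
  omega

theorem pairsE_succ (i : ℕ) : pairsE c M d i (i + 1) = ∅ := by
  refine filter_eq_empty_iff.2 fun r _ h => ?_
  have := h.2.2.2
  push_cast at this
  nlinarith

theorem pairsE_self (i : ℕ) : pairsE c M d i i = ∅ := by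
  refine filter_eq_empty_iff.2 fun r _ h => ?_
  have := h.2.2.2
  omega

theorem ColMono.excess_succ (hg : ColMono c M d g) (i : ℕ) : excess c M d g i (i + 1) = 0 := by
  have : pairsX c M d g i (i + 1) = ∅ := by
    refine filter_eq_empty_iff.2 fun r hr h => ?_
    have := hg r (mem_range.1 hr) i h.1 h.2.1
    omega
  simp [excess, this]

theorem RowMono.exists_excess_succ (hd : IsShape A M d) (hg : RowMono M d g)
    (h : ¬ ColMono c M d g) : ∃ i, i + 1 < A ∧ 0 < excess c M d g i (i + 1) := by
  simp only [ColMono, not_forall, not_le] at h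
  obtain ⟨r, hr, i, hi, hi', h⟩ := h
  refine ⟨i, lt_of_lt_of_le hi' (hd.le r), ?_⟩
  have hsub := hg.pairsR_subset (c := c) hd i (i + 1)
  have hr' : r ∈ pairsX c M d g i (i + 1) := by
    simp only [pairsX, mem_filter, mem_range]
    exact ⟨hr, hi, hi', h⟩
  obtain ⟨s, hs, hs'⟩ : ∃ s ∈ pairsX c M d g i (i + 1), s ∉ pairsR c M d g i (i + 1) := by
    obtain ⟨s, hs⟩ : ∃ s, s = (pairsX c M d g i (i + 1)).max' ⟨r, hr'⟩ := ⟨_, rfl⟩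
    refine ⟨s, hs ▸ max'_mem _ ⟨r, hr'⟩, fun hmem => ?_⟩
    simp only [pairsR, mem_filter, mem_range] at hmem
    obtain ⟨h1, h2, h3, h4⟩ := hmem
    have h5 : s + 1 < M := by
      by_contra hcon
      obtain rfl : s + 1 = M := by omega
      rw [hd.top] at h2
      omega
    have h6 : i < d (s + 1 + 1) := by have := hd.le_succ (s + 1); omega
    have h7 : s + 1 ∈ pairsX c M d g i (i + 1) := by
      simp only [pairsX, mem_filter, mem_range]
      have := hg (s + 1) h5 i h6
      exact ⟨h5, h6, h3, by omega⟩
    have := le_max' _ _ h7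
    omega
  have : (pairsR c M d g i (i + 1)).card < (pairsX c M d g i (i + 1)).card :=
    card_lt_card ⟨hsub, fun h => hs' (h hs)⟩
  simp only [excess, pairsE_succ, card_empty]
  omega

theorem exists_excess_self (hd : IsShape A M d)
    (h0 : ∀ i, g 0 i = -(c * i : ℤ)) {r₀ i : ℕ} (hr₀ : r₀ ≤ M) (hi : i < d r₀)
    (h : (c * r₀ : ℤ) < g r₀ i) : 0 < excess c M d g i i := by
  have hR : pairsR c M d g i i = ∅ := filter_eq_empty_iff.2 fun r _ h => by omega
  simp only [excess, hR, pairsE_self, card_empty, add_zero, Nat.sub_zero, card_pos]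
  by_contra hcon
  rw [not_nonempty_iff_eq_empty, pairsX, filter_eq_empty_iff] at hcon
  have hP : ∀ r ≤ r₀, g r i ≤ c * r := by
    intro r
    induction r with
    | zero => intro _; rw [h0]; push_cast; nlinarith
    | succ r ih =>
      intro hr
      have h1 := ih (by omega)
      have h2 := hcon (mem_range.2 (by omega : r < M))
      have h3 : i < d (r + 1) := lt_of_lt_of_le hi (hd.anti hr)
      have h4 := hd.succ_le r
      have h5 : g (r + 1) i ≤ g r i + c := by
        by_contra h6
        exact h2 ⟨h3, by omega, by omega⟩
      push_cast
      linarith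
  have := hP r₀ le_rfl
  omega

theorem RowMono.pairsY_self (hg : RowMono M d g) (i : ℕ) :
    pairsY M d g i i = ∅ := by
  refine filter_eq_empty_iff.2 fun r hr h => ?_
  have := hg r (mem_range.1 hr) i h.2.1
  omega

theorem exists_mem_pairsY (hd : IsShape A M d) (hg : ¬ RowMono M d g) :
    ∃ i < A, (pairsY M d g i i).Nonempty := by
  simp only [RowMono, not_forall, not_le] at hg
  obtain ⟨r, hr, i, hi, h⟩ := hg
  refine ⟨i, lt_of_lt_of_le hi (hd.le _), r, ?_⟩
  simp only [pairsY, mem_filter, mem_range]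
  exact ⟨hr, lt_of_lt_of_le hi (hd.succ_le r), hi, h⟩

theorem pairsT_self (i : ℕ) : pairsT M d g i i = ∅ :=
  filter_eq_empty_iff.2 fun r _ h => by omega

/-- For the trivial filling, the pairs of type `T` and `Y` agree. -/
theorem pairsT_trivial (hd : IsShape A M d) (i k : ℕ) :
    pairsT M d (fun _ i => -(c * i : ℤ)) i k = pairsY M d (fun _ i => -(c * i : ℤ)) i k := by
  refine filter_congr fun r _ => ?_
  have h1 := hd.succ_le r
  refine ⟨fun ⟨h2, h3, h4⟩ => ⟨by omega, h3, h4⟩, fun ⟨h2, h3, h4⟩ => ⟨?_, h3, h4⟩⟩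
  by_contra h5
  have : (c : ℤ) * k ≤ c * i := by gcongr; omega
  dsimp only at h4
  omega

/-- For the trivial filling, the pairs of type `X` are those of type `R` and `E`. -/
theorem card_pairsX_trivial (hd : IsShape A M d) (i k : ℕ) :
    (pairsX c M d (fun _ i => -(c * i : ℤ)) i k).card =
      (pairsR c M d (fun _ i => -(c * i : ℤ)) i k).card + (pairsE c M d i k).card := by
  rw [← card_union_of_disjoint]
  · congr 1
    ext r
    have h1 := hd.succ_le r
    simp only [pairsX, pairsR, pairsE, mem_union, mem_filter, mem_range]
    constructor
    · rintro ⟨h2, h3, h4, h5⟩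
      rcases lt_or_ge k (d (r + 1)) with h | h
      · exact Or.inl ⟨h2, h3, h, h5⟩
      · exact Or.inr ⟨h2, h3, h4, h, h5⟩
    · rintro (⟨h2, h3, h4, h5⟩ | ⟨h2, h3, h4, h5, h6⟩)
      · exact ⟨h2, h3, by omega, h5⟩
      · exact ⟨h2, h3, h4, h6⟩
  · rw [disjoint_left]
    intro r
    simp only [pairsR, pairsE, mem_filter, mem_range]
    omega

end Pairs

end

section

open Finset

/-! ### Expansion transversally to the plane `t₁ + t₂ = c t₃` -/

/-- Polynomials on the plane. -/
abbrev PlanePoly : Type := MvPolynomial (Fin 2) ℂ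

/-- The equation `t₁ + t₂ - c t₃` of the plane. -/
def planeEq (c : ℕ) : CohPt := MvPolynomial.X 0 + MvPolynomial.X 1 - (c : CohPt) * MvPolynomial.X 2

/-- Polynomials in `t₁, t₂, t₃` as polynomials in the equation of the plane. -/
def toPoly (c : ℕ) : CohPt →ₐ[ℂ] Polynomial PlanePoly :=
  MvPolynomial.aeval ![Polynomial.C (MvPolynomial.X 0),
    Polynomial.C ((c : PlanePoly) * MvPolynomial.X 1 - MvPolynomial.X 0) + Polynomial.X,
    Polynomial.C (MvPolynomial.X 1)]

/-- The inverse of `toPoly`. -/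
def ofPoly (c : ℕ) : Polynomial PlanePoly →+* CohPt :=
  Polynomial.eval₂RingHom
    (MvPolynomial.aeval (R := ℂ) ![(MvPolynomial.X 0 : CohPt), MvPolynomial.X 2] :
      PlanePoly →ₐ[ℂ] CohPt).toRingHom (planeEq c)

theorem ofPoly_toPoly (c : ℕ) (p : CohPt) : ofPoly c (toPoly c p) = p := by
  have h : (ofPoly c).comp (toPoly c).toRingHom = RingHom.id CohPt := by
    refine MvPolynomial.ringHom_ext (fun r => ?_) fun i => ?_
    · have : toPoly c (MvPolynomial.C r) = Polynomial.C (MvPolynomial.C r) := by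
        rw [toPoly, MvPolynomial.aeval_C]; rfl
      simp [this, ofPoly]
    · fin_cases i <;> simp [toPoly, ofPoly, planeEq]
  exact congrArg (fun f : CohPt →+* CohPt => f p) h

theorem restrictPlane_ofPoly (c : ℕ) (p : Polynomial PlanePoly) :
    restrictPlane c (ofPoly c p) = p.coeff 0 := by
  have h : (restrictPlane c).toRingHom.comp (ofPoly c) = Polynomial.constantCoeff := by
    refine Polynomial.ringHom_ext (fun r => ?_) ?_
    · have : (restrictPlane c).toRingHom.comp
          (MvPolynomial.aeval (R := ℂ) ![(MvPolynomial.X 0 : CohPt), MvPolynomial.X 2] :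
            PlanePoly →ₐ[ℂ] CohPt).toRingHom = RingHom.id PlanePoly := by
        refine MvPolynomial.ringHom_ext (fun r => ?_) fun i => ?_
        · simp [restrictPlane]
        · fin_cases i <;> simp [restrictPlane]
      have := congrArg (fun f : PlanePoly →+* PlanePoly => f r) this
      simpa [ofPoly] using this
    · simp [ofPoly, planeEq, restrictPlane]
  exact congrArg (fun f : Polynomial PlanePoly →+* PlanePoly => f p) h

/-- Expansion of polynomials in `t₁, t₂, t₃` in powers of the equation of the plane. -/
def toSeries (c : ℕ) : CohPt →+* PowerSeries PlaneFrac :=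
  (Polynomial.coeToPowerSeries.ringHom.comp
    (Polynomial.mapRingHom (algebraMap PlanePoly PlaneFrac))).comp (toPoly c).toRingHom

theorem toSeries_apply (c : ℕ) (p : CohPt) :
    toSeries c p = (((toPoly c p).map (algebraMap PlanePoly PlaneFrac) :
      Polynomial PlaneFrac) : PowerSeries PlaneFrac) := rfl

theorem toSeries_injective (c : ℕ) : Function.Injective (toSeries c) := by
  intro p q h
  rw [toSeries_apply, toSeries_apply, Polynomial.coe_inj] at h
  have h1 := Polynomial.map_injective _ (IsFractionRing.injective PlanePoly PlaneFrac) h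
  rw [← ofPoly_toPoly c p, h1, ofPoly_toPoly]

/-- Laurent expansion of rational functions of `t₁, t₂, t₃` along the plane. -/
def expand (c : ℕ) : CohFrac →+* LaurentSeries PlaneFrac :=
  IsFractionRing.lift (A := CohPt) (K := CohFrac) (L := LaurentSeries PlaneFrac)
    (g := (HahnSeries.ofPowerSeries ℤ PlaneFrac).comp (toSeries c))
    (HahnSeries.ofPowerSeries_injective.comp (toSeries_injective c))

theorem expand_algebraMap (c : ℕ) (p : CohPt) :
    expand c (algebraMap CohPt CohFrac p) = HahnSeries.ofPowerSeries ℤ PlaneFrac (toSeries c p) :=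
  IsFractionRing.lift_algebraMap (A := CohPt) (K := CohFrac) (L := LaurentSeries PlaneFrac) _ p

theorem specializesTo_of_expand {c : ℕ} {f : CohFrac} {P : PowerSeries PlaneFrac}
    (h : expand c f = HahnSeries.ofPowerSeries ℤ PlaneFrac P) :
    SpecializesTo c f (PowerSeries.constantCoeff P) := by
  obtain ⟨a, b, hb, rfl⟩ := IsFractionRing.div_surjective (A := CohPt) f
  have hb0 : b ≠ 0 := nonZeroDivisors.ne_zero hb
  have hinj := IsFractionRing.injective CohPt CohFrac
  have hinj₂ := IsFractionRing.injective PlanePoly PlaneFrac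
  set k := (toPoly c b).natTrailingDegree
  have hbne : toPoly c b ≠ 0 := fun h0 => hb0 (by
    rw [← ofPoly_toPoly c b, h0, map_zero])
  obtain ⟨b', hb'⟩ : Polynomial.X ^ k ∣ toPoly c b :=
    Polynomial.X_pow_dvd_iff.2 fun l hl => Polynomial.coeff_eq_zero_of_lt_natTrailingDegree hl
  have hb'0 : b'.coeff 0 ≠ 0 := by
    have h1 : (toPoly c b).coeff k ≠ 0 := by
      rwa [← Polynomial.trailingCoeff, Ne, Polynomial.trailingCoeff_eq_zero]
    rwa [hb', Polynomial.coeff_X_pow_mul', if_pos le_rfl, Nat.sub_self] at h1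
  have hab : toSeries c a = P * toSeries c b := by
    apply HahnSeries.ofPowerSeries_injective (Γ := ℤ)
    rw [map_mul, ← h, ← expand_algebraMap, ← expand_algebraMap, ← map_mul, div_mul_cancel₀]
    rwa [Ne, map_eq_zero_iff _ hinj]
  have hSb : toSeries c b = PowerSeries.X ^ k *
      ((b'.map (algebraMap PlanePoly PlaneFrac) : Polynomial PlaneFrac) :
        PowerSeries PlaneFrac) := by
    rw [toSeries_apply, hb']
    simp
  obtain ⟨a', ha'⟩ : Polynomial.X ^ k ∣ toPoly c a := by
    refine Polynomial.X_pow_dvd_iff.2 fun l hl => hinj₂ ?_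
    rw [map_zero, ← Polynomial.coeff_map, ← Polynomial.coeff_coe, ← toSeries_apply, hab, hSb,
      mul_left_comm, PowerSeries.coeff_X_pow_mul', if_neg (by omega)]
  have hSa : toSeries c a = PowerSeries.X ^ k *
      ((a'.map (algebraMap PlanePoly PlaneFrac) : Polynomial PlaneFrac) :
        PowerSeries PlaneFrac) := by
    rw [toSeries_apply, ha']
    simp
  refine ⟨ofPoly c a', ofPoly c b', ?_, ?_, ?_⟩
  · rwa [restrictPlane_ofPoly]
  · have h1 : a = ofPoly c Polynomial.X ^ k * ofPoly c a' := by
      rw [← map_pow, ← map_mul, ← ha', ofPoly_toPoly]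
    have h2 : b = ofPoly c Polynomial.X ^ k * ofPoly c b' := by
      rw [← map_pow, ← map_mul, ← hb', ofPoly_toPoly]
    have h3 : ofPoly c Polynomial.X ^ k ≠ 0 := fun h0 => hb0 (by rw [h2, h0, zero_mul])
    conv_lhs => rw [h1, h2, map_mul, map_mul]
    rw [mul_div_mul_left]
    rwa [Ne, map_eq_zero_iff _ hinj]
  · rw [restrictPlane_ofPoly, restrictPlane_ofPoly, eq_div_iff]
    · have h1 : PowerSeries.X ^ k * ((a'.map (algebraMap PlanePoly PlaneFrac) :
          Polynomial PlaneFrac) : PowerSeries PlaneFrac) = PowerSeries.X ^ k *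
          (P * ((b'.map (algebraMap PlanePoly PlaneFrac) : Polynomial PlaneFrac) :
            PowerSeries PlaneFrac)) := by
        rw [← hSa, hab, hSb]; ring
      have h2 := mul_left_cancel₀ (pow_ne_zero _ PowerSeries.X_ne_zero) h1
      have h3 := congrArg PowerSeries.constantCoeff h2
      rw [map_mul] at h3
      have h4 : ∀ p : Polynomial PlanePoly, PowerSeries.constantCoeff
          ((p.map (algebraMap PlanePoly PlaneFrac) : Polynomial PlaneFrac) :
            PowerSeries PlaneFrac) = algebraMap PlanePoly PlaneFrac (p.coeff 0) := fun p => by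
        rw [← PowerSeries.coeff_zero_eq_constantCoeff_apply, Polynomial.coeff_coe,
          Polynomial.coeff_map]
      rw [h4, h4] at h3
      exact h3.symm
    · rwa [Ne, map_eq_zero_iff _ hinj₂]

/-- The expansion of `p t₁ + q t₂ + s t₃`. -/
theorem expand_weight (c : ℕ) (v : ℤ × ℤ × ℤ) :
    expand c (weight v) = HahnSeries.ofPowerSeries ℤ PlaneFrac
      (PowerSeries.C (algebraMap PlanePoly PlaneFrac
        (((v.1 - v.2.1 : ℤ) : PlanePoly) * MvPolynomial.X 0 +
          ((v.2.2 + c * v.2.1 : ℤ) : PlanePoly) * MvPolynomial.X 1)) +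
        PowerSeries.C (v.2.1 : PlaneFrac) * PowerSeries.X) := by
  have h : weight v = algebraMap CohPt CohFrac ((v.1 : CohPt) * MvPolynomial.X 0 +
      (v.2.1 : CohPt) * MvPolynomial.X 1 + (v.2.2 : CohPt) * MvPolynomial.X 2) := by
    simp [weight, t]
  rw [h, expand_algebraMap]
  congr 1
  have h0 : toSeries c (MvPolynomial.X 0) =
      PowerSeries.C (algebraMap PlanePoly PlaneFrac (MvPolynomial.X 0)) := by
    simp [toSeries_apply, toPoly]
  have h1 : toSeries c (MvPolynomial.X 1) = (c : PowerSeries PlaneFrac) *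
      PowerSeries.C (algebraMap PlanePoly PlaneFrac (MvPolynomial.X 1)) -
      PowerSeries.C (algebraMap PlanePoly PlaneFrac (MvPolynomial.X 0)) + PowerSeries.X := by
    simp [toSeries_apply, toPoly]
    exact map_natCast (Polynomial.coeToPowerSeries.ringHom (R := PlaneFrac)) c
  have h2 : toSeries c (MvPolynomial.X 2) =
      PowerSeries.C (algebraMap PlanePoly PlaneFrac (MvPolynomial.X 1)) := by
    simp [toSeries_apply, toPoly]
  rw [map_add, map_add, map_mul, map_mul, map_mul, h0, h1, h2]
  simp only [map_intCast, map_add, map_mul, map_sub, Int.cast_sub, Int.cast_add, Int.cast_mul,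
    Int.cast_natCast, map_natCast]
  ring

end

section

open Finset

/-! ### Characters and their exponentials -/

/-- Weights that vanish on the plane `t₁ + t₂ = c t₃`. -/
def OnLine (c : ℕ) (v : ℤ × ℤ × ℤ) : Prop := v.1 = v.2.1 ∧ v.2.2 = -(c * v.2.1)

/-- The weight `q (t₁ + t₂ - c t₃)`. -/
def lineVec (c : ℕ) (q : ℤ) : ℤ × ℤ × ℤ := (q, q, -(c * q))

theorem onLine_iff {c : ℕ} {v : ℤ × ℤ × ℤ} : OnLine c v ↔ v = lineVec c v.2.1 := by
  obtain ⟨p, q, s⟩ := v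
  simp [OnLine, lineVec]

theorem plane_ne_zero {a b : ℤ} (h : ¬ (a = 0 ∧ b = 0)) :
    algebraMap PlanePoly PlaneFrac ((a : PlanePoly) * MvPolynomial.X 0 +
      (b : PlanePoly) * MvPolynomial.X 1) ≠ 0 := by
  rw [Ne, map_eq_zero_iff _ (IsFractionRing.injective PlanePoly PlaneFrac)]
  intro h0
  apply h
  have h1 := congrArg (MvPolynomial.eval ![(1 : ℂ), 0]) h0
  have h2 := congrArg (MvPolynomial.eval ![(0 : ℂ), 1]) h0
  simp only [map_add, map_mul, map_intCast, MvPolynomial.eval_X, map_zero] at h1 h2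
  simp at h1 h2
  exact ⟨h1, h2⟩

theorem expand_weight_lineVec (c : ℕ) (q : ℤ) :
    expand c (weight (lineVec c q)) =
      HahnSeries.ofPowerSeries ℤ PlaneFrac (PowerSeries.C (q : PlaneFrac) * PowerSeries.X) := by
  rw [expand_weight]
  simp [lineVec]

theorem weight_ne_zero (c : ℕ) {v : ℤ × ℤ × ℤ} (hv : v ≠ 0) : weight v ≠ 0 := by
  intro h
  have h1 := expand_weight c v
  rw [h, map_zero, eq_comm, map_eq_zero_iff _ HahnSeries.ofPowerSeries_injective] at h1
  have h2 := congrArg (PowerSeries.coeff 0) h1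
  have h3 := congrArg (PowerSeries.coeff 1) h1
  simp only [map_add,
    PowerSeries.coeff_zero_mul_X, add_zero, map_zero, PowerSeries.coeff_C] at h2
  rw [map_zero, map_add, PowerSeries.coeff_succ_mul_X, PowerSeries.coeff_zero_C,
    PowerSeries.coeff_C, if_neg one_ne_zero, zero_add, Int.cast_eq_zero] at h3
  by_cases h4 : v.1 - v.2.1 = 0 ∧ v.2.2 + c * v.2.1 = 0
  · apply hv
    obtain ⟨p, q, s⟩ := v
    simp only at h3 h4
    subst h3
    simp at h4
    simp [h4]
  · exact plane_ne_zero h4 (by simpa using h2)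

/-- The part of the plethystic exponential coming from the weights satisfying `p`. -/
def expOn (p : ℤ × ℤ × ℤ → Prop) [DecidablePred p] (f : Char) : CohFrac :=
  f.coeff.prod fun v a => if p v then weight v ^ a else 1

section ExpOn

variable {p : ℤ × ℤ × ℤ → Prop} [DecidablePred p]

theorem expOn_add (hp : ¬ p 0) (f g : Char) : expOn p (f + g) = expOn p f * expOn p g := by
  unfold expOn
  rw [AddMonoidAlgebra.coeff_add]
  refine Finsupp.prod_add_index' (fun v => by split_ifs <;> simp) fun v a b => ?_
  split_ifs with h
  · exact zpow_add₀ (weight_ne_zero 0 fun h0 => hp (h0 ▸ h)) a b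
  · simp

theorem expOn_zero : expOn p 0 = 1 := by simp [expOn]

theorem expOn_neg (hp : ¬ p 0) (f : Char) : expOn p (-f) = (expOn p f)⁻¹ := by
  have h := expOn_add hp (-f) f
  rw [neg_add_cancel, expOn_zero] at h
  exact eq_inv_of_mul_eq_one_left h.symm

theorem expOn_mono (i j k : ℤ) :
    expOn p (mono i j k) = if p (i, j, k) then weight (i, j, k) else 1 := by
  unfold expOn mono
  rw [AddMonoidAlgebra.coeff_single, Finsupp.prod_single_index (by split_ifs <;> simp)]
  split_ifs <;> simp

theorem expOn_zsmul (hp : ¬ p 0) (a : ℤ) (f : Char) : expOn p (a • f) = expOn p f ^ a := by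
  let φ : Multiplicative Char →* CohFrac :=
    { toFun := fun f => expOn p f.toAdd
      map_one' := expOn_zero
      map_mul' := fun f g => expOn_add hp _ _ }
  have h0 : ∀ f, expOn p f ≠ 0 := fun f h => by
    have h1 := expOn_add hp f (-f)
    rw [add_neg_cancel, expOn_zero, h, zero_mul] at h1
    exact one_ne_zero h1
  induction a using Int.induction_on with
  | zero => simp [expOn_zero]
  | succ n ih => rw [add_smul, one_smul, expOn_add hp, ih, zpow_add_one₀ (h0 f)]
  | pred n ih =>
    rw [sub_smul, one_smul, sub_eq_add_neg, expOn_add hp, ih, expOn_neg hp, zpow_sub_one₀ (h0 f)]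

theorem expOn_sum (hp : ¬ p 0) {α : Type*} (s : Finset α) (f : α → Char) :
    expOn p (∑ x ∈ s, f x) = ∏ x ∈ s, expOn p (f x) := by
  classical
  induction s using Finset.induction_on with
  | empty => simp [expOn_zero]
  | insert a s ha ih => rw [sum_insert ha, expOn_add hp, ih, prod_insert ha]

theorem expOn_congr (hp : ¬ p 0) {f g : Char} (h : ∀ v, p v → f.coeff v = g.coeff v) :
    expOn p f = expOn p g := by
  have h1 : expOn p (f - g) = 1 := by
    refine Finset.prod_eq_one fun v _ => ?_
    simp only
    split_ifs with hv
    · rw [AddMonoidAlgebra.coeff_sub, Finsupp.sub_apply, h v hv, sub_self, zpow_zero]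
    · rfl
  have h2 := expOn_add hp (f - g) g
  rwa [sub_add_cancel, h1, one_mul] at h2

end ExpOn

open Classical in
/-- The part of the plethystic exponential from weights that do not vanish on the plane. -/
def expOff (c : ℕ) (f : Char) : CohFrac := expOn (fun v => ¬ OnLine c v) f

open Classical in
/-- The part of the plethystic exponential from nonzero weights that vanish on the plane. -/
def expLine (c : ℕ) (f : Char) : CohFrac := expOn (fun v => OnLine c v ∧ v ≠ 0) f

theorem not_off_zero (c : ℕ) : ¬ ¬ OnLine c 0 := by simp [OnLine]

theorem expOff_add (c : ℕ) (f g : Char) : expOff c (f + g) = expOff c f * expOff c g := by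
  classical exact expOn_add (p := fun v => ¬ OnLine c v) (not_off_zero c) f g

theorem expOff_neg (c : ℕ) (f : Char) : expOff c (-f) = (expOff c f)⁻¹ := by
  classical exact expOn_neg (p := fun v => ¬ OnLine c v) (not_off_zero c) f

theorem expOff_zero (c : ℕ) : expOff c 0 = 1 := by
  classical exact expOn_zero (p := fun v => ¬ OnLine c v)

theorem Exp_eq (c : ℕ) {f : Char} (hf : f.coeff 0 = 0) : Exp f = expOff c f * expLine c f := by
  unfold Exp expOff expLine expOn Finsupp.prod
  rw [← Finset.prod_mul_distrib]
  refine Finset.prod_congr rfl fun v hv => ?_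
  have hv0 : v ≠ 0 := by
    rintro rfl
    exact (Finsupp.mem_support_iff.1 hv) hf
  by_cases h : OnLine c v <;> simp [h, hv0]

theorem expLine_eq_prod (c : ℕ) {f : Char} {α : Type*} (s : Finset α) (κ : α → ℤ) (e : α → ℤ)
    (h : ∀ q, q ≠ 0 → f.coeff (lineVec c q) = ∑ x ∈ s, if κ x = q then e x else 0) :
    expLine c f = ∏ x ∈ s, if κ x = 0 then 1 else weight (lineVec c (κ x)) ^ e x := by
  classical
  have hp : ¬ (OnLine c 0 ∧ (0 : ℤ × ℤ × ℤ) ≠ 0) := by simp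
  have h1 : expLine c f = expLine c (∑ x ∈ s, e x • mono (κ x) (κ x) (-(c * κ x))) := by
    refine expOn_congr hp fun v hv => ?_
    have hq : v = lineVec c v.2.1 := onLine_iff.1 hv.1
    have hq0 : v.2.1 ≠ 0 := fun h0 => hv.2 (by rw [hq, h0]; simp [lineVec])
    rw [hq, h _ hq0, AddMonoidAlgebra.coeff_sum, Finset.sum_apply']
    refine Finset.sum_congr rfl fun x _ => ?_
    rw [AddMonoidAlgebra.coeff_smul, Finsupp.smul_apply, mono, AddMonoidAlgebra.coeff_single]
    split_ifs with h2
    · rw [h2, lineVec, Finsupp.single_eq_same, smul_eq_mul, mul_one]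
    · rw [Finsupp.single_eq_of_ne, smul_zero]
      exact fun h3 => h2 (congrArg Prod.fst h3).symm
  rw [h1, expLine, expOn_sum hp]
  refine Finset.prod_congr rfl fun x _ => ?_
  rw [expOn_zsmul hp, expOn_mono]
  by_cases h2 : κ x = 0
  · simp [h2]
  · rw [if_neg h2, if_pos]
    · rfl
    · refine ⟨by simp [OnLine], fun h3 => h2 ?_⟩
      exact congrArg Prod.fst h3

/-! ### Families of characters -/

section Families

variable {ι : Type*} {n : ι → ℕ} {c : ℕ}

/-- A family of rational functions, regular along the plane, with filtered expansion. -/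
def RegFam (c : ℕ) (n : ι → ℕ) (F : (∀ r, Equiv.Perm (Fin (n r))) → CohFrac) : Prop :=
  ∃ Φ, SeriesDeg PlaneFrac n Φ ∧ ∀ σ, expand c (F σ) = HahnSeries.ofPowerSeries ℤ PlaneFrac (Φ σ)

/-- A family as in `RegFam` that does not vanish on the plane. -/
def UnitFam (c : ℕ) (n : ι → ℕ) (F : (∀ r, Equiv.Perm (Fin (n r))) → CohFrac) : Prop :=
  ∃ Φ, SeriesDeg PlaneFrac n Φ ∧ (∀ σ, PowerSeries.constantCoeff (Φ σ) ≠ 0) ∧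
    ∀ σ, expand c (F σ) = HahnSeries.ofPowerSeries ℤ PlaneFrac (Φ σ)

variable {F H : (∀ r, Equiv.Perm (Fin (n r))) → CohFrac}

theorem UnitFam.regFam (h : UnitFam c n F) : RegFam c n F := by
  obtain ⟨Φ, h1, _, h3⟩ := h
  exact ⟨Φ, h1, h3⟩

theorem UnitFam.one : UnitFam c n fun _ => 1 :=
  ⟨fun _ => 1, SeriesDeg.const 1, by simp, by simp⟩

theorem UnitFam.mul (h : UnitFam c n F) (h' : UnitFam c n H) :
    UnitFam c n fun σ => F σ * H σ := by
  obtain ⟨Φ, h1, h2, h3⟩ := h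
  obtain ⟨Φ', h1', h2', h3'⟩ := h'
  exact ⟨fun σ => Φ σ * Φ' σ, h1.mul h1', fun σ => by simp [h2, h2'], fun σ => by simp [h3, h3']⟩

theorem UnitFam.inv (h : UnitFam c n F) : UnitFam c n fun σ => (F σ)⁻¹ := by
  obtain ⟨Φ, h1, h2, h3⟩ := h
  refine ⟨fun σ => (Φ σ)⁻¹, h1.inv, fun σ => by simpa using h2 σ, fun σ => ?_⟩
  rw [map_inv₀, h3]
  refine inv_eq_of_mul_eq_one_right ?_
  rw [← map_mul, PowerSeries.mul_inv_cancel _ (h2 σ), map_one]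

theorem RegFam.mul (h : RegFam c n F) (h' : RegFam c n H) :
    RegFam c n fun σ => F σ * H σ := by
  obtain ⟨Φ, h1, h3⟩ := h
  obtain ⟨Φ', h1', h3'⟩ := h'
  exact ⟨fun σ => Φ σ * Φ' σ, h1.mul h1', fun σ => by simp [h3, h3']⟩

theorem RegFam.add (h : RegFam c n F) (h' : RegFam c n H) :
    RegFam c n fun σ => F σ + H σ := by
  obtain ⟨Φ, h1, h3⟩ := h
  obtain ⟨Φ', h1', h3'⟩ := h'
  exact ⟨fun σ => Φ σ + Φ' σ, h1.add h1', fun σ => by simp [h3, h3']⟩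

theorem RegFam.neg (h : RegFam c n F) : RegFam c n fun σ => -F σ := by
  obtain ⟨Φ, h1, h3⟩ := h
  exact ⟨fun σ => -Φ σ, h1.neg, fun σ => by simp [h3]⟩

theorem RegFam.one : RegFam c n fun _ => 1 := UnitFam.one.regFam

theorem RegFam.zero : RegFam c n fun _ => 0 :=
  ⟨fun _ => 0, SeriesDeg.const 0, by simp⟩

theorem RegFam.pow (h : RegFam c n F) (k : ℕ) : RegFam c n fun σ => F σ ^ k := by
  induction k with
  | zero => simpa using RegFam.one
  | succ k ih => simpa [pow_succ] using ih.mul h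

theorem RegFam.prod {α : Type*} (s : Finset α)
    {F : α → (∀ r, Equiv.Perm (Fin (n r))) → CohFrac} (h : ∀ a ∈ s, RegFam c n (F a)) :
    RegFam c n fun σ => ∏ a ∈ s, F a σ := by
  classical
  induction s using Finset.induction_on with
  | empty => simpa using RegFam.one (c := c) (n := n)
  | insert a s ha ih =>
    simp only [Finset.prod_insert ha]
    exact (h a (by simp)).mul (ih fun b hb => h b (by simp [hb]))

theorem RegFam.ratCast (r : ℚ) : RegFam c n fun _ => (r : CohFrac) :=
  ⟨fun _ => PowerSeries.C (r : PlaneFrac), SeriesDeg.const _, fun _ => by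
    rw [map_ratCast, ← RingHom.comp_apply, map_ratCast]⟩

/-- A family of weights with constant restriction to the plane, depending linearly on the
permutations. -/
structure WeightFam (c : ℕ) (n : ι → ℕ) (v : (∀ r, Equiv.Perm (Fin (n r))) → ℤ × ℤ × ℤ) :
    Prop where
  const : ∃ a b : ℤ, ∀ σ, (v σ).1 - (v σ).2.1 = a ∧ (v σ).2.2 + c * (v σ).2.1 = b
  deg : PolyDeg PlaneFrac n 1 fun σ => ((v σ).2.1 : PlaneFrac)

theorem WeightFam.add {v w : (∀ r, Equiv.Perm (Fin (n r))) → ℤ × ℤ × ℤ} (hv : WeightFam c n v)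
    (hw : WeightFam c n w) : WeightFam c n fun σ => v σ + w σ := by
  obtain ⟨⟨a, b, h⟩, h1⟩ := hv
  obtain ⟨⟨a', b', h'⟩, h1'⟩ := hw
  refine ⟨⟨a + a', b + b', fun σ => ?_⟩, ?_⟩
  · have h2 := h σ
    have h3 := h' σ
    simp only [Prod.fst_add, Prod.snd_add]
    constructor
    · linarith
    · rw [mul_add]; linarith
  · simpa using h1.add h1'

theorem WeightFam.neg {v : (∀ r, Equiv.Perm (Fin (n r))) → ℤ × ℤ × ℤ} (hv : WeightFam c n v) :
    WeightFam c n fun σ => -v σ := by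
  obtain ⟨⟨a, b, h⟩, h1⟩ := hv
  refine ⟨⟨-a, -b, fun σ => ?_⟩, ?_⟩
  · have h2 := h σ
    simp only [Prod.fst_neg, Prod.snd_neg]
    constructor
    · linarith
    · rw [mul_neg]; linarith
  · simpa using h1.neg

theorem WeightFam.const' (v : ℤ × ℤ × ℤ) : WeightFam c n fun _ => v :=
  ⟨⟨_, _, fun _ => ⟨rfl, rfl⟩⟩, PolyDeg.const 1 _⟩

theorem WeightFam.regFam {v : (∀ r, Equiv.Perm (Fin (n r))) → ℤ × ℤ × ℤ}
    (hv : WeightFam c n v) : RegFam c n fun σ => weight (v σ) := by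
  obtain ⟨⟨a, b, h⟩, h1⟩ := hv
  refine ⟨_, SeriesDeg.linear (algebraMap PlanePoly PlaneFrac ((a : PlanePoly) *
    MvPolynomial.X 0 + (b : PlanePoly) * MvPolynomial.X 1)) h1, fun σ => ?_⟩
  rw [expand_weight, (h σ).1, (h σ).2]

theorem WeightFam.unitFam {v : (∀ r, Equiv.Perm (Fin (n r))) → ℤ × ℤ × ℤ}
    (hv : WeightFam c n v) : UnitFam c n fun σ => expOff c (mono (v σ).1 (v σ).2.1 (v σ).2.2) := by
  obtain ⟨⟨a, b, h⟩, h1⟩ := hv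
  simp only [expOff, expOn_mono]
  have h2 : ∀ σ, OnLine c (v σ) ↔ (a = 0 ∧ b = 0) := fun σ => by
    rw [OnLine, ← (h σ).1, ← (h σ).2]
    constructor <;> rintro ⟨_, _⟩ <;> constructor <;> linarith
  by_cases hab : a = 0 ∧ b = 0
  · simpa [h2, hab] using UnitFam.one
  · simp only [Prod.mk.eta, h2, hab, not_false_eq_true, if_true]
    refine ⟨_, SeriesDeg.linear (algebraMap PlanePoly PlaneFrac ((a : PlanePoly) *
      MvPolynomial.X 0 + (b : PlanePoly) * MvPolynomial.X 1)) h1, fun σ => ?_, fun σ => ?_⟩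
    · simpa using plane_ne_zero hab
    · rw [expand_weight, (h σ).1, (h σ).2]

/-- The families of characters generated by `WeightFam`. -/
def CharFam (c : ℕ) (n : ι → ℕ) : AddSubgroup ((∀ r, Equiv.Perm (Fin (n r))) → Char) :=
  AddSubgroup.closure {X | ∃ v, WeightFam c n v ∧
    X = fun σ => mono (v σ).1 (v σ).2.1 (v σ).2.2}

variable {X Y : (∀ r, Equiv.Perm (Fin (n r))) → Char}

theorem CharFam.of {v : (∀ r, Equiv.Perm (Fin (n r))) → ℤ × ℤ × ℤ} (hv : WeightFam c n v) :
    (fun σ => mono (v σ).1 (v σ).2.1 (v σ).2.2) ∈ CharFam c n :=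
  AddSubgroup.subset_closure ⟨v, hv, rfl⟩

theorem CharFam.mul (hX : X ∈ CharFam c n) (hY : Y ∈ CharFam c n) : X * Y ∈ CharFam c n := by
  unfold CharFam at hX hY
  induction hX, hY using AddSubgroup.closure_induction₂ with
  | mem x y hx hy =>
    obtain ⟨v, hv, rfl⟩ := hx
    obtain ⟨w, hw, rfl⟩ := hy
    convert CharFam.of (hv.add hw) using 1
    funext σ
    simp [mono_mul]
  | zero_left x _ => simp
  | zero_right x _ => simp
  | add_left x y z _ _ _ h1 h2 => rw [add_mul]; exact (CharFam c n).add_mem h1 h2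
  | add_right x y z _ _ _ h1 h2 => rw [mul_add]; exact (CharFam c n).add_mem h1 h2
  | neg_left x y _ _ h => rw [neg_mul]; exact (CharFam c n).neg_mem h
  | neg_right x y _ _ h => rw [mul_neg]; exact (CharFam c n).neg_mem h

theorem CharFam.conj (hX : X ∈ CharFam c n) : (fun σ => conj (X σ)) ∈ CharFam c n := by
  unfold CharFam at hX
  induction hX using AddSubgroup.closure_induction with
  | mem x hx =>
    obtain ⟨v, hv, rfl⟩ := hx
    convert CharFam.of hv.neg using 1
    funext σ
    simp [conj_mono]
  | zero =>
    simp only [Pi.zero_apply, map_zero]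
    exact (CharFam c n).zero_mem
  | add x y _ _ h1 h2 =>
    simp only [Pi.add_apply, map_add]
    exact (CharFam c n).add_mem h1 h2
  | neg x _ h =>
    simp only [Pi.neg_apply, map_neg]
    exact (CharFam c n).neg_mem h

theorem CharFam.const (f : Char) : (fun _ => f) ∈ CharFam c n := by
  have h : f = ∑ v ∈ f.coeff.support, f.coeff v • mono v.1 v.2.1 v.2.2 := by
    conv_lhs => rw [← AddMonoidAlgebra.sum_coeff_single f]
    refine Finset.sum_congr rfl fun v _ => ?_
    simp [mono]
  have h2 : (fun _ => f) = ∑ v ∈ f.coeff.support, f.coeff v •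
      fun _ : ∀ r, Equiv.Perm (Fin (n r)) => mono v.1 v.2.1 v.2.2 := by
    funext σ
    rw [Finset.sum_apply]
    exact h
  rw [h2]
  exact AddSubgroup.sum_mem _ fun v _ => AddSubgroup.zsmul_mem _
    (CharFam.of (WeightFam.const' v)) _

theorem CharFam.unitFam (hX : X ∈ CharFam c n) : UnitFam c n fun σ => expOff c (X σ) := by
  unfold CharFam at hX
  induction hX using AddSubgroup.closure_induction with
  | mem x hx =>
    obtain ⟨v, hv, rfl⟩ := hx
    exact hv.unitFam
  | zero => simpa only [Pi.zero_apply, expOff_zero] using UnitFam.one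
  | add x y _ _ h1 h2 => simpa only [Pi.add_apply, expOff_add] using h1.mul h2
  | neg x _ h => simpa only [Pi.neg_apply, expOff_neg] using h.inv

/-- The Chern character of a character of the torus, as a power series in `z`. -/
def chernChar : Char →+* PowerSeries CohFrac :=
  AddMonoidAlgebra.liftNCRingHom (Int.castRingHom _)
    { toFun := fun v => expSeries (weight v.toAdd)
      map_one' := by
        have : weight (Multiplicative.toAdd 1) = 0 := by simp [weight]
        rw [this, expSeries, PowerSeries.rescale_zero]
        simp
      map_mul' := fun v w => by
        have : weight (Multiplicative.toAdd (v * w)) =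
            weight v.toAdd + weight w.toAdd := by
          simp [weight]; ring
        rw [this, expSeries, expSeries, expSeries, PowerSeries.exp_mul_exp_eq_exp_add] }
    fun _ _ => mul_comm _ _

theorem chernChar_mono (i j k : ℤ) : chernChar (mono i j k) = expSeries (weight (i, j, k)) := by
  rw [chernChar, mono]
  exact (AddMonoidAlgebra.liftNC_single _ _ _ _).trans (by simp)

theorem CharFam.regFam_coeff (hX : X ∈ CharFam c n) (k : ℕ) :
    RegFam c n fun σ => PowerSeries.coeff k (chernChar (X σ)) := by
  unfold CharFam at hX
  induction hX using AddSubgroup.closure_induction with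
  | mem x hx =>
    obtain ⟨v, hv, rfl⟩ := hx
    simp only [chernChar_mono, expSeries, PowerSeries.coeff_rescale, PowerSeries.coeff_exp,
      eq_ratCast]
    exact (hv.regFam.pow k).mul (RegFam.ratCast _)
  | zero => simpa using RegFam.zero
  | add x y _ _ h1 h2 => simpa using h1.add h2
  | neg x _ h => simpa using h.neg

end Families

theorem chSeries_eq (μ : YoungDiagram) (B : Finset (ℕ × ℕ × ℤ)) :
    chSeries μ B = chernChar ((1 - mono 1 0 0) * (1 - mono 0 1 0) *
      ((1 - mono 0 0 1) * Qv B + Qe μ)) := by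
  simp only [map_mul, map_sub, map_one, map_add, chernChar_mono, Qv, Qe, map_sum, chSeries]
  have h0 : weight (1, 0, 0) = t 0 := by simp [weight]
  have h1 : weight (0, 1, 0) = t 1 := by simp [weight]
  have h2 : weight (0, 0, 1) = t 2 := by simp [weight]
  rw [h0, h1, h2]

end

section

open Finset

/-! ### The part of the vertex character that vanishes on the plane -/

/-- The sum of the coefficients of `t₁^q t₂^q t₃^s` with `s ≤ -c q`. -/
def theta (c : ℕ) (q : ℤ) : Char →+ ℤ where
  toFun f := f.coeff.sum fun v a => if v.1 = q ∧ v.2.1 = q ∧ v.2.2 ≤ -(c * q) then a else 0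
  map_zero' := by simp
  map_add' f g := by
    rw [AddMonoidAlgebra.coeff_add]
    refine Finsupp.sum_add_index' (M := ℤ) (N := ℤ) (fun v => ?_) (fun v a b => ?_)
    · simp
    · split_ifs <;> simp

theorem theta_mono (c : ℕ) (q i j k : ℤ) :
    theta c q (mono i j k) = if i = q ∧ j = q ∧ k ≤ -(c * q) then 1 else 0 := by
  change Finsupp.sum (mono i j k).coeff (fun v a =>
    if v.1 = q ∧ v.2.1 = q ∧ v.2.2 ≤ -(c * q) then a else 0) = _
  rw [mono, AddMonoidAlgebra.coeff_single, Finsupp.sum_single_index (by simp)]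

theorem char_eq_sum (f : Char) :
    f = ∑ v ∈ f.coeff.support, f.coeff v • mono v.1 v.2.1 v.2.2 := by
  conv_lhs => rw [← AddMonoidAlgebra.sum_coeff_single f]
  refine Finset.sum_congr rfl fun v _ => ?_
  simp [mono]

theorem char_induction {P : Char → Prop} (h0 : P 0) (ha : ∀ f g, P f → P g → P (f + g))
    (hn : ∀ f, P f → P (-f)) (hm : ∀ i j k, P (mono i j k)) (f : Char) : P f := by
  let H : AddSubgroup Char :=
    { carrier := {f | P f}, zero_mem' := h0, add_mem' := fun h h' => ha _ _ h h'
      neg_mem' := fun h => hn _ h }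
  change f ∈ H
  rw [char_eq_sum f]
  exact AddSubgroup.sum_mem _ fun v _ => AddSubgroup.zsmul_mem _ (hm _ _ _) _

theorem theta_one_sub_mul (c : ℕ) (q : ℤ) (f : Char) :
    theta c q ((1 - mono 0 0 1) * f) = f.coeff (lineVec c q) := by
  induction f using char_induction with
  | h0 => simp
  | ha f g hf hg => rw [mul_add, map_add, hf, hg, AddMonoidAlgebra.coeff_add, Finsupp.add_apply]
  | hn f hf => rw [mul_neg, map_neg, hf, AddMonoidAlgebra.coeff_neg, Finsupp.neg_apply]
  | hm i j k =>
    rw [sub_mul, one_mul, mono_mul, map_sub, theta_mono, theta_mono, mono,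
      AddMonoidAlgebra.coeff_single, Finsupp.single_apply, lineVec]
    simp only [Prod.mk.injEq, zero_add]
    by_cases hi : i = q <;> by_cases hj : j = q <;> simp only [hi, hj, true_and, false_and,
      if_false, sub_zero]
    split_ifs <;> omega

/-- All weights in `f` satisfy `P`. -/
def SuppOn (P : ℤ × ℤ × ℤ → Prop) (f : Char) : Prop := ∀ v, f.coeff v ≠ 0 → P v

section SuppOn

variable {P Q R : ℤ × ℤ × ℤ → Prop} {f g : Char}

theorem SuppOn.add (hf : SuppOn P f) (hg : SuppOn P g) : SuppOn P (f + g) := by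
  intro v hv
  rw [AddMonoidAlgebra.coeff_add, Finsupp.add_apply] at hv
  by_cases h : f.coeff v = 0
  · exact hg v (by simpa [h] using hv)
  · exact hf v h

theorem SuppOn.neg (hf : SuppOn P f) : SuppOn P (-f) := by
  intro v hv
  rw [AddMonoidAlgebra.coeff_neg, Finsupp.neg_apply, neg_ne_zero] at hv
  exact hf v hv

theorem SuppOn.sub (hf : SuppOn P f) (hg : SuppOn P g) : SuppOn P (f - g) := by
  rw [sub_eq_add_neg]
  exact hf.add hg.neg

theorem SuppOn.zero : SuppOn P 0 := fun v hv => (hv (by simp)).elim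

theorem SuppOn.sum {α : Type*} {s : Finset α} {F : α → Char} (h : ∀ a ∈ s, SuppOn P (F a)) :
    SuppOn P (∑ a ∈ s, F a) := by
  classical
  induction s using Finset.induction_on with
  | empty => exact SuppOn.zero
  | insert a s ha ih =>
    rw [sum_insert ha]
    exact (h a (by simp)).add (ih fun b hb => h b (by simp [hb]))

theorem SuppOn.mono {i j k : ℤ} (h : P (i, j, k)) : SuppOn P (mono i j k) := by
  intro v hv
  rw [PTVertex.mono, AddMonoidAlgebra.coeff_single, Finsupp.single_apply] at hv
  split_ifs at hv with h1
  · exact h1 ▸ h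
  · exact (hv rfl).elim

theorem SuppOn.zsmul (hf : SuppOn P f) (a : ℤ) : SuppOn P (a • f) := by
  intro v hv
  rw [AddMonoidAlgebra.coeff_smul, Finsupp.smul_apply] at hv
  exact hf v (right_ne_zero_of_smul hv)

theorem SuppOn.imp (hf : SuppOn P f) (h : ∀ v, P v → Q v) : SuppOn Q f :=
  fun v hv => h v (hf v hv)

theorem SuppOn.mul (hf : SuppOn P f) (hg : SuppOn Q g) (h : ∀ v w, P v → Q w → R (v + w)) :
    SuppOn R (f * g) := by
  classical
  intro v hv
  have h1 := AddMonoidAlgebra.support_coeff_mul_subset f g (Finsupp.mem_support_iff.2 hv)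
  obtain ⟨a, ha, b, hb, rfl⟩ := Finset.mem_add.1 h1
  exact h a b (hf a (Finsupp.mem_support_iff.1 ha)) (hg b (Finsupp.mem_support_iff.1 hb))

theorem SuppOn.conj (hf : SuppOn P f) (h : ∀ v, P v → Q (-v)) : SuppOn Q (conj f) := by
  rw [char_eq_sum f, map_sum]
  refine SuppOn.sum fun v hv => ?_
  rw [map_zsmul, conj_mono]
  exact (SuppOn.mono (h v (hf v (Finsupp.mem_support_iff.1 hv)))).zsmul _

theorem theta_eq_zero' (c : ℕ) (q : ℤ)
    (hf : SuppOn (fun v => ¬ (v.1 = q ∧ v.2.1 = q ∧ v.2.2 ≤ -(c * q))) f) :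
    theta c q f = 0 :=
  Finset.sum_eq_zero fun v hv => if_neg (hf v (Finsupp.mem_support_iff.1 hv))

theorem theta_eq_zero (c : ℕ) (q : ℤ) (hf : SuppOn (fun v => v.1 ≠ v.2.1) f) :
    theta c q f = 0 :=
  theta_eq_zero' c q (hf.imp fun _ h ⟨h1, h2, _⟩ => h (h1.trans h2.symm))

end SuppOn

/-- `(1 - t₁⁻¹) (1 - t₂⁻¹)`. -/
def kappa : Char := (1 - mono 1 0 0) * (1 - mono 0 1 0) * mono (-1) (-1) 0

theorem kappa_eq : kappa = mono 0 0 0 - mono (-1) 0 0 - mono 0 (-1) 0 + mono (-1) (-1) 0 := by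
  simp only [kappa, ← mono_zero, sub_mul, mul_sub, mono_mul]
  norm_num
  ring

/-- The character of the filling `g` of the rows. -/
def rowChar (c A M : ℕ) (d : ℕ → ℕ) (g : ℕ → ℕ → ℤ) : Char :=
  ∑ r ∈ range (M + 1), ∑ i ∈ range (d r), mono i (i + r - A) (-(g r i) - c * i)

section RowChar

variable {c A M : ℕ} {d : ℕ → ℕ} {g : ℕ → ℕ → ℤ}

theorem rowChar_eq (hd : IsShape A M d) : rowChar c A M d g =
    ∑ i ∈ range A, ∑ r ∈ range (M + 1),
      if i < d r then mono i (i + r - A) (-(g r i) - c * i) else 0 := by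
  rw [rowChar, sum_comm' (t' := range A) (s' := fun i => (range (M + 1)).filter fun r => i < d r)]
  · exact sum_congr rfl fun i _ => sum_filter _ _
  · intro r i
    simp only [mem_range, mem_filter]
    have := hd.le r
    omega

theorem theta_shift (hd : IsShape A M d) (q a b : ℤ) :
    theta c q (mono a b 0 * (rowChar c A M d g * conj (rowChar c A M d g))) =
      ∑ i ∈ range A, ∑ k ∈ range A, ∑ r ∈ range (M + 1), ∑ s ∈ range (M + 1),
        if i < d r ∧ k < d s ∧ (k : ℤ) - i + a = q ∧ (s : ℤ) - r + b = a ∧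
          g r i ≤ g s k - c * a then 1 else 0 := by
  rw [rowChar_eq hd, map_sum, sum_mul_sum, sum_comm]
  simp only [map_sum, mul_sum]
  refine sum_congr rfl fun i _ => sum_congr rfl fun k _ => ?_
  simp only [sum_mul, mul_sum, map_sum]
  refine sum_congr rfl fun r _ => sum_congr rfl fun s _ => ?_
  by_cases h1 : i < d r
  swap
  · simp [h1]
  by_cases h2 : k < d s
  swap
  · simp [h2]
  simp only [h1, h2, if_true, conj_mono, mono_mul, theta_mono, true_and]
  refine if_congr ?_ rfl rfl
  constructor
  · rintro ⟨h3, h4, h5⟩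
    refine ⟨by omega, by omega, ?_⟩
    rw [← h3] at h5
    linarith
  · rintro ⟨h3, h4, h5⟩
    refine ⟨by omega, by omega, ?_⟩
    rw [← h3]
    linarith

theorem sum_range_shift (F : ℕ → ℕ → ℤ) :
    ∑ r ∈ range (M + 1), ∑ s ∈ range (M + 1), (if (s : ℤ) - r - 1 = 0 then F r s else 0) =
      (∑ r ∈ range M, F r (r + 1)) := by
  rw [sum_range_succ, sum_eq_zero (s := range (M + 1))
    (f := fun s : ℕ => if (s : ℤ) - M - 1 = 0 then F M s else 0), add_zero]
  · refine sum_congr rfl fun r hr => ?_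
    rw [sum_eq_single_of_mem (r + 1) (by simpa using hr)]
    · simp
    · intro s _ hs
      rw [if_neg]
      omega
  · intro s hs
    rw [if_neg]
    have := mem_range.1 hs
    omega

theorem sum_range_diag (F : ℕ → ℕ → ℤ) :
    ∑ r ∈ range (M + 1), ∑ s ∈ range (M + 1), (if (s : ℤ) - r = 0 then F r s else 0) =
      F 0 0 + ∑ r ∈ range M, F (r + 1) (r + 1) := by
  rw [add_comm (F 0 0), ← sum_range_succ' (fun r => F r r)]
  refine sum_congr rfl fun r hr => ?_
  rw [sum_eq_single_of_mem r hr]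
  · simp
  · intro s _ hs
    rw [if_neg]
    omega

theorem sum_indicator (p q : ℕ → Prop) [DecidablePred p] [DecidablePred q] :
    (∑ r ∈ range M, if p r ∧ ¬ q r then (1 : ℤ) else 0) =
      (∑ r ∈ range M, if p r then (1 : ℤ) else 0) -
        ((range M).filter fun r => p r ∧ q r).card := by
  rw [card_filter]
  push_cast
  rw [← sum_sub_distrib]
  refine sum_congr rfl fun r _ => ?_
  by_cases h1 : p r <;> by_cases h2 : q r <;> simp [h1, h2]

/-- The number of columns where the pairs of rows `i`, `k` meet. -/
def pairsBase (c M : ℕ) (d : ℕ → ℕ) (g : ℕ → ℕ → ℤ) (i k : ℕ) : ℤ × ℤ :=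
  ((if g 0 i ≤ g 0 k then 1 else 0) +
      (∑ r ∈ range M, if i < d (r + 1) ∧ k < d (r + 1) then 1 else 0) -
      ∑ r ∈ range M, if i < d r ∧ k < d (r + 1) then 1 else 0,
    (if g 0 i ≤ g 0 k + c then 1 else 0) +
      (∑ r ∈ range M, if i < d (r + 1) ∧ k < d (r + 1) then 1 else 0) -
      ∑ r ∈ range M, if i < d (r + 1) ∧ k < d r then 1 else 0)

theorem sum_range_pairs (p : Prop) [Decidable p] (a b : ℤ) (i k : ℕ) (Q : ℕ → ℕ → Prop)
    [∀ r s, Decidable (Q r s)] :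
    (∑ r ∈ range (M + 1), ∑ s ∈ range (M + 1),
      if i < d r ∧ k < d s ∧ p ∧ (s : ℤ) - r + b = a ∧ Q r s then (1 : ℤ) else 0) =
    if p then ∑ r ∈ range (M + 1), ∑ s ∈ range (M + 1),
      (if (s : ℤ) - r + b = a then if (i < d r ∧ k < d s) ∧ Q r s then (1 : ℤ) else 0 else 0)
      else 0 := by
  by_cases hp : p
  · rw [if_pos hp]
    refine sum_congr rfl fun r _ => sum_congr rfl fun s _ => ?_
    rw [← ite_and]
    refine if_congr ?_ rfl rfl
    tauto
  · simp [hp]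

theorem sum_pairs_diag {i k : ℕ} (hi : i < d 0) (hk : k < d 0) (a b : ℤ) (hab : a = b) (e : ℤ) :
    (∑ r ∈ range (M + 1), ∑ s ∈ range (M + 1),
      (if (s : ℤ) - r + b = a then if (i < d r ∧ k < d s) ∧ g r i ≤ g s k + e then (1 : ℤ)
        else 0 else 0)) =
    (if g 0 i ≤ g 0 k + e then 1 else 0) +
      ((∑ r ∈ range M, if i < d (r + 1) ∧ k < d (r + 1) then 1 else 0) -
      ((range M).filter fun r => (i < d (r + 1) ∧ k < d (r + 1)) ∧
        g (r + 1) k + e < g (r + 1) i).card) := by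
  have h := sum_range_diag (M := M) fun r s =>
    if (i < d r ∧ k < d s) ∧ g r i ≤ g s k + e then 1 else 0
  rw [← sum_indicator]
  simp only [not_lt]
  have h0 : (if g 0 i ≤ g 0 k + e then (1 : ℤ) else 0) =
      if (i < d 0 ∧ k < d 0) ∧ g 0 i ≤ g 0 k + e then 1 else 0 :=
    if_congr (by tauto) rfl rfl
  rw [h0, ← h]
  refine sum_congr rfl fun r _ => sum_congr rfl fun s _ => if_congr ?_ rfl rfl
  omega

theorem sum_pairs_shift {i k : ℕ} (a b : ℤ) (hab : a = b + 1) (e : ℤ) :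
    (∑ r ∈ range (M + 1), ∑ s ∈ range (M + 1),
      (if (s : ℤ) - r + b = a then if (i < d r ∧ k < d s) ∧ g r i ≤ g s k + e then (1 : ℤ)
        else 0 else 0)) =
      ((∑ r ∈ range M, if i < d r ∧ k < d (r + 1) then 1 else 0) -
      ((range M).filter fun r => (i < d r ∧ k < d (r + 1)) ∧ g (r + 1) k + e < g r i).card) := by
  have h := sum_range_shift (M := M) fun r s =>
    if (i < d r ∧ k < d s) ∧ g r i ≤ g s k + e then 1 else 0
  rw [← sum_indicator]
  simp only [not_lt]
  rw [← h]
  refine sum_congr rfl fun r _ => sum_congr rfl fun s _ => if_congr ?_ rfl rfl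
  omega

theorem sum_pairs_shift' {i k : ℕ} (a b : ℤ) (hab : b = a + 1) (e : ℤ) :
    (∑ r ∈ range (M + 1), ∑ s ∈ range (M + 1),
      (if (s : ℤ) - r + b = a then if (i < d r ∧ k < d s) ∧ g r i ≤ g s k + e then (1 : ℤ)
        else 0 else 0)) =
      ((∑ r ∈ range M, if i < d (r + 1) ∧ k < d r then 1 else 0) -
      ((range M).filter fun r => (i < d (r + 1) ∧ k < d r) ∧ g r k + e < g (r + 1) i).card) := by
  have h := sum_range_shift (M := M) fun r s =>
    if (i < d s ∧ k < d r) ∧ g s i ≤ g r k + e then 1 else 0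
  rw [← sum_indicator]
  simp only [not_lt]
  rw [← h, sum_comm]
  refine sum_congr rfl fun r _ => sum_congr rfl fun s _ => if_congr ?_ rfl rfl
  omega

theorem theta_kappa (hd : IsShape A M d) (q : ℤ) :
    theta c q (kappa * (rowChar c A M d g * conj (rowChar c A M d g))) =
      ∑ i ∈ range A, ∑ k ∈ range A,
        ((if (k : ℤ) - i = q then (pairsBase c M d g i k).1 - (pairsT M d g i k).card +
            (pairsY M d g i k).card else 0) +
          if (k : ℤ) - i - 1 = q then (pairsBase c M d g i k).2 - (pairsR c M d g i k).card +
            (pairsX c M d g i k).card else 0) := by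
  rw [kappa_eq, add_mul, sub_mul, sub_mul, map_add, map_sub, map_sub, theta_shift hd,
    theta_shift hd, theta_shift hd, theta_shift hd, ← sum_sub_distrib, ← sum_sub_distrib,
    ← sum_add_distrib]
  refine sum_congr rfl fun i hi => ?_
  rw [← sum_sub_distrib, ← sum_sub_distrib, ← sum_add_distrib]
  refine sum_congr rfl fun k hk => ?_
  have hi' : i < d 0 := by rw [hd.zero]; exact mem_range.1 hi
  have hk' : k < d 0 := by rw [hd.zero]; exact mem_range.1 hk
  simp only [sub_eq_add_neg (g _ k)]
  rw [sum_range_pairs, sum_range_pairs, sum_range_pairs, sum_range_pairs,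
    sum_pairs_diag hi' hk' 0 0 rfl, sum_pairs_diag hi' hk' (-1) (-1) rfl,
    sum_pairs_shift 0 (-1) rfl, sum_pairs_shift' (-1) 0 rfl]
  simp only [mul_zero, neg_zero, add_zero, mul_neg, mul_one, neg_neg, pairsBase, pairsT, pairsY,
    pairsX, pairsR, ← sub_eq_add_neg, and_assoc]
  split_ifs <;> ring

end RowChar

/-- The quadratic expression with `F_e = - charG Q_e` and
`V = (charG ((1 - t₃) F_v) - charG Q_e) / (1 - t₃)`. -/
def charG (N : Char) : Char := N + conj N * mono (-1) (-1) 0 - N * conj N * kappa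

theorem Fe_eq (μ : YoungDiagram) : Fe μ = -charG (Qe μ) := by
  rw [Fe, charG, kappa]
  ring

theorem one_sub_mul_vertexChar (μ : YoungDiagram) (B : Finset (ℕ × ℕ × ℤ)) :
    (1 - mono 0 0 1) * vertexChar μ B =
      charG ((1 - mono 0 0 1) * Qv B + Qe μ) - charG (Qe μ) := by
  have h3 : mono 0 0 1 * mono 0 0 (-1) = 1 := by rw [mono_mul]; rfl
  have h123 : mono (-1) (-1) (-1) = mono (-1) (-1) 0 * mono 0 0 (-1) := by rw [mono_mul]; rfl
  simp only [vertexChar, charG, kappa, map_add, map_mul, map_sub, map_one, conj_mono, h123,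
    neg_zero]
  generalize conj (Qv B) = q'
  generalize conj (Qe μ) = e'
  generalize Qv B = q
  generalize Qe μ = e
  generalize mono 0 0 1 = z at *
  generalize mono 0 0 (-1) = z' at *
  generalize mono (-1) (-1) 0 = w
  generalize mono 1 0 0 = x
  generalize mono 0 1 0 = y
  grind

/-- The character of the staircase of cells to the left of the first `A` rows. -/
def extChar (A : ℕ) : Char :=
  ∑ i ∈ range A, ∑ r ∈ range (A - i), mono i (i + r - A) 0

/-- The boundary terms of the staircase. -/
def extBoundary (A : ℕ) : Char :=
  mono A 0 0 + (1 - mono 1 0 0) * ∑ i ∈ range A, mono i (i - A) 0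

theorem mul_extChar (A : ℕ) :
    (1 - mono 1 0 0) * (1 - mono 0 1 0) * extChar A = extBoundary A - 1 := by
  have h1 : ∀ i ∈ range A, (1 - mono 0 1 0) * ∑ r ∈ range (A - i), mono i (i + r - A) 0 =
      mono i (i - A) 0 - mono i 0 0 := by
    intro i hi
    have h2 := Finset.sum_range_sub' (fun r : ℕ => mono i (i + r - A) 0) (A - i)
    have h3 : ((A - i : ℕ) : ℤ) = A - i := by
      have := mem_range.1 hi
      omega
    rw [h3] at h2
    simp only [Nat.cast_zero, add_zero, add_sub_cancel, sub_self] at h2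
    rw [← h2, mul_sum]
    refine sum_congr rfl fun r _ => ?_
    rw [sub_mul, one_mul, mono_mul]
    push_cast
    congr 2 <;> ring
  have h4 : (1 - mono 1 0 0) * ∑ i ∈ range A, mono i 0 0 = 1 - mono A 0 0 := by
    have h2 := Finset.sum_range_sub' (fun i : ℕ => mono i 0 0) A
    simp only [Nat.cast_zero, mono_zero] at h2
    rw [← h2, mul_sum]
    refine sum_congr rfl fun r _ => ?_
    rw [sub_mul, one_mul, mono_mul]
    push_cast
    congr 2; ring
  rw [extChar, mul_assoc, mul_sum, sum_congr rfl h1, sum_sub_distrib, mul_sub, h4, extBoundary]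
  ring

theorem suppOn_extBoundary (A : ℕ) : SuppOn (fun v => (A : ℤ) ≤ v.1 - v.2.1) (extBoundary A) := by
  rw [extBoundary, sub_mul, one_mul, mul_sum]
  refine (SuppOn.mono (by simp)).add ((SuppOn.sum fun i _ => SuppOn.mono ?_).sub
    (SuppOn.sum fun i _ => ?_))
  · simp only; omega
  · rw [mono_mul]
    exact SuppOn.mono (by simp only; omega)

theorem charG_eq (A : ℕ) (N : Char) :
    charG N = -(kappa * ((N + extChar A) * conj (N + extChar A))) +
      kappa * (extChar A * conj (extChar A)) + N * conj (extBoundary A) +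
      conj N * mono (-1) (-1) 0 * extBoundary A := by
  have h1 := mul_extChar A
  have h2 : kappa = (1 - mono (-1) 0 0) * (1 - mono 0 (-1) 0) := by
    rw [kappa_eq, ← mono_zero, sub_mul, mul_sub, mul_sub, mono_mul, mono_mul, mono_mul, mono_mul]
    norm_num
    ring
  have h3 := congrArg conj h1
  simp only [map_mul, map_sub, map_one, conj_mono, neg_zero, ← h2] at h3
  have h4 : kappa * extChar A = (extBoundary A - 1) * mono (-1) (-1) 0 := by
    rw [← h1, kappa]; ring
  rw [charG, map_add]
  linear_combination N * h3 + conj N * h4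

theorem theta_charG (c : ℕ) (q : ℤ) {A : ℕ} {N : Char}
    (hN : SuppOn (fun v => v.1 - v.2.1 < A) N) :
    theta c q (charG N) = -theta c q (kappa * ((N + extChar A) * conj (N + extChar A))) +
      theta c q (kappa * (extChar A * conj (extChar A))) := by
  have hb := suppOn_extBoundary A
  rw [charG_eq A N, map_add, map_add, map_add, map_neg, theta_eq_zero (f := N * _),
    theta_eq_zero (f := conj N * _ * _), add_zero, add_zero]
  · refine SuppOn.mul (P := fun v => -(A : ℤ) < v.1 - v.2.1)
      (SuppOn.mul (P := fun v => -(A : ℤ) < v.1 - v.2.1) (Q := fun v => v.1 = v.2.1)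
        (hN.conj fun v hv => ?_) (SuppOn.mono rfl) fun v w hv hw => ?_) hb fun v w hv hw => ?_
    · simp only [Prod.fst_neg, Prod.snd_neg]; omega
    · simp only [Prod.fst_add, Prod.snd_add]; omega
    · simp only [Prod.fst_add, Prod.snd_add]; omega
  · refine SuppOn.mul hN (hb.conj (Q := fun v => v.1 - v.2.1 ≤ -(A : ℤ)) fun v hv => ?_)
      fun v w hv hw => ?_
    · simp only [Prod.fst_neg, Prod.snd_neg]; omega
    · simp only [Prod.fst_add, Prod.snd_add]; omega

section Coeff

variable {c A M : ℕ} {d : ℕ → ℕ} {g : ℕ → ℕ → ℤ}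

/-- The coefficients of the vertex character at the weights that vanish on the plane. -/
theorem coeff_vertexChar {μ : YoungDiagram} {B : Finset (ℕ × ℕ × ℤ)} (hd : IsShape A M d)
    (h0 : ∀ i, g 0 i = -(c * i : ℤ))
    (hQ : SuppOn (fun v => v.1 - v.2.1 < A) (Qe μ))
    (hB : SuppOn (fun v => v.1 - v.2.1 < A) (Qv B))
    (hμ : Qe μ + extChar A = rowChar c A M d fun _ i => -(c * i : ℤ))
    (hg : (1 - mono 0 0 1) * Qv B + Qe μ + extChar A = rowChar c A M d g)
    (hmono : RowMono M d g) (q : ℤ) :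
    (vertexChar μ B).coeff (lineVec c q) =
      (∑ x ∈ range A ×ˢ range A, if (x.2 : ℤ) - x.1 = q then
        ((pairsT M d g x.1 x.2).card : ℤ) - (pairsY M d g x.1 x.2).card else 0) +
      ∑ x ∈ range A ×ˢ range A, if (x.2 : ℤ) - x.1 - 1 = q then
        -(excess c M d g x.1 x.2 : ℤ) else 0 := by
  have hN : SuppOn (fun v => v.1 - v.2.1 < A) ((1 - mono 0 0 1) * Qv B + Qe μ) := by
    refine SuppOn.add ?_ hQ
    rw [sub_mul, one_mul]
    refine hB.sub (SuppOn.mul (P := fun v => v.1 = v.2.1) (SuppOn.mono rfl) hB fun v w hv hw => ?_)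
    simp only [Prod.fst_add, Prod.snd_add]; omega
  rw [← theta_one_sub_mul, one_sub_mul_vertexChar, map_sub, theta_charG c q hN,
    theta_charG c q hQ, hμ, hg, theta_kappa hd, theta_kappa hd, add_sub_add_right_eq_sub,
    neg_sub_neg, sum_product, sum_product, ← sum_sub_distrib, ← sum_add_distrib]
  refine sum_congr rfl fun i _ => ?_
  rw [← sum_sub_distrib, ← sum_add_distrib]
  refine sum_congr rfl fun k _ => ?_
  have h1 : pairsBase c M d g i k = pairsBase c M d (fun _ i => -(c * i : ℤ)) i k := by
    simp [pairsBase, h0]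
  have h2 := hmono.card_le (c := c) hd h0 i k
  rw [h1, pairsT_trivial hd, card_pairsX_trivial hd, excess, Nat.cast_sub h2]
  push_cast
  split_ifs <;> ring

theorem card_row_end (hd : IsShape A M d) {i : ℕ} (hi : i < A) (k : ℕ) :
    (∑ r ∈ range M, if i < d r ∧ k < d (r + 1) then (1 : ℤ) else 0) -
      (∑ r ∈ range M, if i < d (r + 1) ∧ k < d (r + 1) then (1 : ℤ) else 0) =
      if k < i then 1 else 0 := by
  have hM : d M ≤ i := by rw [hd.top]; exact Nat.zero_le _
  obtain ⟨s, hs, hs1, hs2⟩ : ∃ s < M, d (s + 1) ≤ i ∧ i < d s := by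
    have hex : ∃ r, d r ≤ i := ⟨M, hM⟩
    have h1 := Nat.find_spec hex
    have h2 : Nat.find hex ≠ 0 := fun h0 => by
      rw [h0, hd.zero] at h1; omega
    obtain ⟨s, hs⟩ := Nat.exists_eq_succ_of_ne_zero h2
    have h3 := Nat.find_min' hex hM
    rw [hs] at h1
    exact ⟨s, by omega, h1, not_le.1 (Nat.find_min hex (by omega))⟩
  rw [← sum_sub_distrib, sum_eq_single_of_mem s (mem_range.2 hs)]
  · have := hd.le_succ s
    split_ifs <;> omega
  · intro r _ hr
    have : d r ≤ i ∨ i < d (r + 1) := by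
      rcases lt_or_gt_of_ne hr with h | h
      · exact Or.inr (lt_of_lt_of_le hs2 (hd.anti h))
      · exact Or.inl ((hd.anti h).trans hs1)
    have := hd.succ_le r
    split_ifs <;> omega

theorem theta_kappa_trivial (hd : IsShape A M d) (q : ℤ) :
    theta 0 q (kappa * (rowChar 0 A M d (fun _ _ => 0) * conj (rowChar 0 A M d fun _ _ => 0))) =
      ∑ i ∈ range A, ∑ k ∈ range A,
        ((if (k : ℤ) - i = q then 1 - (if k < i then 1 else 0) else 0) +
          if (k : ℤ) - i - 1 = q then 1 - (if i < k then 1 else 0) else 0) := by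
  rw [theta_kappa hd]
  refine sum_congr rfl fun i hi => sum_congr rfl fun k hk => ?_
  have h1 := card_row_end hd (mem_range.1 hi) k
  have h2 := card_row_end hd (mem_range.1 hk) i
  simp only [and_comm] at h1 h2
  simp only [pairsBase, pairsT, pairsY, pairsX, pairsR, lt_irrefl, and_false, filter_false,
    card_empty, le_refl, if_true, Nat.cast_zero, sub_zero, add_zero]
  simp only [and_comm]
  split_ifs at * <;> linarith

theorem suppOn_Qe (μ : YoungDiagram) : SuppOn (fun v => v.2.2 = 0) (Qe μ) :=
  SuppOn.sum fun _ _ => SuppOn.mono rfl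

theorem suppOn_Fe (μ : YoungDiagram) : SuppOn (fun v => v.2.2 = 0) (Fe μ) := by
  have hadd : ∀ v w : ℤ × ℤ × ℤ, v.2.2 = 0 → w.2.2 = 0 → (v + w).2.2 = 0 := by
    intro v w hv hw
    simp [hv, hw]
  have hm : ∀ i j : ℤ, SuppOn (fun v => v.2.2 = 0) (mono i j 0) := fun i j => SuppOn.mono rfl
  have hc : SuppOn (fun v => v.2.2 = 0) (conj (Qe μ)) :=
    (suppOn_Qe μ).conj fun v hv => by simp [hv]
  have hk : SuppOn (fun v => v.2.2 = 0) kappa := by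
    rw [kappa_eq]
    exact (((hm _ _).sub (hm _ _)).sub (hm _ _)).add (hm _ _)
  rw [Fe_eq, charG]
  exact (((suppOn_Qe μ).add (hc.mul (hm _ _) hadd)).sub
    (((suppOn_Qe μ).mul hc hadd).mul hk hadd)).neg

theorem isShape_ext (A : ℕ) : IsShape A A fun r => A - r :=
  ⟨by simp, fun r => by omega, fun r => by omega, by simp⟩

theorem extChar_eq (A : ℕ) : extChar A = rowChar 0 A A (fun r => A - r) fun _ _ => 0 := by
  rw [extChar, rowChar, sum_comm' (t' := range (A + 1)) (s' := fun r => range (A - r))]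
  · simp
  · intro i r
    simp only [mem_range]
    omega

/-- The edge character has no nonzero weights that vanish on the plane. -/
theorem coeff_Fe {μ : YoungDiagram} (hd : IsShape A M d)
    (hQ : SuppOn (fun v => v.1 - v.2.1 < A) (Qe μ))
    (hμ : Qe μ + extChar A = rowChar c A M d fun _ i => -(c * i : ℤ)) {q : ℤ} (hq : q ≠ 0) :
    (Fe μ).coeff (lineVec c q) = 0 := by
  rcases Nat.eq_zero_or_pos c with rfl | hc
  · rw [← theta_one_sub_mul, sub_mul, one_mul, map_sub, theta_eq_zero' (f := mono 0 0 1 * _),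
      sub_zero, Fe_eq, map_neg, theta_charG 0 q hQ, hμ]
    · have h := theta_kappa_trivial hd q
      have h' := theta_kappa_trivial (isShape_ext A) q
      rw [← extChar_eq] at h'
      simp only [Nat.cast_zero, zero_mul, neg_zero]
      rw [h, h']
      simp
    · refine SuppOn.mul (P := fun v => v.2.2 = 1) (SuppOn.mono rfl) (suppOn_Fe μ)
        fun v w hv hw => ?_
      simp [hv, hw]
  · by_contra h
    have := suppOn_Fe μ _ h
    simp only [lineVec, neg_eq_zero, mul_eq_zero, Nat.cast_eq_zero] at this
    omega

end Coeff

end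

section

open Finset

/-! ### Restricted partitions as fillings of the rows -/

section Fillings

/-- The number of rows. -/
def rowCount (μ : YoungDiagram) : ℕ := μ.colLen 0

/-- The number of columns of the extended diagram. -/
def colCount (μ : YoungDiagram) : ℕ := rowCount μ + μ.rowLen 0

theorem lt_rowCount_iff (μ : YoungDiagram) (i : ℕ) : i < rowCount μ ↔ 0 < μ.rowLen i := by
  rw [rowCount, ← YoungDiagram.mem_iff_lt_colLen, YoungDiagram.mem_iff_lt_rowLen]

theorem lt_rowCount {μ : YoungDiagram} {i j : ℕ} (h : (i, j) ∈ μ) : i < rowCount μ := by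
  rw [lt_rowCount_iff]
  have := YoungDiagram.mem_iff_lt_rowLen.1 h
  omega

theorem exists_not_lt (μ : YoungDiagram) (r : ℕ) :
    ∃ i, ¬ i + r < μ.rowLen i + rowCount μ := by
  refine ⟨rowCount μ, ?_⟩
  have := (lt_rowCount_iff μ (rowCount μ)).not.1 (lt_irrefl _)
  omega

/-- The number of rows that reach the column `r` of the extended diagram. -/
def rowsAt (μ : YoungDiagram) (r : ℕ) : ℕ := Nat.find (exists_not_lt μ r)

theorem lt_rowsAt_iff {μ : YoungDiagram} {r i : ℕ} :
    i < rowsAt μ r ↔ i + r < μ.rowLen i + rowCount μ := by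
  rw [rowsAt, Nat.lt_find_iff]
  refine ⟨fun h => not_not.1 (h i le_rfl), fun h k hk => not_not.2 ?_⟩
  have := μ.rowLen_anti _ _ hk
  omega

theorem isShape_rowsAt (μ : YoungDiagram) : IsShape (rowCount μ) (colCount μ) (rowsAt μ) where
  zero := by
    refine eq_of_forall_lt_iff fun i => ?_
    rw [lt_rowsAt_iff]
    have := lt_rowCount_iff μ i
    omega
  succ_le r := le_of_forall_lt fun i => by
    rw [lt_rowsAt_iff, lt_rowsAt_iff]
    omega
  le_succ r := by
    by_contra! h
    have h1 := lt_rowsAt_iff.1 h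
    have h2 := μ.rowLen_anti _ _ (Nat.le_add_right (rowsAt μ (r + 1)) 1)
    have h3 : rowsAt μ (r + 1) < rowsAt μ (r + 1) := by
      rw [lt_rowsAt_iff]
      omega
    exact absurd h3 (lt_irrefl _)
  top := by
    by_contra h
    have := lt_rowsAt_iff.1 (Nat.pos_of_ne_zero h)
    simp only [colCount] at this
    omega

theorem lt_rowsAt_of_mem {μ : YoungDiagram} {i j : ℕ} (h : (i, j) ∈ μ) :
    i < rowsAt μ (j + rowCount μ - i) := by
  rw [lt_rowsAt_iff]
  have h1 := lt_rowCount h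
  have h2 := YoungDiagram.mem_iff_lt_rowLen.1 h
  omega

theorem le_colCount_of_mem {μ : YoungDiagram} {i j : ℕ} (h : (i, j) ∈ μ) :
    j + rowCount μ - i < colCount μ := by
  have h2 := YoungDiagram.mem_iff_lt_rowLen.1 h
  have h3 := μ.rowLen_anti _ _ (Nat.zero_le i)
  simp only [colCount]
  omega

theorem mem_of_lt_rowsAt {μ : YoungDiagram} {i r : ℕ} (h : i < rowsAt μ r)
    (hr : rowCount μ ≤ i + r) : (i, i + r - rowCount μ) ∈ μ := by
  rw [YoungDiagram.mem_iff_lt_rowLen]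
  rw [lt_rowsAt_iff] at h
  omega

theorem sum_rows {R : Type*} [AddCommMonoid R] (μ : YoungDiagram) (F : ℕ → ℕ → R) :
    ∑ r ∈ range (colCount μ + 1), ∑ i ∈ range (rowsAt μ r), F i r =
      ∑ x ∈ μ.cells, F x.1 (x.2 + rowCount μ - x.1) +
        ∑ i ∈ range (rowCount μ), ∑ r ∈ range (rowCount μ - i), F i r := by
  have hd := isShape_rowsAt μ
  rw [sum_comm' (t' := range (rowCount μ))
    (s' := fun i => range ((rowCount μ - i) + μ.rowLen i))]
  · rw [sum_finset_product μ.cells (range (rowCount μ)) (fun i => range (μ.rowLen i)),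
      add_comm, ← sum_add_distrib]
    · refine sum_congr rfl fun i hi => ?_
      rw [sum_range_add]
      congr 1
      refine sum_congr rfl fun j _ => ?_
      have := mem_range.1 hi
      congr 1
      simp only
      omega
    · rintro ⟨i, j⟩
      simp only [YoungDiagram.mem_cells, mem_range]
      exact ⟨fun h => ⟨lt_rowCount h, YoungDiagram.mem_iff_lt_rowLen.1 h⟩,
        fun h => YoungDiagram.mem_iff_lt_rowLen.2 h.2⟩
  · intro r i
    simp only [mem_range, lt_rowsAt_iff, colCount]
    have h1 := lt_rowCount_iff μ i
    have h2 := μ.rowLen_anti _ _ (Nat.zero_le i)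
    omega

/-- The height of a restricted partition over a cell. -/
def height (B : Finset (ℕ × ℕ × ℤ)) (i j : ℕ) : ℕ :=
  (B.filter fun x => x.1 = i ∧ x.2.1 = j).card

theorem IsRestricted.mem_iff {μ : YoungDiagram} {B : Finset (ℕ × ℕ × ℤ)} (hB : IsRestricted μ B)
    (i j : ℕ) (l : ℤ) : (i, j, l) ∈ B ↔ -(height B i j : ℤ) ≤ l ∧ l < 0 := by
  have hup : ∀ l l' : ℤ, (i, j, l) ∈ B → l ≤ l' → l' < 0 → (i, j, l') ∈ B := by
    intro l l' h h1 h2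
    have h3 := hB.upward h (l' - l).toNat (by omega)
    have h4 : l + ((l' - l).toNat : ℤ) = l' := by omega
    rwa [h4] at h3
  have hinj : Function.Injective fun l : ℤ => (i, j, l) := fun a b h => by simpa using h
  constructor
  · intro h
    have hl := (hB.cyl i j l h).2
    refine ⟨?_, hl⟩
    have h1 : (Ico l 0).image (fun l : ℤ => (i, j, l)) ⊆
        B.filter fun x => x.1 = i ∧ x.2.1 = j := by
      intro x hx
      obtain ⟨a, ha, rfl⟩ := mem_image.1 hx
      rw [mem_Ico] at ha
      exact mem_filter.2 ⟨hup l a h ha.1 ha.2, rfl, rfl⟩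
    have h2 := card_le_card h1
    rw [card_image_of_injective _ hinj, Int.card_Ico] at h2
    simp only [height]
    omega
  · rintro ⟨h1, h2⟩
    by_contra h
    have h3 : (B.filter fun x => x.1 = i ∧ x.2.1 = j) ⊆
        (Ico (l + 1) 0).image (fun l : ℤ => (i, j, l)) := by
      rintro ⟨a, b, s⟩ hx
      simp only [mem_filter] at hx
      obtain ⟨hx, rfl, rfl⟩ := hx
      refine mem_image.2 ⟨s, mem_Ico.2 ⟨?_, (hB.cyl _ _ _ hx).2⟩, rfl⟩
      by_contra h4
      exact h (hup s l hx (by omega) h2)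
    have h4 := card_le_card h3
    rw [card_image_of_injective _ hinj, Int.card_Ico] at h4
    simp only [height] at h1
    omega

theorem IsRestricted.height_eq_zero {μ : YoungDiagram} {B : Finset (ℕ × ℕ × ℤ)}
    (hB : IsRestricted μ B) {i j : ℕ} (h : (i, j) ∉ μ) : height B i j = 0 := by
  by_contra h0
  have := (hB.mem_iff i j (-1)).2 (by omega)
  exact h (hB.cyl _ _ _ this).1

theorem IsRestricted.height_le_fst {μ : YoungDiagram} {B : Finset (ℕ × ℕ × ℤ)}
    (hB : IsRestricted μ B) {i j : ℕ} (h : (i + 1, j) ∈ μ) :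
    height B i j ≤ height B (i + 1) j := by
  by_contra! h0
  have h1 := (hB.mem_iff i j (-(height B i j : ℤ))).2 (by omega)
  have h2 := (hB.mem_iff _ _ _).1 (hB.mul_x₁ _ _ _ h1 h)
  omega

theorem IsRestricted.height_le_snd {μ : YoungDiagram} {B : Finset (ℕ × ℕ × ℤ)}
    (hB : IsRestricted μ B) {i j : ℕ} (h : (i, j + 1) ∈ μ) :
    height B i j ≤ height B i (j + 1) := by
  by_contra! h0
  have h1 := (hB.mem_iff i j (-(height B i j : ℤ))).2 (by omega)
  have h2 := (hB.mem_iff _ _ _).1 (hB.mul_x₂ _ _ _ h1 h)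
  omega

/-- The filling of the rows of the extended diagram given by a restricted partition. -/
def filling (c : ℕ) (μ : YoungDiagram) (B : Finset (ℕ × ℕ × ℤ)) (r i : ℕ) : ℤ :=
  (if rowCount μ ≤ i + r then (height B i (i + r - rowCount μ) : ℤ) else 0) - c * i

variable {c : ℕ} {μ : YoungDiagram} {B : Finset (ℕ × ℕ × ℤ)}

theorem filling_of_mem (c : ℕ) (B : Finset (ℕ × ℕ × ℤ)) {i j : ℕ} (h : (i, j) ∈ μ) :
    filling c μ B (j + rowCount μ - i) i = height B i j - c * i := by
  have := lt_rowCount h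
  rw [filling, if_pos (by omega)]
  congr 3
  omega

theorem IsRestricted.filling_zero (hB : IsRestricted μ B) (i : ℕ) :
    filling c μ B 0 i = -(c * i : ℤ) := by
  rw [filling]
  split_ifs with h
  · rw [hB.height_eq_zero]
    · simp
    · intro hm
      have := lt_rowCount hm
      omega
  · simp

theorem IsRestricted.rowMono (hB : IsRestricted μ B) :
    RowMono (colCount μ) (rowsAt μ) (filling c μ B) := by
  intro r _ i hi
  simp only [filling]
  rcases le_or_gt (rowCount μ) (i + r) with h | h
  · have h1 := mem_of_lt_rowsAt hi (by omega)
    have h2 : i + (r + 1) - rowCount μ = i + r - rowCount μ + 1 := by omega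
    rw [h2] at h1 ⊢
    have := hB.height_le_snd h1
    rw [if_pos h, if_pos (by omega)]
    omega
  · rw [if_neg (by omega)]
    split_ifs <;> omega

theorem IsRestricted.colMono (hB : IsRestricted μ B) :
    ColMono c (colCount μ) (rowsAt μ) (filling c μ B) := by
  intro r _ i _ hi
  simp only [filling]
  have h2 : i + (r + 1) = i + 1 + r := by omega
  rw [h2]
  push_cast
  rcases le_or_gt (rowCount μ) (i + 1 + r) with h | h
  · have := hB.height_le_fst (mem_of_lt_rowsAt hi h)
    rw [if_pos h, if_pos h]
    have : (c : ℤ) * (i + 1) = c * i + c := by ring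
    omega
  · rw [if_neg (by omega), if_neg (by omega)]
    have : (c : ℤ) * (i + 1) = c * i + c := by ring
    omega

/-- The restricted partition given by a filling. -/
def boxes (c : ℕ) (μ : YoungDiagram) (g : ℕ → ℕ → ℤ) : Finset (ℕ × ℕ × ℤ) :=
  μ.cells.biUnion fun x =>
    (Ico (-(g (x.2 + rowCount μ - x.1) x.1 + c * x.1)) 0).image fun l => (x.1, x.2, l)

theorem mem_boxes {g : ℕ → ℕ → ℤ} {i j : ℕ} {l : ℤ} : (i, j, l) ∈ boxes c μ g ↔
    (i, j) ∈ μ ∧ -(g (j + rowCount μ - i) i + c * i) ≤ l ∧ l < 0 := by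
  simp only [boxes, mem_biUnion, mem_image, mem_Ico, Prod.mk.injEq, Prod.exists,
    YoungDiagram.mem_cells]
  constructor
  · rintro ⟨a, b, h, l', h', rfl, rfl, rfl⟩
    exact ⟨h, h'⟩
  · rintro ⟨h, h'⟩
    exact ⟨i, j, h, l, h', rfl, rfl, rfl⟩

theorem isRestricted_boxes {g : ℕ → ℕ → ℤ} (hr : RowMono (colCount μ) (rowsAt μ) g)
    (hc : ColMono c (colCount μ) (rowsAt μ) g) : IsRestricted μ (boxes c μ g) where
  cyl i j l h := ⟨(mem_boxes.1 h).1, (mem_boxes.1 h).2.2⟩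
  mul_x₁ i j l h h' := by
    rw [mem_boxes] at h ⊢
    refine ⟨h', le_trans ?_ h.2.1, h.2.2⟩
    have h1 := lt_rowCount h'
    have h2 := le_colCount_of_mem h'
    have h3 := lt_rowsAt_of_mem h'
    have h4 := lt_rowsAt_of_mem h.1
    have h5 : j + rowCount μ - i = j + rowCount μ - (i + 1) + 1 := by omega
    rw [h5] at h4 ⊢
    have h6 := hc _ h2 i h4 h3
    push_cast
    linarith
  mul_x₂ i j l h h' := by
    rw [mem_boxes] at h ⊢
    refine ⟨h', le_trans ?_ h.2.1, h.2.2⟩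
    have h1 := lt_rowCount h'
    have h2 := le_colCount_of_mem h.1
    have h3 := lt_rowsAt_of_mem h'
    have h5 : j + 1 + rowCount μ - i = j + rowCount μ - i + 1 := by omega
    rw [h5] at h3 ⊢
    have h6 := hr _ h2 i h3
    linarith
  mul_x₃ i j l h h' := by
    rw [mem_boxes] at h ⊢
    exact ⟨h.1, by omega, h'⟩

theorem IsRestricted.boxes_filling (hB : IsRestricted μ B) : boxes c μ (filling c μ B) = B := by
  ext ⟨i, j, l⟩
  rw [mem_boxes, hB.mem_iff]
  constructor
  · rintro ⟨h, h1, h2⟩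
    rw [filling_of_mem c B h] at h1
    exact ⟨by linarith, h2⟩
  · intro h
    have h3 := (hB.cyl _ _ _ ((hB.mem_iff i j l).2 h)).1
    rw [filling_of_mem c B h3]
    exact ⟨h3, by linarith [h.1], h.2⟩

theorem RowMono.ge {M : ℕ} {d : ℕ → ℕ} {A : ℕ} (hd : IsShape A M d) {g : ℕ → ℕ → ℤ}
    (hg : RowMono M d g) (h0 : ∀ i, g 0 i = -(c * i : ℤ)) {r i : ℕ} (hr : r ≤ M)
    (hi : i < d r) : -(c * i : ℤ) ≤ g r i := by
  induction r with
  | zero => exact (h0 i).ge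
  | succ r ih => exact (ih (by omega) (lt_of_lt_of_le hi (hd.succ_le r))).trans (hg r hr i hi)

theorem ColMono.le_ext {g : ℕ → ℕ → ℤ} (hg : ColMono c (colCount μ) (rowsAt μ) g)
    (h0 : ∀ i, g 0 i = -(c * i : ℤ)) {r i : ℕ} (hr : i + r < rowCount μ) :
    g r i ≤ -(c * i : ℤ) := by
  induction r generalizing i with
  | zero => exact (h0 i).le
  | succ r ih =>
    have h1 := ih (i := i + 1) (by omega)
    have h2 := hg r (by simp only [colCount]; omega) i (by rw [lt_rowsAt_iff]; omega)
      (by rw [lt_rowsAt_iff]; omega)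
    push_cast at h1
    linarith

theorem height_boxes {g : ℕ → ℕ → ℤ} {i j : ℕ} (h : (i, j) ∈ μ)
    (hg : -(c * i : ℤ) ≤ g (j + rowCount μ - i) i) :
    (height (boxes c μ g) i j : ℤ) = g (j + rowCount μ - i) i + c * i := by
  have hinj : Function.Injective fun l : ℤ => (i, j, l) := fun a b h => by simpa using h
  have h1 : (boxes c μ g).filter (fun x => x.1 = i ∧ x.2.1 = j) =
      (Ico (-(g (j + rowCount μ - i) i + c * i)) 0).image fun l => (i, j, l) := by
    ext ⟨a, b, l⟩
    simp only [mem_filter, mem_boxes, mem_image, mem_Ico, Prod.mk.injEq]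
    constructor
    · rintro ⟨⟨_, h2⟩, rfl, rfl⟩
      exact ⟨l, h2, rfl, rfl, rfl⟩
    · rintro ⟨l', h2, rfl, rfl, rfl⟩
      exact ⟨⟨h, h2⟩, rfl, rfl⟩
  rw [height, h1, card_image_of_injective _ hinj, Int.card_Ico]
  omega

theorem filling_boxes {g : ℕ → ℕ → ℤ} (hr : RowMono (colCount μ) (rowsAt μ) g)
    (hc : ColMono c (colCount μ) (rowsAt μ) g) (h0 : ∀ i, g 0 i = -(c * i : ℤ)) {r i : ℕ}
    (hrM : r ≤ colCount μ) (hi : i < rowsAt μ r) : filling c μ (boxes c μ g) r i = g r i := by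
  have h1 := hr.ge (isShape_rowsAt μ) h0 hrM hi
  rcases le_or_gt (rowCount μ) (i + r) with h | h
  · have h2 := mem_of_lt_rowsAt hi h
    have h3 : i + r - rowCount μ + rowCount μ - i = r := by omega
    have h4 := height_boxes (c := c) (g := g) h2 (by rw [h3]; exact h1)
    have h5 := filling_of_mem c (boxes c μ g) h2
    rw [h3] at h4 h5
    rw [h5, h4]
    ring
  · rw [filling, if_neg (by omega)]
    have := hc.le_ext h0 h
    omega

theorem IsRestricted.sum_boxes {R : Type*} [AddCommMonoid R] (hB : IsRestricted μ B)
    (F : ℕ × ℕ × ℤ → R) :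
    ∑ b ∈ B, F b = ∑ x ∈ μ.cells, ∑ l ∈ Ico (-(height B x.1 x.2 : ℤ)) 0, F (x.1, x.2, l) := by
  rw [sum_sigma']
  refine (sum_bij' (fun x _ => (x.1.1, x.1.2, x.2)) (fun b _ => ⟨(b.1, b.2.1), b.2.2⟩) ?_ ?_
    ?_ ?_ ?_).symm
  · rintro ⟨⟨i, j⟩, l⟩ h
    simp only [mem_sigma, mem_Ico] at h
    exact (hB.mem_iff _ _ _).2 h.2
  · rintro ⟨i, j, l⟩ h
    simp only [mem_sigma, mem_Ico, YoungDiagram.mem_cells]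
    exact ⟨(hB.cyl _ _ _ h).1, (hB.mem_iff _ _ _).1 h⟩
  · rintro ⟨⟨i, j⟩, l⟩ _; rfl
  · rintro ⟨i, j, l⟩ _; rfl
  · rintro ⟨⟨i, j⟩, l⟩ _; rfl

theorem one_sub_mul_sum_mono (i j : ℤ) (m : ℤ) (k : ℕ) :
    (1 - mono 0 0 1) * ∑ l ∈ Ico m (m + k), mono i j l = mono i j m - mono i j (m + k) := by
  induction k with
  | zero => simp
  | succ k ih =>
    have h : Ico m (m + (k + 1 : ℕ)) = insert (m + k) (Ico m (m + k)) := by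
      ext x
      simp only [mem_Ico, mem_insert]
      omega
    rw [h, sum_insert (by simp), mul_add, ih, sub_mul, one_mul, mono_mul]
    push_cast
    rw [zero_add, zero_add, add_comm (1 : ℤ), add_assoc]
    ring

theorem IsRestricted.rowChar_filling (hB : IsRestricted μ B) :
    (1 - mono 0 0 1) * Qv B + Qe μ + extChar (rowCount μ) =
      rowChar c (rowCount μ) (colCount μ) (rowsAt μ) (filling c μ B) := by
  rw [rowChar, sum_rows μ fun i r => mono i (i + r - rowCount μ) (-filling c μ B r i - c * i)]
  congr 1
  · rw [Qv, hB.sum_boxes, mul_sum, Qe, ← sum_add_distrib]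
    refine sum_congr rfl fun x hx => ?_
    have h := one_sub_mul_sum_mono x.1 x.2 (-(height B x.1 x.2 : ℤ)) (height B x.1 x.2)
    rw [neg_add_cancel] at h
    have hx' : (x.1, x.2) ∈ μ := hx
    rw [h, filling_of_mem c B hx', sub_add_cancel]
    have := lt_rowCount hx'
    congr 1
    · push_cast [Nat.cast_sub (by omega : x.1 ≤ x.2 + rowCount μ)]
      ring
    · ring
  · refine sum_congr rfl fun i hi => sum_congr rfl fun r hr => ?_
    have := mem_range.1 hr
    rw [filling, if_neg (by omega)]
    congr 1
    ring

theorem Qe_add_extChar (c : ℕ) (μ : YoungDiagram) : Qe μ + extChar (rowCount μ) =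
    rowChar c (rowCount μ) (colCount μ) (rowsAt μ) fun _ (i : ℕ) => -(c * i : ℤ) := by
  have h0 : IsRestricted μ ∅ := ⟨by simp, by simp, by simp, by simp⟩
  have h := h0.rowChar_filling (c := c)
  have h1 : filling c μ ∅ = fun _ (i : ℕ) => -(c * i : ℤ) := by
    funext r i
    simp [filling, height]
  rw [h1] at h
  rw [← h]
  simp [Qv]

theorem IsRestricted.card_eq (hB : IsRestricted μ B) :
    ∑ r ∈ range (colCount μ + 1), ∑ i ∈ range (rowsAt μ r), (filling c μ B r i + c * i) =
      B.card := by
  rw [sum_rows μ fun i r => filling c μ B r i + c * i, card_eq_sum_ones, hB.sum_boxes]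
  rw [sum_eq_zero (s := range (rowCount μ)), add_zero]
  · push_cast
    refine sum_congr rfl fun x hx => ?_
    rw [filling_of_mem c B (show (x.1, x.2) ∈ μ from hx)]
    simp
  · intro i _
    refine sum_eq_zero fun r hr => ?_
    have := mem_range.1 hr
    rw [filling, if_neg (by omega)]
    ring

theorem suppOn_Qe_content (μ : YoungDiagram) :
    SuppOn (fun v => v.1 - v.2.1 < rowCount μ) (Qe μ) := by
  refine SuppOn.sum fun x hx => SuppOn.mono ?_
  have := lt_rowCount (show (x.1, x.2) ∈ μ from hx)
  simp only
  omega

theorem IsRestricted.suppOn_Qv (hB : IsRestricted μ B) :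
    SuppOn (fun v => v.1 - v.2.1 < rowCount μ) (Qv B) := by
  refine SuppOn.sum fun x hx => SuppOn.mono ?_
  have := lt_rowCount (hB.cyl x.1 x.2.1 x.2.2 hx).1
  simp only
  omega

end Fillings

end

section

open Finset PowerSeries

/-! ### Permutations of the entries in each column -/

section Orbits

/-- The number of rows in the columns after the first. -/
abbrev rowSize (M : ℕ) (d : ℕ → ℕ) (r : Fin M) : ℕ := d (r + 1)

/-- Permutations of the rows in each column after the first. -/
abbrev RowPerm (M : ℕ) (d : ℕ → ℕ) : Type := ∀ r, Equiv.Perm (Fin (rowSize M d r))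

/-- Fillings of the columns after the first. -/
abbrev Conf (M : ℕ) (d : ℕ → ℕ) : Type := ∀ r, Fin (rowSize M d r) → ℤ

variable {c A M : ℕ} {d : ℕ → ℕ}

/-- A filling of the columns after the first, extended by the trivial first column. -/
def fullConf (c : ℕ) (f : Conf M d) : ℕ → ℕ → ℤ
  | 0, i => -(c * i)
  | r + 1, i => if h : r < M then (if h' : i < d (r + 1) then f ⟨r, h⟩ ⟨i, h'⟩ else 0) else 0

/-- The action of permutations on fillings. -/
def act (σ : RowPerm M d) (f : Conf M d) : Conf M d := fun r i => f r ((σ r).symm i)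

/-- The permutation of the rows in a given column. -/
def permAt (σ : RowPerm M d) : ∀ r, Equiv.Perm (Fin (d r))
  | 0 => 1
  | r + 1 => if h : r < M then σ ⟨r, h⟩ else 1

theorem act_one (f : Conf M d) : act 1 f = f := rfl

theorem fullConf_act (σ : RowPerm M d) (f : Conf M d) (r : ℕ) (p : Fin (d r)) :
    fullConf c (act σ f) r (permAt σ r p) = fullConf c f r p := by
  rcases r with _ | r
  · simp [fullConf, permAt]
  · by_cases h : r < M <;> simp [fullConf, permAt, h, act]

/-- A common form of the sets of pairs. -/
def pairsAt (M : ℕ) (d : ℕ → ℕ) (g : ℕ → ℕ → ℤ) (s : ℤ) (a b i k : ℕ) : Finset ℕ :=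
  (range M).filter fun r => i < d (r + a) ∧ k < d (r + b) ∧ g (r + b) k + s < g (r + a) i

theorem pairsT_eq (g : ℕ → ℕ → ℤ) (i k : ℕ) : pairsT M d g i k = pairsAt M d g 0 1 1 i k := by
  simp [pairsT, pairsAt]

theorem pairsY_eq (g : ℕ → ℕ → ℤ) (i k : ℕ) : pairsY M d g i k = pairsAt M d g 0 0 1 i k := by
  simp [pairsY, pairsAt]

theorem pairsX_eq (g : ℕ → ℕ → ℤ) (i k : ℕ) : pairsX c M d g i k = pairsAt M d g c 1 0 i k := by
  simp [pairsX, pairsAt]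

theorem pairsR_eq (g : ℕ → ℕ → ℤ) (i k : ℕ) : pairsR c M d g i k = pairsAt M d g c 1 1 i k := by
  simp [pairsR, pairsAt]

@[to_additive]
theorem prod_pow_card_pairsAt (hd : IsShape A M d) {R : Type*} [CommMonoid R] (w : ℕ → ℕ → R)
    (s : ℤ) (a b : ℕ) (σ : RowPerm M d) (f : Conf M d) :
    ∏ x ∈ range A ×ˢ range A,
        w x.1 x.2 ^ (pairsAt M d (fullConf c (act σ f)) s a b x.1 x.2).card =
      ∏ r ∈ range M, ∏ p : Fin (d (r + a)), ∏ q : Fin (d (r + b)),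
        if fullConf c f (r + b) q + s < fullConf c f (r + a) p then
          w (permAt σ (r + a) p) (permAt σ (r + b) q) else 1 := by
  simp only [← prod_const, pairsAt, prod_filter]
  rw [prod_comm]
  refine prod_congr rfl fun r _ => ?_
  have hr : ∀ a, range (d (r + a)) = (range A).filter fun i => i < d (r + a) := fun a => by
    ext i
    have := hd.le (r + a)
    simp only [mem_range, mem_filter]
    omega
  have h1 : ∏ p : Fin (d (r + a)), ∏ q : Fin (d (r + b)),
      (if fullConf c f (r + b) q + s < fullConf c f (r + a) p then
          w (permAt σ (r + a) p) (permAt σ (r + b) q) else 1) =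
      ∏ p : Fin (d (r + a)), ∏ q : Fin (d (r + b)),
      (if fullConf c (act σ f) (r + b) q + s < fullConf c (act σ f) (r + a) p then
          w p q else 1) := by
    conv_rhs => rw [← Equiv.prod_comp (permAt σ (r + a))]
    refine prod_congr rfl fun p _ => ?_
    conv_rhs => rw [← Equiv.prod_comp (permAt σ (r + b))]
    simp only [fullConf_act]
  rw [h1, prod_product, ← prod_range (fun i => ∏ q : Fin (d (r + b)),
      (if fullConf c (act σ f) (r + b) q + s < fullConf c (act σ f) (r + a) i then
          w i q else 1)), hr a, prod_filter]
  refine prod_congr rfl fun i _ => ?_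
  rw [← prod_range (fun k =>
      (if fullConf c (act σ f) (r + b) k + s < fullConf c (act σ f) (r + a) i then
          w i k else 1)), hr b, prod_filter]
  by_cases h : i < d (r + a)
  · rw [if_pos h]
    refine prod_congr rfl fun k _ => ?_
    by_cases h2 : k < d (r + b) <;> simp [h, h2]
  · rw [if_neg h]
    exact prod_eq_one fun k _ => if_neg fun h2 => h h2.1

theorem sum_card_pairsAt_act (hd : IsShape A M d) (s : ℤ) (a b : ℕ) (σ : RowPerm M d)
    (f : Conf M d) :
    ∑ x ∈ range A ×ˢ range A, (pairsAt M d (fullConf c (act σ f)) s a b x.1 x.2).card =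
      ∑ x ∈ range A ×ˢ range A, (pairsAt M d (fullConf c f) s a b x.1 x.2).card := by
  have h1 := sum_nsmul_card_pairsAt (c := c) hd (fun _ _ => 1) s a b σ f
  have h2 := sum_nsmul_card_pairsAt (c := c) hd (fun _ _ => 1) s a b 1 f
  simp only [smul_eq_mul, mul_one, act_one] at h1 h2
  rw [h1, h2]

variable {K : Type*} [Field K]

theorem polyDeg_permAt (r : ℕ) (p : Fin (d r)) :
    PolyDeg K (rowSize M d) 1 fun σ => ((permAt σ r p : ℕ) : K) := by
  rcases r with _ | r
  · exact PolyDeg.const (K := K) (n := rowSize M d) 1 ((p : ℕ) : K)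
  · by_cases h : r < M
    · simpa [permAt, h] using PolyDeg.coord (K := K) (n := rowSize M d) ⟨r, h⟩ p
    · simpa [permAt, h] using PolyDeg.const (K := K) (n := rowSize M d) 1 _

theorem polyDeg_pairsAt (hd : IsShape A M d) (s : ℤ) (a b : ℕ) (e : K) (f : Conf M d) :
    PolyDeg K (rowSize M d)
      (∑ x ∈ range A ×ˢ range A, (pairsAt M d (fullConf c f) s a b x.1 x.2).card)
      fun σ => ∏ x ∈ range A ×ˢ range A, ((x.2 : K) - (x.1 : K) + e) ^
        (pairsAt M d (fullConf c (act σ f)) s a b x.1 x.2).card := by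
  have h2 := sum_nsmul_card_pairsAt (c := c) hd (fun _ _ => 1) s a b 1 f
  simp only [smul_eq_mul, mul_one, act_one] at h2
  rw [h2]
  have h3 := fun σ => prod_pow_card_pairsAt (c := c) hd (fun i k => (k : K) - (i : K) + e) s a b σ f
  simp only [h3]
  refine PolyDeg.prod _ fun r _ => PolyDeg.prod _ fun p _ => PolyDeg.prod _ fun q _ => ?_
  split_ifs
  · exact ((polyDeg_permAt _ q).sub (polyDeg_permAt _ p)).add (PolyDeg.const 1 e)
  · exact PolyDeg.const 0 1

theorem seriesDeg_pairsAt (hd : IsShape A M d) (s : ℤ) (a b : ℕ) (e : K) (f : Conf M d) :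
    SeriesDeg K (rowSize M d)
      fun σ => ∏ x ∈ range A ×ˢ range A, (1 + C ((x.2 : K) - (x.1 : K) + e) * X) ^
        (pairsAt M d (fullConf c (act σ f)) s a b x.1 x.2).card := by
  have h3 := fun σ => prod_pow_card_pairsAt (c := c) hd
    (fun i k => (1 + C ((k : K) - (i : K) + e) * X : K⟦X⟧)) s a b σ f
  simp only [h3]
  refine SeriesDeg.prod _ fun r _ => SeriesDeg.prod _ fun p _ => SeriesDeg.prod _ fun q _ => ?_
  split_ifs
  · have := SeriesDeg.linear (K := K) (n := rowSize M d) 1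
      (((polyDeg_permAt _ q).sub (polyDeg_permAt _ p)).add (PolyDeg.const 1 e))
    simpa using this
  · exact SeriesDeg.const 1

theorem descentProd_eq (hd : IsShape A M d) (f : Conf M d) (σ : RowPerm M d) :
    descentProd K f σ = ∏ x ∈ range A ×ˢ range A, ((x.2 : K) - (x.1 : K)) ^
      (pairsT M d (fullConf c (act σ f)) x.1 x.2).card := by
  simp only [pairsT_eq]
  rw [prod_pow_card_pairsAt (c := c) hd (fun i k => (k : K) - (i : K)), prod_range, descentProd]
  refine prod_congr rfl fun r _ => ?_
  rw [descents, prod_filter, ← univ_product_univ, prod_product]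
  refine prod_congr rfl fun p _ => prod_congr rfl fun q _ => ?_
  simp [fullConf, permAt]

theorem sum_card_descents (hd : IsShape A M d) (f : Conf M d) :
    ∑ r, (descents (f r)).card =
      ∑ x ∈ range A ×ˢ range A, (pairsT M d (fullConf c f) x.1 x.2).card := by
  have h2 := sum_nsmul_card_pairsAt (c := c) hd (fun _ _ => 1) 0 1 1 1 f
  simp only [smul_eq_mul, mul_one, act_one] at h2
  simp only [pairsT_eq, h2]
  rw [sum_range]
  refine sum_congr rfl fun r _ => ?_
  rw [descents, card_filter, ← univ_product_univ, sum_product]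
  refine sum_congr rfl fun p _ => sum_congr rfl fun q _ => ?_
  simp [fullConf]

end Orbits

end

section

open Finset PowerSeries

/-! ### The contribution of the weights on the plane -/

section Numerator

variable {c A M : ℕ} {d : ℕ → ℕ} {K : Type*} [Field K]

/-- The total number of pairs of type `Y`. -/
def totalY (c A : ℕ) (f : Conf M d) : ℕ :=
  ∑ x ∈ range A ×ˢ range A, (pairsY M d (fullConf c f) x.1 x.2).card

/-- The total number of pairs of type `X` in excess of those of type `R` and `E`. -/
def totalExcess (c A : ℕ) (f : Conf M d) : ℕ :=
  ∑ x ∈ range A ×ˢ range A, (pairsX c M d (fullConf c f) x.1 x.2).card -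
    (∑ x ∈ range A ×ˢ range A, (pairsR c M d (fullConf c f) x.1 x.2).card +
      ∑ x ∈ range A ×ˢ range A, (pairsE c M d x.1 x.2).card)

theorem totalY_act (hd : IsShape A M d) (σ : RowPerm M d) (f : Conf M d) :
    totalY c A (act σ f) = totalY c A f := by
  simp only [totalY, pairsY_eq, sum_card_pairsAt_act hd]

theorem totalExcess_act (hd : IsShape A M d) (σ : RowPerm M d) (f : Conf M d) :
    totalExcess c A (act σ f) = totalExcess c A f := by
  simp only [totalExcess, pairsX_eq, pairsR_eq, sum_card_pairsAt_act hd]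

theorem sum_excess (hd : IsShape A M d) {f : Conf M d} (hf : RowMono M d (fullConf c f)) :
    ∑ x ∈ range A ×ˢ range A, excess c M d (fullConf c f) x.1 x.2 = totalExcess c A f := by
  rw [totalExcess, ← sum_add_distrib, ← sum_tsub_distrib]
  · rfl
  · exact fun x _ => hf.card_le hd (fun _ => rfl) _ _

/-- The value on a restricted partition of the factor from weights on the plane. -/
def lineValue (K : Type*) [Field K] (c A : ℕ) (f : Conf M d) : K :=
  (∏ x ∈ range A ×ˢ range A,
      ((x.2 : K) - (x.1 : K)) ^ (pairsY M d (fullConf c f) x.1 x.2).card) *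
    ∏ x ∈ range A ×ˢ range A,
      ((x.2 : K) - (x.1 : K) + -1) ^ excess c M d (fullConf c f) x.1 x.2

theorem prodY_eq_zero (hd : IsShape A M d) {f : Conf M d} (hf : ¬ RowMono M d (fullConf c f)) :
    ∏ x ∈ range A ×ˢ range A,
      ((x.2 : K) - (x.1 : K)) ^ (pairsY M d (fullConf c f) x.1 x.2).card = 0 := by
  obtain ⟨i, hi, h⟩ := exists_mem_pairsY hd hf
  refine prod_eq_zero (i := (i, i)) (by simpa using hi) ?_
  simp [h.card_ne_zero]

theorem prodExcess_eq_zero (hd : IsShape A M d) {f : Conf M d}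
    (hf : RowMono M d (fullConf c f)) (hf' : ¬ ColMono c M d (fullConf c f)) :
    ∏ x ∈ range A ×ˢ range A,
      ((x.2 : K) - (x.1 : K) + -1) ^ excess c M d (fullConf c f) x.1 x.2 = 0 := by
  obtain ⟨i, hi, h⟩ := hf.exists_excess_succ hd hf'
  refine prod_eq_zero (i := (i, i + 1)) (by simp; omega) ?_
  simp [h.ne']

/-- The generating series of the excess factors. -/
def excessSeries (K : Type*) [Field K] (c A : ℕ) (f : Conf M d) : K⟦X⟧ :=
  (∏ x ∈ range A ×ˢ range A, (1 + C ((x.2 : K) - (x.1 : K) + -1) * X) ^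
      (pairsX c M d (fullConf c f) x.1 x.2).card) *
    (∏ x ∈ range A ×ˢ range A, (1 + C ((x.2 : K) - (x.1 : K) + -1) * X) ^
      (pairsR c M d (fullConf c f) x.1 x.2).card)⁻¹ *
    (∏ x ∈ range A ×ˢ range A, (1 + C ((x.2 : K) - (x.1 : K) + -1) * X) ^
      (pairsE c M d x.1 x.2).card)⁻¹

theorem seriesDeg_excessSeries (hd : IsShape A M d) (f : Conf M d) :
    SeriesDeg K (rowSize M d) fun σ => excessSeries K c A (act σ f) := by
  simp only [excessSeries, pairsX_eq, pairsR_eq]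
  exact ((seriesDeg_pairsAt hd _ _ _ _ f).mul (seriesDeg_pairsAt hd _ _ _ _ f).inv).mul
    (SeriesDeg.const _)

theorem excessSeries_eq (hd : IsShape A M d) {f : Conf M d} (hf : RowMono M d (fullConf c f)) :
    excessSeries K c A f = ∏ x ∈ range A ×ˢ range A,
      (1 + C ((x.2 : K) - (x.1 : K) + -1) * X) ^ excess c M d (fullConf c f) x.1 x.2 := by
  have h : ∀ e : ℕ × ℕ → ℕ, constantCoeff (∏ x ∈ range A ×ˢ range A,
      (1 + C ((x.2 : K) - (x.1 : K) + -1) * X : K⟦X⟧) ^ e x) ≠ 0 := fun e => by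
    simp [map_prod]
  have h1 := fun x : ℕ × ℕ => hf.card_le hd (fun _ => rfl) x.1 x.2
  have h2 : ∀ x : ℕ × ℕ, (pairsX c M d (fullConf c f) x.1 x.2).card =
      excess c M d (fullConf c f) x.1 x.2 + (pairsR c M d (fullConf c f) x.1 x.2).card +
        (pairsE c M d x.1 x.2).card := fun x => by
    have := h1 x
    rw [excess]
    omega
  rw [excessSeries]
  simp only [h2, pow_add, prod_mul_distrib]
  have hR := PowerSeries.mul_inv_cancel _ (h fun x => (pairsR c M d (fullConf c f) x.1 x.2).card)
  have hE := PowerSeries.mul_inv_cancel _ (h fun x => (pairsE c M d x.1 x.2).card)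
  generalize (∏ x ∈ range A ×ˢ range A, (1 + C ((x.2 : K) - (x.1 : K) + -1) * X : K⟦X⟧) ^
    (pairsR c M d (fullConf c f) x.1 x.2).card) = PR at *
  generalize (∏ x ∈ range A ×ˢ range A, (1 + C ((x.2 : K) - (x.1 : K) + -1) * X : K⟦X⟧) ^
    (pairsE c M d x.1 x.2).card) = PE at *
  generalize PR⁻¹ = PR' at *
  generalize PE⁻¹ = PE' at *
  generalize (∏ x ∈ range A ×ˢ range A, (1 + C ((x.2 : K) - (x.1 : K) + -1) * X : K⟦X⟧) ^ _) = a
  linear_combination a * (PE * PE') * hR + a * hE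

theorem polyDeg_lineValue (hd : IsShape A M d) (f : Conf M d) :
    PolyDeg K (rowSize M d) (totalY c A f + totalExcess c A f) fun σ =>
      lineValue K c A (act σ f) := by
  have h1 := polyDeg_pairsAt (c := c) (K := K) hd 0 0 1 0 f
  simp only [add_zero, ← pairsY_eq] at h1
  have h := h1.mul (seriesDeg_excessSeries (c := c) hd f (totalExcess c A f))
  refine (congrArg (PolyDeg K (rowSize M d) _) (funext fun σ => ?_)).mpr h
  beta_reduce
  by_cases hσ : RowMono M d (fullConf c (act σ f))
  · rw [lineValue, excessSeries_eq hd hσ, ← totalExcess_act hd σ, ← sum_excess hd hσ,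
      coeff_prod_one_add_pow]
  · rw [lineValue, prodY_eq_zero hd hσ, zero_mul, zero_mul]

theorem lineValue_eq_zero (hd : IsShape A M d) {f : Conf M d}
    (hf : ¬ (RowMono M d (fullConf c f) ∧ ColMono c M d (fullConf c f))) :
    lineValue K c A f = 0 := by
  by_cases h : RowMono M d (fullConf c f)
  · rw [lineValue, prodExcess_eq_zero hd h fun h' => hf ⟨h, h'⟩, mul_zero]
  · rw [lineValue, prodY_eq_zero hd h, zero_mul]

theorem exists_excess_of_large (hd : IsShape A M d) {f : Conf M d} (σ : RowPerm M d) {r i : ℕ}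
    (hr : r ≤ M) (hi : i < d r) (h : (c * r : ℤ) < fullConf c f r i) :
    ∃ k < A, 0 < excess c M d (fullConf c (act σ f)) k k := by
  have h1 := fullConf_act (c := c) σ f r ⟨i, hi⟩
  have h2 := (permAt σ r ⟨i, hi⟩).2
  refine ⟨_, lt_of_lt_of_le h2 (hd.le r), exists_excess_self hd (fun _ => rfl) hr h2 ?_⟩
  rwa [h1]

theorem totalExcess_pos (hd : IsShape A M d) {f : Conf M d} (hf : RowMono M d (fullConf c f))
    {k : ℕ} (hk : k < A) (h : 0 < excess c M d (fullConf c f) k k) : 0 < totalExcess c A f := by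
  rw [← sum_excess hd hf]
  exact sum_pos' (fun _ _ => Nat.zero_le _) ⟨(k, k), by simpa using hk, h⟩

/-- A large value improves the degree bound. -/
theorem polyDeg_lineValue_of_large (hd : IsShape A M d) (f : Conf M d) {r i : ℕ}
    (hr : r ≤ M) (hi : i < d r) (h : (c * r : ℤ) < fullConf c f r i) :
    PolyDeg K (rowSize M d) (totalY c A f + (totalExcess c A f - 1)) fun σ =>
      lineValue K c A (act σ f) := by
  have h1 := polyDeg_pairsAt (c := c) (K := K) hd 0 0 1 0 f
  simp only [add_zero, ← pairsY_eq] at h1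
  have h2 := h1.mul (((seriesDeg_excessSeries (c := c) hd f).mul
    (SeriesDeg.const (1 + C (-1 : K) * X)⁻¹)).neg (totalExcess c A f - 1))
  refine (congrArg (PolyDeg K (rowSize M d) _) (funext fun σ => ?_)).mpr h2
  beta_reduce
  by_cases hσ : RowMono M d (fullConf c (act σ f))
  · obtain ⟨k, hk, hk'⟩ := exists_excess_of_large hd σ hr hi h
    set e : ℕ × ℕ → ℕ := fun x => excess c M d (fullConf c (act σ f)) x.1 x.2 with he
    obtain ⟨e', he'⟩ : ∃ e' : ℕ × ℕ → ℕ, ∀ x, e x = e' x + if x = (k, k) then 1 else 0 := by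
      refine ⟨fun x => e x - if x = (k, k) then 1 else 0, fun x => ?_⟩
      by_cases hx : x = (k, k)
      · subst hx
        have : 0 < e (k, k) := hk'
        simp only [if_true]
        omega
      · simp [hx]
    have hk2 : (k, k) ∈ range A ×ˢ range A := by simpa using hk
    have hprod : ∀ {R : Type _} [CommMonoid R] (w : ℕ × ℕ → R),
        ∏ x ∈ range A ×ˢ range A, w x ^ e x =
          (∏ x ∈ range A ×ˢ range A, w x ^ e' x) * w (k, k) := fun w => by
      simp only [he', pow_add, prod_mul_distrib, pow_ite, pow_one, pow_zero]
      rw [prod_ite_eq' (range A ×ˢ range A) (k, k) w, if_pos hk2]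
    have hsum : totalExcess c A f - 1 = ∑ x ∈ range A ×ˢ range A, e' x := by
      rw [← totalExcess_act hd σ, ← sum_excess hd hσ]
      change ∑ x ∈ range A ×ˢ range A, e x - 1 = _
      simp only [he', sum_add_distrib]
      rw [sum_ite_eq' (range A ×ˢ range A) (k, k), if_pos hk2, Nat.add_sub_cancel]
    have h3 := hprod fun x : ℕ × ℕ => (x.2 : K) - (x.1 : K) + -1
    have h4 := hprod fun x : ℕ × ℕ => (1 + C ((x.2 : K) - (x.1 : K) + -1) * X : K⟦X⟧)
    rw [lineValue, excessSeries_eq hd hσ]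
    change _ * (∏ x ∈ range A ×ˢ range A, _ ^ e x) =
      _ * coeff _ (-((∏ x ∈ range A ×ˢ range A, _ ^ e x) * _))
    rw [h3, h4, hsum, map_neg, mul_assoc (∏ x ∈ range A ×ˢ range A, _)]
    simp only [sub_self, zero_add]
    rw [PowerSeries.mul_inv_cancel _ (by simp), mul_one, coeff_prod_one_add_pow]
    ring
  · rw [lineValue, prodY_eq_zero hd hσ, zero_mul, zero_mul]

end Numerator

end

section

open Finset

/-! ### Families of restricted partitions -/

section Families

variable {c A M : ℕ} {d : ℕ → ℕ}

theorem sum_fullConf_act {R : Type*} [AddCommMonoid R] (F : ℕ → ℕ → ℤ → R) (σ : RowPerm M d)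
    (f : Conf M d) :
    ∑ r ∈ range (M + 1), ∑ i ∈ range (d r), F r i (fullConf c (act σ f) r i) =
      ∑ r ∈ range (M + 1), ∑ p : Fin (d r), F r (permAt σ r p) (fullConf c f r p) := by
  refine sum_congr rfl fun r _ => ?_
  rw [sum_range fun i => F r i (fullConf c (act σ f) r i),
    ← Equiv.sum_comp (permAt σ r)]
  simp only [fullConf_act]

/-- The character of the boxes between the constant filling `m` and the filling `g`. -/
def deepChar (c A M : ℕ) (d : ℕ → ℕ) (m : ℤ) (g : ℕ → ℕ → ℤ) : Char :=
  ∑ r ∈ range (M + 1), ∑ i ∈ range (d r), ∑ s ∈ range (g r i - m).toNat,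
    mono i (i + r - A) (-(g r i) - c * i + s)

theorem one_sub_mul_deepChar {m : ℤ} {g : ℕ → ℕ → ℤ} (hm : ∀ r ≤ M, ∀ i < d r, m ≤ g r i) :
    (1 - mono 0 0 1) * deepChar c A M d m g =
      rowChar c A M d g - rowChar c A M d fun _ _ => m := by
  rw [deepChar, rowChar, rowChar, mul_sum, ← sum_sub_distrib]
  refine sum_congr rfl fun r hr => ?_
  rw [mul_sum, ← sum_sub_distrib]
  refine sum_congr rfl fun i hi => ?_
  have h := hm r (Nat.lt_succ_iff.1 (mem_range.1 hr)) i (mem_range.1 hi)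
  have h2 := sum_range_sub' (fun s : ℕ => mono i (i + r - A) (-(g r i) - c * i + s))
    (g r i - m).toNat
  have h3 : -(g r i) - c * i + ((g r i - m).toNat : ℤ) = -m - c * i := by omega
  rw [h3, Nat.cast_zero, add_zero] at h2
  rw [← h2, mul_sum]
  refine sum_congr rfl fun s _ => ?_
  rw [sub_mul, one_mul, mono_mul]
  push_cast
  congr 2 <;> ring

theorem charFam_deepChar (m : ℤ) (f : Conf M d) :
    (fun σ => deepChar c A M d m (fullConf c (act σ f))) ∈ CharFam c (rowSize M d) := by
  have h : (fun σ => deepChar c A M d m (fullConf c (act σ f))) =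
      ∑ r ∈ range (M + 1), ∑ p : Fin (d r), ∑ s ∈ range (fullConf c f r p - m).toNat,
        fun σ : RowPerm M d => mono (permAt σ r p) (permAt σ r p + r - A)
          (-(fullConf c f r p) - c * (permAt σ r p) + s) := by
    funext σ
    simp only [Finset.sum_apply, deepChar]
    exact sum_fullConf_act (c := c) (fun r i v => ∑ s ∈ range (v - m).toNat,
      mono i (i + r - A) (-v - c * i + s)) σ f
  rw [h]
  refine AddSubgroup.sum_mem _ fun r _ => AddSubgroup.sum_mem _ fun p _ =>
    AddSubgroup.sum_mem _ fun s _ => ?_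
  refine CharFam.of (v := fun σ : RowPerm M d => ((permAt σ r p : ℤ), (permAt σ r p + r - A : ℤ),
    (-(fullConf c f r p) - c * (permAt σ r p) + s : ℤ))) ⟨⟨A - r, -(fullConf c f r p) + s +
      c * (r - A), fun σ => ⟨?_, ?_⟩⟩, ?_⟩
  · simp only; ring
  · simp only; ring
  · have := ((polyDeg_permAt (K := PlaneFrac) (M := M) r p).add
      (PolyDeg.const 1 (r : PlaneFrac))).sub (PolyDeg.const 1 (A : PlaneFrac))
    simpa using this

theorem exists_le_fullConf (hd : IsShape A M d) (f : Conf M d) :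
    ∃ m : ℤ, ∀ σ : RowPerm M d, ∀ r ≤ M, ∀ i < d r, m ≤ fullConf c (act σ f) r i := by
  obtain ⟨m, hm⟩ := Finset.exists_le
    ((range (M + 1) ×ˢ range A).image fun x => -fullConf c f x.1 x.2)
  refine ⟨-m, fun σ r hr i hi => ?_⟩
  obtain ⟨p, hp⟩ := (permAt σ r).surjective ⟨i, hi⟩
  have h := fullConf_act (c := c) σ f r p
  rw [hp] at h
  simp only at h
  rw [h]
  refine neg_le.1 (hm _ (mem_image.2 ⟨(r, p), ?_, rfl⟩))
  have := p.2
  have := hd.le r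
  simp only [mem_product, mem_range]
  omega

theorem one_sub_mono_ne_zero : (1 - mono 0 0 1 : Char) ≠ 0 := by
  intro h
  have h1 := congrArg (fun f : Char => f.coeff (0, 0, 1)) h
  simp [← mono_zero, mono, AddMonoidAlgebra.coeff_single] at h1

variable {μ : YoungDiagram}

/-- The fillings of the columns of the extended diagram of `μ`. -/
abbrev ShapeConf (μ : YoungDiagram) : Type := Conf (colCount μ) (rowsAt μ)

/-- The fillings that come from restricted partitions. -/
def IsPlane (c : ℕ) (f : ShapeConf μ) : Prop :=
  RowMono (colCount μ) (rowsAt μ) (fullConf c f) ∧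
    ColMono c (colCount μ) (rowsAt μ) (fullConf c f)

/-- The restricted partition of a filling. -/
def confBoxes (c : ℕ) (f : ShapeConf μ) : Finset (ℕ × ℕ × ℤ) := boxes c μ (fullConf c f)

theorem IsPlane.isRestricted {f : ShapeConf μ} (hf : IsPlane c f) :
    IsRestricted μ (confBoxes c f) := isRestricted_boxes hf.1 hf.2

theorem IsPlane.rowChar_eq {f : ShapeConf μ} (hf : IsPlane c f) :
    (1 - mono 0 0 1) * Qv (confBoxes c f) + Qe μ + extChar (rowCount μ) =
      rowChar c (rowCount μ) (colCount μ) (rowsAt μ) (fullConf c f) := by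
  rw [hf.isRestricted.rowChar_filling (c := c)]
  refine sum_congr rfl fun r hr => sum_congr rfl fun i hi => ?_
  rw [confBoxes, filling_boxes hf.1 hf.2 (fun _ => rfl) (Nat.lt_succ_iff.1 (mem_range.1 hr))
    (mem_range.1 hi)]

theorem exists_charFam_Qv (c : ℕ) (f : ShapeConf μ) :
    ∃ F ∈ CharFam c (rowSize (colCount μ) (rowsAt μ)), ∀ σ, IsPlane c (act σ f) →
      F σ = Qv (confBoxes c (act σ f)) := by
  obtain ⟨m, hm⟩ := exists_le_fullConf (c := c) (isShape_rowsAt μ) f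
  refine ⟨_, AddSubgroup.sub_mem _ (charFam_deepChar (A := rowCount μ) m f)
    (CharFam.const (deepChar c (rowCount μ) (colCount μ) (rowsAt μ) m fun _ i => -(c * i : ℤ))),
    fun σ hσ => mul_left_cancel₀ one_sub_mono_ne_zero ?_⟩
  have h0 : ∀ r ≤ colCount μ, ∀ i < rowsAt μ r, m ≤ -(c * i : ℤ) := fun r _ i hi =>
    hm 1 0 (Nat.zero_le _) i (lt_of_lt_of_le hi ((isShape_rowsAt μ).anti (Nat.zero_le r)))
  rw [Pi.sub_apply, mul_sub, one_sub_mul_deepChar (hm σ), one_sub_mul_deepChar h0,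
    ← hσ.rowChar_eq, ← Qe_add_extChar]
  ring

theorem exists_unitFam_expOff (c : ℕ) (f : ShapeConf μ) :
    ∃ F, UnitFam c (rowSize (colCount μ) (rowsAt μ)) F ∧ ∀ σ, IsPlane c (act σ f) →
      F σ = expOff c (-vertexChar μ (confBoxes c (act σ f))) := by
  obtain ⟨F, hF, h⟩ := exists_charFam_Qv c f
  have hE := CharFam.const (c := c) (n := rowSize (colCount μ) (rowsAt μ)) (Qe μ)
  have hk := fun g : Char => CharFam.const (c := c) (n := rowSize (colCount μ) (rowsAt μ)) g
  have hc := CharFam.conj hF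
  have hV := (AddSubgroup.add_mem _ (AddSubgroup.add_mem _ (AddSubgroup.sub_mem _ hF
    (CharFam.mul hc (hk (mono (-1) (-1) (-1))))) (CharFam.mul (CharFam.mul hF hc)
      (hk ((1 - mono 1 0 0) * (1 - mono 0 1 0) * (1 - mono 0 0 1) * mono (-1) (-1) (-1)))))
    (CharFam.mul (AddSubgroup.sub_mem _ (CharFam.mul (CharFam.mul hc hE) (hk (mono 0 0 (-1))))
      (CharFam.mul hF (CharFam.conj hE)))
      (hk ((1 - mono 1 0 0) * (1 - mono 0 1 0) * mono (-1) (-1) 0))))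
  refine ⟨_, CharFam.unitFam (AddSubgroup.neg_mem _ hV), fun σ hσ => ?_⟩
  simp only [Pi.neg_apply, Pi.add_apply, Pi.sub_apply, Pi.mul_apply, h σ hσ, vertexChar]

theorem exists_regFam_ch (c : ℕ) (f : ShapeConf μ) (k : ℕ) :
    ∃ F, RegFam c (rowSize (colCount μ) (rowsAt μ)) F ∧ ∀ σ, IsPlane c (act σ f) →
      F σ = ch k μ (confBoxes c (act σ f)) := by
  obtain ⟨F, hF, h⟩ := exists_charFam_Qv c f
  have hk := fun g : Char => CharFam.const (c := c) (n := rowSize (colCount μ) (rowsAt μ)) g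
  refine ⟨_, CharFam.regFam_coeff (CharFam.mul (hk ((1 - mono 1 0 0) * (1 - mono 0 1 0)))
    (AddSubgroup.add_mem _ (CharFam.mul (hk (1 - mono 0 0 1)) hF) (hk (Qe μ)))) k,
    fun σ hσ => ?_⟩
  simp only [Pi.add_apply, Pi.mul_apply, h σ hσ, ch, chSeries_eq]

end Families

end

section

open Finset PowerSeries

/-! ### Sums over orbits -/

section OrbitSums

variable {c : ℕ} {μ : YoungDiagram}

instance charZero_planeFrac : CharZero PlaneFrac :=
  charZero_of_injective_algebraMap (IsFractionRing.injective PlanePoly PlaneFrac)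

theorem prod_C_mul_X_pow {α K : Type*} [Field K] (s : Finset α) (a : α → K) (e : α → ℕ) :
    ∏ x ∈ s, (C (a x) * X : K⟦X⟧) ^ e x = C (∏ x ∈ s, a x ^ e x) * X ^ ∑ x ∈ s, e x := by
  simp only [mul_pow, prod_mul_distrib, prod_pow_eq_pow_sum, map_prod, map_pow]

theorem IsPlane.coeff_vertexChar {f : ShapeConf μ} (hf : IsPlane c f) (q : ℤ) :
    (vertexChar μ (confBoxes c f)).coeff (lineVec c q) =
      (∑ x ∈ range (rowCount μ) ×ˢ range (rowCount μ), if (x.2 : ℤ) - x.1 = q then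
        ((pairsT (colCount μ) (rowsAt μ) (fullConf c f) x.1 x.2).card : ℤ) -
          (pairsY (colCount μ) (rowsAt μ) (fullConf c f) x.1 x.2).card else 0) +
      ∑ x ∈ range (rowCount μ) ×ˢ range (rowCount μ), if (x.2 : ℤ) - x.1 - 1 = q then
        -(excess c (colCount μ) (rowsAt μ) (fullConf c f) x.1 x.2 : ℤ) else 0 :=
  PTVertex.coeff_vertexChar (isShape_rowsAt μ) (fun _ => rfl) (suppOn_Qe_content μ)
    hf.isRestricted.suppOn_Qv (Qe_add_extChar c μ) hf.rowChar_eq hf.1 q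

theorem IsPlane.coeff_zero {f : ShapeConf μ} (hf : IsPlane c f) :
    (vertexChar μ (confBoxes c f)).coeff 0 = 0 := by
  have h := hf.coeff_vertexChar 0
  have h0 : lineVec c 0 = 0 := by simp [lineVec]
  rw [h0] at h
  rw [h, sum_eq_zero, sum_eq_zero, add_zero]
  · rintro ⟨i, k⟩ _
    simp only
    split_ifs with h1
    · obtain rfl : k = i + 1 := by omega
      rw [hf.2.excess_succ]
      simp
    · rfl
  · rintro ⟨i, k⟩ _
    simp only
    split_ifs with h1
    · obtain rfl : k = i := by omega
      rw [hf.1.pairsY_self, pairsT_self]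
      simp
    · rfl

theorem IsPlane.expLine_eq {f : ShapeConf μ} (hf : IsPlane c f) :
    expLine c (-vertexChar μ (confBoxes c f)) =
      (∏ x ∈ range (rowCount μ) ×ˢ range (rowCount μ), if (x.2 : ℤ) - x.1 = 0 then 1 else
        weight (lineVec c ((x.2 : ℤ) - x.1)) ^
          (((pairsY (colCount μ) (rowsAt μ) (fullConf c f) x.1 x.2).card : ℤ) -
            (pairsT (colCount μ) (rowsAt μ) (fullConf c f) x.1 x.2).card)) *
      ∏ x ∈ range (rowCount μ) ×ˢ range (rowCount μ), if (x.2 : ℤ) - x.1 - 1 = 0 then 1 else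
        weight (lineVec c ((x.2 : ℤ) - x.1 - 1)) ^
          (excess c (colCount μ) (rowsAt μ) (fullConf c f) x.1 x.2 : ℤ) := by
  rw [expLine_eq_prod c ((range (rowCount μ) ×ˢ range (rowCount μ)).disjSum
    (range (rowCount μ) ×ˢ range (rowCount μ)))
    (Sum.elim (fun x => (x.2 : ℤ) - x.1) fun x => (x.2 : ℤ) - x.1 - 1)
    (Sum.elim (fun x => ((pairsY (colCount μ) (rowsAt μ) (fullConf c f) x.1 x.2).card : ℤ) -
      (pairsT (colCount μ) (rowsAt μ) (fullConf c f) x.1 x.2).card)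
      fun x => (excess c (colCount μ) (rowsAt μ) (fullConf c f) x.1 x.2 : ℤ)), prod_disjSum]
  · rfl
  · intro q _
    rw [AddMonoidAlgebra.coeff_neg, Finsupp.neg_apply, hf.coeff_vertexChar, sum_disjSum, neg_add,
      ← sum_neg_distrib, ← sum_neg_distrib]
    congr 1
    · refine sum_congr rfl fun x _ => ?_
      by_cases hx : (x.2 : ℤ) - x.1 = q
      · rw [if_pos hx]
        exact (neg_sub _ _).trans (if_pos hx).symm
      · rw [if_neg hx]
        exact neg_zero.trans (if_neg hx).symm
    · refine sum_congr rfl fun x _ => ?_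
      by_cases hx : (x.2 : ℤ) - x.1 - 1 = q
      · rw [if_pos hx]
        exact (neg_neg _).trans (if_pos hx).symm
      · rw [if_neg hx]
        exact neg_zero.trans (if_neg hx).symm

theorem prod_expand_weight (c : ℕ) (s : Finset (ℕ × ℕ)) (a : ℤ) (e : ℕ × ℕ → ℕ) :
    ∏ x ∈ s, expand c (weight (lineVec c ((x.2 : ℤ) - x.1 - a))) ^ e x =
      HahnSeries.ofPowerSeries ℤ PlaneFrac
        (C (∏ x ∈ s, ((x.2 : PlaneFrac) - (x.1 : PlaneFrac) - a) ^ e x) * X ^ ∑ x ∈ s, e x) := by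
  rw [← prod_C_mul_X_pow]
  simp only [map_prod, map_pow, expand_weight_lineVec, Int.cast_sub, Int.cast_natCast]

theorem prod_expand_ite (c : ℕ) (s : Finset (ℕ × ℕ)) (a : ℤ) (e e' : ℕ × ℕ → ℕ)
    (he : ∀ x : ℕ × ℕ, (x.2 : ℤ) - x.1 - a = 0 → e x = 0 ∧ e' x = 0) :
    (∏ x ∈ s, expand c (if (x.2 : ℤ) - x.1 - a = 0 then 1 else
      weight (lineVec c ((x.2 : ℤ) - x.1 - a)) ^ ((e' x : ℤ) - e x))) *
      ∏ x ∈ s, expand c (weight (lineVec c ((x.2 : ℤ) - x.1 - a))) ^ e x =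
      ∏ x ∈ s, expand c (weight (lineVec c ((x.2 : ℤ) - x.1 - a))) ^ e' x := by
  rw [← prod_mul_distrib]
  refine prod_congr rfl fun x _ => ?_
  split_ifs with hx
  · rw [(he x hx).1, (he x hx).2, pow_zero, map_one, mul_one]
  · have hw : expand c (weight (lineVec c ((x.2 : ℤ) - x.1 - a))) ≠ 0 := by
      rw [map_ne_zero]
      exact weight_ne_zero c fun h => hx (congrArg Prod.fst h)
    rw [map_zpow₀, zpow_sub₀ hw, zpow_natCast, zpow_natCast, div_mul_cancel₀ _ (pow_ne_zero _ hw)]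

theorem IsPlane.expand_expLine {f : ShapeConf μ} (hf : IsPlane c f) :
    expand c (expLine c (-vertexChar μ (confBoxes c f))) * HahnSeries.ofPowerSeries ℤ PlaneFrac
      (C (∏ x ∈ range (rowCount μ) ×ˢ range (rowCount μ), ((x.2 : PlaneFrac) - (x.1 : PlaneFrac)) ^
        (pairsT (colCount μ) (rowsAt μ) (fullConf c f) x.1 x.2).card) *
      X ^ ∑ x ∈ range (rowCount μ) ×ˢ range (rowCount μ),
        (pairsT (colCount μ) (rowsAt μ) (fullConf c f) x.1 x.2).card) =
    HahnSeries.ofPowerSeries ℤ PlaneFrac (C (lineValue PlaneFrac c (rowCount μ) f) *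
      X ^ (totalY c (rowCount μ) f + totalExcess c (rowCount μ) f)) := by
  have h2 := prod_expand_ite c (range (rowCount μ) ×ˢ range (rowCount μ)) 0
    (fun x => (pairsT (colCount μ) (rowsAt μ) (fullConf c f) x.1 x.2).card)
    (fun x => (pairsY (colCount μ) (rowsAt μ) (fullConf c f) x.1 x.2).card) fun x hx => by
      have h3 : x.2 = x.1 := by omega
      simp only [h3, pairsT_self, hf.1.pairsY_self, card_empty, and_self]
  have h3 := prod_expand_ite c (range (rowCount μ) ×ˢ range (rowCount μ)) 1 (fun _ => 0)
    (fun x => excess c (colCount μ) (rowsAt μ) (fullConf c f) x.1 x.2) fun x hx => by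
      have h3 : x.2 = x.1 + 1 := by omega
      simp only [h3, hf.2.excess_succ, and_self]
  simp only [pow_zero, prod_const_one, mul_one, Nat.cast_zero, sub_zero] at h3
  rw [prod_expand_weight, prod_expand_weight] at h2
  rw [prod_expand_weight] at h3
  simp only [Int.cast_zero, sub_zero, Int.cast_one] at h2 h3
  rw [hf.expLine_eq, map_mul, map_prod, map_prod, mul_right_comm, h2, h3, ← map_mul]
  simp only [lineValue, pow_add, ← sum_excess (isShape_rowsAt μ) hf.1, totalY, map_mul,
    ← sub_eq_add_neg]
  ring

open Classical in
/-- The contribution of a filling. -/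
def confTerm (c : ℕ) {m : ℕ} (k : Fin m → ℕ) (f : ShapeConf μ) : CohFrac :=
  if IsPlane c f then vertexWeight μ (confBoxes c f) * ∏ r, ch (k r) μ (confBoxes c f) else 0

theorem exists_seriesDeg_confTerm (c : ℕ) {m : ℕ} (k : Fin m → ℕ) (f : ShapeConf μ) :
    ∃ Φ, SeriesDeg PlaneFrac (rowSize (colCount μ) (rowsAt μ)) Φ ∧ ∀ σ,
      expand c (confTerm c k (act σ f)) * HahnSeries.ofPowerSeries ℤ PlaneFrac
        (X ^ ∑ r, (descents (f r)).card) =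
      HahnSeries.ofPowerSeries ℤ PlaneFrac
        (X ^ (totalY c (rowCount μ) f + totalExcess c (rowCount μ) f) *
          (C (lineValue PlaneFrac c (rowCount μ) (act σ f) / descentProd PlaneFrac f σ) *
            Φ σ)) := by
  have hd := isShape_rowsAt μ
  obtain ⟨U, hU, hU'⟩ := exists_unitFam_expOff c f
  choose F hF hF' using exists_regFam_ch c f
  obtain ⟨Φ, hΦ, hΦ'⟩ := hU.regFam.mul (RegFam.prod univ fun r _ => hF (k r))
  refine ⟨Φ, hΦ, fun σ => ?_⟩
  by_cases hσ : IsPlane c (act σ f)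
  · have h1 := hσ.expand_expLine
    have h2 := descentProd_eq (c := c) (K := PlaneFrac) hd f σ
    have h3 : descentProd PlaneFrac f σ ≠ 0 := by
      rw [h2]
      refine prod_ne_zero_iff.2 fun x _ => ?_
      by_cases hx : x.2 = x.1
      · rw [hx, pairsT_self]
        simp
      · refine pow_ne_zero _ (sub_ne_zero.2 ?_)
        exact_mod_cast hx
    have h4 := hΦ' σ
    beta_reduce at h4
    rw [hU' σ hσ, prod_congr rfl fun r _ => hF' (k r) σ hσ] at h4
    rw [← h2, totalY_act hd, totalExcess_act hd] at h1
    have h5 : ∑ x ∈ range (rowCount μ) ×ˢ range (rowCount μ),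
        (pairsT (colCount μ) (rowsAt μ) (fullConf c (act σ f)) x.1 x.2).card =
        ∑ r, (descents (f r)).card := by
      rw [sum_card_descents (c := c) hd f]
      simp only [pairsT_eq]
      exact sum_card_pairsAt_act hd _ _ _ σ f
    rw [h5] at h1
    rw [confTerm, if_pos hσ, vertexWeight, Exp_eq c (by simp [hσ.coeff_zero])]
    have h6 : HahnSeries.ofPowerSeries ℤ PlaneFrac (C (descentProd PlaneFrac f σ)) ≠ 0 := by
      rw [Ne, map_eq_zero_iff _ HahnSeries.ofPowerSeries_injective, _root_.map_eq_zero]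
      exact h3
    refine mul_right_cancel₀ h6 ?_
    have h7 : C (lineValue PlaneFrac c (rowCount μ) (act σ f) / descentProd PlaneFrac f σ) *
        C (descentProd PlaneFrac f σ) = C (lineValue PlaneFrac c (rowCount μ) (act σ f)) := by
      rw [← map_mul, div_mul_cancel₀ _ h3]
    have h8 := congrArg (HahnSeries.ofPowerSeries ℤ PlaneFrac) h7
    simp only [map_mul] at h1 h4 h8 ⊢
    linear_combination expand c (expOff c (-vertexChar μ (confBoxes c (act σ f)))) *
      expand c (∏ r, ch (k r) μ (confBoxes c (act σ f))) * h1 +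
      HahnSeries.ofPowerSeries ℤ PlaneFrac
        (C (lineValue PlaneFrac c (rowCount μ) (act σ f))) * HahnSeries.ofPowerSeries ℤ PlaneFrac
        (X ^ (totalY c (rowCount μ) f + totalExcess c (rowCount μ) f)) * h4 -
      HahnSeries.ofPowerSeries ℤ PlaneFrac
        (X ^ (totalY c (rowCount μ) f + totalExcess c (rowCount μ) f)) *
      HahnSeries.ofPowerSeries ℤ PlaneFrac (Φ σ) * h8
  · rw [confTerm, if_neg hσ, lineValue_eq_zero hd hσ]
    simp

theorem exists_expand_sum_orbit (c : ℕ) {m : ℕ} (k : Fin m → ℕ) (f : ShapeConf μ) :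
    ∃ P, expand c (∑ σ, confTerm c k (act σ f)) = HahnSeries.ofPowerSeries ℤ PlaneFrac P ∧
      ∀ r ≤ colCount μ, ∀ i < rowsAt μ r, (c * r : ℤ) < fullConf c f r i →
        constantCoeff P = 0 := by
  have hd := isShape_rowsAt μ
  obtain ⟨Φ, hΦ, h⟩ := exists_seriesDeg_confTerm c k f
  have h1 := congrArg (fun g => ∑ σ, g σ) (funext h)
  simp only [← sum_mul, ← map_sum, ← mul_sum] at h1
  have key : ∀ l ≤ totalY c (rowCount μ) f + totalExcess c (rowCount μ) f,
      PolyDeg PlaneFrac (rowSize (colCount μ) (rowsAt μ)) l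
        (fun σ => lineValue PlaneFrac c (rowCount μ) (act σ f)) →
      ∃ Q, expand c (∑ σ, confTerm c k (act σ f)) = HahnSeries.ofPowerSeries ℤ PlaneFrac
        (X ^ (totalY c (rowCount μ) f + totalExcess c (rowCount μ) f - l) * Q) := by
    intro l hl hp
    obtain ⟨Q, hQ⟩ := X_pow_dvd_sum_div_descentProd hp hl hΦ f
    refine ⟨Q, mul_right_cancel₀ (b := HahnSeries.ofPowerSeries ℤ PlaneFrac
        (X ^ ∑ r, (descents (f r)).card)) ?_ ?_⟩
    · rw [Ne, map_eq_zero_iff _ HahnSeries.ofPowerSeries_injective]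
      exact pow_ne_zero _ X_ne_zero
    · rw [h1, hQ, ← map_mul, pow_add]
      congr 1
      ring
  by_cases hbig : ∃ r ≤ colCount μ, ∃ i < rowsAt μ r, (c * r : ℤ) < fullConf c f r i
  · obtain ⟨r, hr, i, hi, hri⟩ := hbig
    by_cases hex : ∃ σ, IsPlane c (act σ f)
    · obtain ⟨σ, hσ⟩ := hex
      obtain ⟨j, hj, hj'⟩ := exists_excess_of_large hd σ hr hi hri
      have hpos := totalExcess_pos hd hσ.1 hj hj'
      rw [totalExcess_act hd] at hpos
      obtain ⟨Q, hQ⟩ := key _ (by omega) (polyDeg_lineValue_of_large hd f hr hi hri)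
      refine ⟨_, hQ, fun _ _ _ _ _ => ?_⟩
      rw [show totalY c (rowCount μ) f + totalExcess c (rowCount μ) f -
        (totalY c (rowCount μ) f + (totalExcess c (rowCount μ) f - 1)) = 1 by omega]
      simp
    · refine ⟨0, ?_, fun _ _ _ _ _ => map_zero _⟩
      rw [sum_eq_zero, map_zero, map_zero]
      exact fun σ _ => if_neg fun hσ => hex ⟨σ, hσ⟩
  · obtain ⟨Q, hQ⟩ := key _ le_rfl (polyDeg_lineValue hd f)
    exact ⟨_, hQ, fun r hr i hi hri => (hbig ⟨r, hr, i, hi, hri⟩).elim⟩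

end OrbitSums

end

section

open Finset

/-! ### Sums over restricted partitions -/

section RestrictedSums

variable {c : ℕ} {μ : YoungDiagram}

/-- The entries of a filling after the first column. -/
def toConf (μ : YoungDiagram) (g : ℕ → ℕ → ℤ) : ShapeConf μ := fun r i => g (r + 1) i

theorem fullConf_toConf {g : ℕ → ℕ → ℤ} (h0 : ∀ i, g 0 i = -(c * i : ℤ)) {r i : ℕ}
    (hr : r ≤ colCount μ) (hi : i < rowsAt μ r) : fullConf c (toConf μ g) r i = g r i := by
  rcases r with _ | r
  · exact (h0 i).symm
  · simp [fullConf, toConf, Nat.lt_of_succ_le hr, hi]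

theorem boxes_congr {g g' : ℕ → ℕ → ℤ}
    (h : ∀ r ≤ colCount μ, ∀ i < rowsAt μ r, g r i = g' r i) : boxes c μ g = boxes c μ g' := by
  ext ⟨i, j, l⟩
  rw [mem_boxes, mem_boxes]
  refine and_congr_right fun hij => ?_
  rw [h _ (le_colCount_of_mem hij).le _ (lt_rowsAt_of_mem hij)]

theorem isPlane_toConf {g : ℕ → ℕ → ℤ} (h0 : ∀ i, g 0 i = -(c * i : ℤ))
    (hr : RowMono (colCount μ) (rowsAt μ) g) (hc : ColMono c (colCount μ) (rowsAt μ) g) :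
    IsPlane c (toConf μ g) := by
  have hd := isShape_rowsAt μ
  constructor
  · intro r hrM i hi
    rw [fullConf_toConf h0 hrM.le (lt_of_lt_of_le hi (hd.succ_le r)), fullConf_toConf h0 hrM hi]
    exact hr r hrM i hi
  · intro r hrM i hi hi'
    rw [fullConf_toConf h0 hrM.le hi', fullConf_toConf h0 hrM hi]
    exact hc r hrM i hi hi'

/-- The number of boxes of a filling. -/
def confSize (c : ℕ) (f : ShapeConf μ) : ℤ :=
  ∑ r ∈ range (colCount μ + 1), ∑ i ∈ range (rowsAt μ r), (fullConf c f r i + c * i)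

theorem confSize_act (σ : RowPerm (colCount μ) (rowsAt μ)) (f : ShapeConf μ) :
    confSize c (act σ f) = confSize c f := by
  have h1 := sum_fullConf_act (c := c) (fun _ _ v => v) σ f
  have h2 := sum_fullConf_act (c := c) (fun _ _ v => v) 1 f
  rw [act_one] at h2
  simp only [confSize, sum_add_distrib]
  rw [h1, h2]

/-- The fillings of a given size with bounded entries. -/
def confSet (c : ℕ) (μ : YoungDiagram) (D : ℕ) : Finset (ShapeConf μ) :=
  (Fintype.piFinset fun _ => Fintype.piFinset fun _ =>
    Icc (-(c * rowCount μ : ℤ)) D).filter fun f => confSize c f = D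

theorem mem_confSet {D : ℕ} {f : ShapeConf μ} : f ∈ confSet c μ D ↔
    (∀ r i, -(c * rowCount μ : ℤ) ≤ f r i ∧ f r i ≤ D) ∧ confSize c f = D := by
  simp [confSet]

theorem act_mem_confSet {D : ℕ} {f : ShapeConf μ} (σ : RowPerm (colCount μ) (rowsAt μ))
    (hf : f ∈ confSet c μ D) : act σ f ∈ confSet c μ D := by
  rw [mem_confSet] at hf ⊢
  rw [confSize_act]
  exact ⟨fun r i => hf.1 r _, hf.2⟩

theorem height_le_card (B : Finset (ℕ × ℕ × ℤ)) (i j : ℕ) : height B i j ≤ B.card :=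
  card_filter_le _ _

theorem toConf_mem_confSet {B : Finset (ℕ × ℕ × ℤ)} (hB : IsRestricted μ B) :
    toConf μ (filling c μ B) ∈ confSet c μ B.card := by
  rw [mem_confSet]
  refine ⟨fun r i => ?_, ?_⟩
  · have h1 : (i : ℕ) < rowCount μ := lt_of_lt_of_le i.2 ((isShape_rowsAt μ).le _)
    have h2 : (c * (i : ℕ) : ℤ) ≤ c * rowCount μ := by gcongr
    have h3 : (0 : ℤ) ≤ c * (i : ℕ) := by positivity
    have h4 := height_le_card B i (i + (r + 1) - rowCount μ)
    simp only [toConf, filling]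
    split_ifs <;> omega
  · rw [← hB.card_eq (c := c), confSize]
    refine sum_congr rfl fun r hr => sum_congr rfl fun i hi => ?_
    rw [fullConf_toConf hB.filling_zero (Nat.lt_succ_iff.1 (mem_range.1 hr)) (mem_range.1 hi)]

theorem IsPlane.card_confBoxes {f : ShapeConf μ} (hf : IsPlane c f) :
    ((confBoxes c f).card : ℤ) = confSize c f := by
  rw [← hf.isRestricted.card_eq (c := c), confSize]
  refine sum_congr rfl fun r hr => sum_congr rfl fun i hi => ?_
  rw [confBoxes, filling_boxes hf.1 hf.2 (fun _ => rfl) (Nat.lt_succ_iff.1 (mem_range.1 hr))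
    (mem_range.1 hi)]

theorem IsPlane.toConf_filling {f : ShapeConf μ} (hf : IsPlane c f) :
    toConf μ (filling c μ (confBoxes c f)) = f := by
  funext r i
  rw [toConf, confBoxes, filling_boxes hf.1 hf.2 (fun _ => rfl) r.2 i.2]
  simp [fullConf]

theorem IsRestricted.confBoxes_toConf {B : Finset (ℕ × ℕ × ℤ)} (hB : IsRestricted μ B) :
    confBoxes c (toConf μ (filling c μ B)) = B := by
  rw [confBoxes, boxes_congr fun r hr i hi => fullConf_toConf hB.filling_zero hr hi,
    hB.boxes_filling]

theorem mem_restricted {D : ℕ} {B : Finset (ℕ × ℕ × ℤ)} :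
    B ∈ restricted μ D ↔ IsRestricted μ B ∧ B.card = D := by
  simp [restricted]

theorem sum_restricted (c : ℕ) {m : ℕ} (k : Fin m → ℕ) (D : ℕ) :
    ∑ B ∈ restricted μ D, vertexWeight μ B * ∏ r, ch (k r) μ B =
      ∑ f ∈ confSet c μ D, confTerm c k f := by
  classical
  simp only [confTerm]
  rw [← sum_filter]
  refine sum_bij' (fun B _ => toConf μ (filling c μ B)) (fun f _ => confBoxes c f)
    (fun B hB => ?_) (fun f hf => ?_) (fun B hB => ?_) (fun f hf => ?_) (fun B hB => ?_)
  · obtain ⟨hB', rfl⟩ := mem_restricted.1 hB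
    exact mem_filter.2 ⟨toConf_mem_confSet hB',
      isPlane_toConf hB'.filling_zero hB'.rowMono hB'.colMono⟩
  · obtain ⟨hf, hf'⟩ := mem_filter.1 hf
    refine mem_restricted.2 ⟨hf'.isRestricted, ?_⟩
    have h1 := hf'.card_confBoxes
    rw [(mem_confSet.1 hf).2] at h1
    exact_mod_cast h1
  · exact (mem_restricted.1 hB).1.confBoxes_toConf
  · exact (mem_filter.1 hf).2.toConf_filling
  · rw [(mem_restricted.1 hB).1.confBoxes_toConf]

theorem sum_sum_act {R : Type*} [AddCommMonoid R] (D : ℕ) (F : ShapeConf μ → R) :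
    ∑ f ∈ confSet c μ D, ∑ σ, F (act σ f) =
      Fintype.card (RowPerm (colCount μ) (rowsAt μ)) • ∑ f ∈ confSet c μ D, F f := by
  rw [sum_comm, ← card_univ, ← sum_const]
  refine sum_congr rfl fun σ _ => ?_
  refine sum_bij' (fun f _ => act σ f) (fun f _ => act σ⁻¹ f) (fun f hf => act_mem_confSet σ hf)
    (fun f hf => act_mem_confSet σ⁻¹ hf) (fun f _ => ?_) (fun f _ => ?_) fun _ _ => rfl
  · funext r i
    simp [act, Equiv.Perm.inv_def]
  · funext r i
    simp [act, Equiv.Perm.inv_def]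

/-- A bound for the sizes with nonzero contribution. -/
def sizeBound (c : ℕ) (μ : YoungDiagram) : ℕ :=
  ∑ r ∈ range (colCount μ + 1), ∑ i ∈ range (rowsAt μ r), (c * r + c * i)

theorem exists_large {D : ℕ} (hD : sizeBound c μ < D) {f : ShapeConf μ} (hf : f ∈ confSet c μ D) :
    ∃ r ≤ colCount μ, ∃ i < rowsAt μ r, (c * r : ℤ) < fullConf c f r i := by
  by_contra! hcon
  have h1 := (mem_confSet.1 hf).2
  have h2 : confSize c f ≤ sizeBound c μ := by
    rw [confSize, sizeBound]
    push_cast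
    refine sum_le_sum fun r hr => sum_le_sum fun i hi => ?_
    have := hcon r (Nat.lt_succ_iff.1 (mem_range.1 hr)) i (mem_range.1 hi)
    linarith
  omega

theorem exists_expand_sum_restricted (c : ℕ) (μ : YoungDiagram) {m : ℕ} (k : Fin m → ℕ) (D : ℕ) :
    ∃ P, expand c (∑ B ∈ restricted μ D, vertexWeight μ B * ∏ r, ch (k r) μ B) =
      HahnSeries.ofPowerSeries ℤ PlaneFrac P ∧
        (sizeBound c μ < D → PowerSeries.constantCoeff P = 0) := by
  choose P hP hP' using exists_expand_sum_orbit (μ := μ) c k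
  set N := Fintype.card (RowPerm (colCount μ) (rowsAt μ)) with hN
  have hN0 : (N : PlaneFrac) ≠ 0 := Nat.cast_ne_zero.2 Fintype.card_ne_zero
  refine ⟨PowerSeries.C (N : PlaneFrac)⁻¹ * ∑ f ∈ confSet c μ D, P f, ?_, fun hD => ?_⟩
  · have h1 := congrArg (expand c) (sum_sum_act (c := c) D (confTerm (μ := μ) c k))
    rw [map_sum, sum_congr rfl fun f _ => hP f, ← map_sum, ← sum_restricted, map_nsmul,
      nsmul_eq_mul] at h1
    rw [map_mul, h1, ← mul_assoc, ← map_natCast (HahnSeries.ofPowerSeries ℤ PlaneFrac),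
      ← map_natCast PowerSeries.C, ← map_mul, ← map_mul, inv_mul_cancel₀ hN0, map_one, map_one,
      one_mul]
  · rw [map_mul, map_sum, sum_eq_zero, mul_zero]
    intro f hf
    obtain ⟨r, hr, i, hi, h⟩ := exists_large hD hf
    exact hP' f r hr i hi h

end RestrictedSums

/-! ### The specialization of the vertex -/

/-- The rational functions that are regular along the plane. -/
def regSubring (c : ℕ) : Subring CohFrac :=
  (HahnSeries.ofPowerSeries ℤ PlaneFrac).range.comap (expand c)

theorem mem_regSubring {c : ℕ} {f : CohFrac} :
    f ∈ regSubring c ↔ ∃ P, HahnSeries.ofPowerSeries ℤ PlaneFrac P = expand c f := Iff.rfl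

theorem weight_mem_regSubring (c : ℕ) (v : ℤ × ℤ × ℤ) : weight v ∈ regSubring c :=
  mem_regSubring.2 ⟨_, (expand_weight c v).symm⟩

theorem algebraMap_mem_regSubring (c : ℕ) (p : CohPt) :
    algebraMap CohPt CohFrac p ∈ regSubring c :=
  mem_regSubring.2 ⟨_, (expand_algebraMap c p).symm⟩

theorem chern_mem_regSubring (c n r : ℕ) (μ : Part n) : chern n r μ ∈ regSubring c := by
  refine multiset_sum_mem _ fun x hx => ?_
  obtain ⟨s, hs, rfl⟩ := Multiset.mem_map.1 hx
  refine multiset_prod_mem _ fun y hy => ?_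
  obtain ⟨b, _, rfl⟩ := Multiset.mem_map.1
    (Multiset.mem_of_le (Multiset.mem_powersetCard.1 hs).1 hy)
  exact weight_mem_regSubring c _

theorem cohHilb_mem_regSubring (c : ℕ) {n : ℕ} (ω : cohHilb n) (μ : Part n) :
    ω.1 μ ∈ regSubring c := by
  obtain ⟨ω, hω⟩ := ω
  simp only
  unfold cohHilb at hω
  induction hω using Algebra.adjoin_induction with
  | mem x hx =>
    obtain ⟨r, rfl⟩ := hx
    exact chern_mem_regSubring c n r μ
  | algebraMap p => exact algebraMap_mem_regSubring c p
  | add x y _ _ hx hy => exact (regSubring c).add_mem hx hy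
  | mul x y _ _ hx hy => exact (regSubring c).mul_mem hx hy

theorem inv_eulerHilb_mem_regSubring (c : ℕ) (μ : YoungDiagram) :
    (eulerHilb μ)⁻¹ ∈ regSubring c := by
  by_cases h0 : (-Fe μ).coeff 0 = 0
  · have h1 : expLine c (-Fe μ) = 1 := by
      rw [expLine_eq_prod c (∅ : Finset ℕ) (fun _ => 0) fun _ => 0]
      · rfl
      · intro q hq
        rw [AddMonoidAlgebra.coeff_neg, Finsupp.neg_apply, coeff_Fe (isShape_rowsAt μ)
          (suppOn_Qe_content μ) (Qe_add_extChar c μ) hq]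
        rfl
    obtain ⟨Φ, -, h2⟩ := (CharFam.unitFam (CharFam.const (c := c) (n := fun _ : Fin 0 => 0)
      (-Fe μ))).inv.regFam
    rw [eulerHilb, Exp_eq c h0, h1, mul_one]
    exact mem_regSubring.2 ⟨_, (h2 1).symm⟩
  · have h1 : eulerHilb μ = 0 := by
      refine Finset.prod_eq_zero (i := 0) (Finsupp.mem_support_iff.2 h0) ?_
      have h2 : weight 0 = 0 := by simp [weight]
      simp only [h2]
      exact zero_zpow _ h0
    rw [h1, inv_zero]
    exact (regSubring c).zero_mem

theorem exists_expand_coeff_bareVertex {n m : ℕ} (c : ℕ) (i : Fin m → ℕ) (ω : cohHilb n) (d : ℕ) :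
    ∃ P, expand c (PowerSeries.coeff d (bareVertex i ω)) =
      HahnSeries.ofPowerSeries ℤ PlaneFrac P ∧
        (∑ μ : Part n, sizeBound c μ.1 < d → PowerSeries.constantCoeff P = 0) := by
  choose P hP hP' using fun μ : Part n => exists_expand_sum_restricted c μ.1 i d
  choose Q hQ using fun μ : Part n => mem_regSubring.1 ((regSubring c).mul_mem
    (cohHilb_mem_regSubring c ω μ) (inv_eulerHilb_mem_regSubring c μ.1))
  refine ⟨∑ μ, Q μ * P μ, ?_, fun hd => ?_⟩
  · simp only [bareVertex, PowerSeries.coeff_mk, div_eq_mul_inv]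
    rw [map_sum, map_sum]
    refine sum_congr rfl fun μ _ => ?_
    rw [map_mul, hP, map_mul (HahnSeries.ofPowerSeries ℤ PlaneFrac), hQ]
  · rw [map_sum]
    refine sum_eq_zero fun μ _ => ?_
    rw [map_mul, hP' μ, mul_zero]
    exact lt_of_le_of_lt (single_le_sum (f := fun μ : Part n => sizeBound c μ.1)
      (fun _ _ => Nat.zero_le _) (mem_univ μ)) hd

/-- A power series with finitely many nonzero coefficients is a rational function. -/
theorem exists_ratFunc_eq {K : Type*} [Field K] {Z : PowerSeries K} {N : ℕ}
    (h : ∀ d, N < d → PowerSeries.coeff d Z = 0) :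
    ∃ R : RatFunc K, (R : LaurentSeries K) = (Z : LaurentSeries K) := by
  refine ⟨((PowerSeries.trunc (N + 1) Z : Polynomial K) : RatFunc K), ?_⟩
  rw [← RatFunc.coe_coe]
  congr 1
  ext d
  rw [Polynomial.coeff_coe, PowerSeries.coeff_trunc]
  split_ifs with hd
  · rfl
  · exact (h d (by omega)).symm

end

end PTVertex

end

theorem mainTheorem7 (n c m : ℕ) (i : Fin m → ℕ) (ω : PTVertex.cohHilb n) :
    ∃ Z : PowerSeries PTVertex.PlaneFrac,
      (∀ d : ℕ, PTVertex.SpecializesTo c (PowerSeries.coeff d (PTVertex.bareVertex i ω))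
        (PowerSeries.coeff d Z)) ∧
      ∃ R : RatFunc PTVertex.PlaneFrac,
        (R : LaurentSeries PTVertex.PlaneFrac) = (Z : LaurentSeries PTVertex.PlaneFrac) := by
  choose P hP hP' using PTVertex.exists_expand_coeff_bareVertex c i ω
  refine ⟨PowerSeries.mk fun d => PowerSeries.constantCoeff (P d), fun d => ?_,
    PTVertex.exists_ratFunc_eq (N := ∑ μ : PTVertex.Part n, PTVertex.sizeBound c μ.1)
      fun d hd => ?_⟩
  · rw [PowerSeries.coeff_mk]
    exact PTVertex.specializesTo_of_expand (hP d)
  · rw [PowerSeries.coeff_mk]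
    exact hP' d hd
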